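/- Let $G$ be a group and $k$ a field; write $\mathrm{Vect}_k$ for the tensor category of finite-dimensional $k$-vector spaces. \textbf{Crossed $G$-categories.} A crossed $G$-category is a tensor (monoidal) category $\mathcal C$, not necessarily strict, which is a disjoint union of subcategories $\mathcal C_\alpha$ ($\alpha\in G$) with $\mathcal C_\alpha\otimes\mathcal C_\beta\subset\mathcal C_{\alpha\beta}$, together with a group homomorphism $\beta\mapsto\Phi_\beta$ from $G$ to the group of strict tensor automorphisms of $\mathcal C$ such that $\Phi_\beta(\mathcal C_\alpha)=\mathcal C_{\beta\alpha\beta^{-1}}$. It is autonomous if it has a choice of left duals and of right duals that is preserved by every $\Phi_\beta$ (dual objects, evaluations and coevaluations). It is $k$-linear abelian if every $\mathcal C_\alpha$ is a $k$-linear abelian category and the functors $U\otimes-$, $-\otimes U$ and $\Phi_\beta$ are additive and exact on the components. A fiber crossed $G$-functor on such a $\mathcal C$ is a faithful (strong) tensor functor $F\colon\mathcal C\to\mathrm{Vect}_k$ whose restrictions $F_\alpha=F|_{\mathcal C_\alpha}$ are $k$-linear and exact, with tensor (monoidal) natural isomorphisms $\dot\varphi_\beta\colon F\to F\circ\Phi_\beta$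 such that $\dot\varphi_1=\mathrm{id}$ and $(\dot\varphi_{\beta_1})_{\Phi_{\beta_2}(U)}\circ(\dot\varphi_{\beta_2})_U=(\dot\varphi_{\beta_1\beta_2})_U$. A Tannakian crossed $G$-category is a triple $(\mathcal C,F,\dot\varphi)$ where $\mathcal C$ is an autonomous $k$-linear abelian crossed $G$-category and $(F,\dot\varphi)$ is a fiber crossed $G$-functor. An equivalence of Tannakian crossed $G$-categories $(\mathcal C,X,\dot\varphi)\to(\mathcal D,Y,\dot\psi)$ is a tensor functor $E\colon\mathcal C\to\mathcal D$ that is an equivalence of categories and preserves the components, with isomorphisms $\kappa_\beta\colon E\circ\Phi_\beta\cong\Phi_\beta\circ E$ that are compatible with products in $G$ and with the tensor structure, such that $X=Y\circ E$ as tensor functors and $Y((\kappa_\beta)_U)\circ(\dot\varphi_\beta)_U=(\dot\psi_\beta)_{E(U)}$. \textbf{Crossed Hopf $G$-algebras.} A crossed Hopf $G$-algebra over $k$ is a family $H=\{H_\alpha\}_{\alpha\in G}$ of $k$-coalgebras with coalgebra morphisms $H_\alpha\otimes H_\beta\to H_{\alpha\beta}$, $h\otimes h'\mapsto hh'$, associative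 and with a grouplike unit $1\in H_1$; coalgebra isomorphisms $\varphi_\beta\colon H_\alpha\to H_{\beta\alpha\beta^{-1}}$ which preserve products and the unit and satisfy $\varphi_{\beta\gamma}=\varphi_\beta\circ\varphi_\gamma$; and linear isomorphisms $S_\alpha\colon H_\alpha\to H_{\alpha^{-1}}$ (the antipode) with $S_\alpha(h')h''=\varepsilon(h)1=h'S_\alpha(h'')$. The category $\mathrm{Com}\,H$ is the crossed $G$-category whose $\alpha$-th component is the category of finite-dimensional left $H_\alpha$-comodules. The unit is $k$ with $c\mapsto 1\otimes c$. The coaction on $M\otimes N$ is $m\otimes n\mapsto m_\alpha n_\beta\otimes m_M\otimes n_N$. The comodule $\Phi_\beta(M)$ is the space $M$ with coaction $m\mapsto\varphi_\beta(m_\alpha)\otimes m_M$. It carries the forgetful functor to $\mathrm{Vect}_k$, with the identity maps $M\to\Phi_\beta(M)$ as $\dot\varphi_\beta$. For a functor $X\colon\mathcal D\to\mathrm{Vect}_k$, let $\mathrm{End}^\vee(X)$ be the coend of $\mathrm{Hom}(X(-),X(-))$: the quotient of $\bigoplus_A\mathrm{End}(X(A))$ by the relations $[h\circ X(f)]=[X(f)\circ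 h]$ for $f\colon A\to B$ and $h\colon X(B)\to X(A)$. It is a coalgebra with counit $\varepsilon[h]=\mathrm{Tr}(h)$ and comultiplication $\Delta[\xi\otimes v]=\sum_l[e_l^*\otimes v]\otimes[\xi\otimes e_l]$, for $v\in X(A)$, $\xi\in X(A)^*$ and a basis $(e_l)$ of $X(A)$, where $\xi\otimes v$ denotes the endomorphism $x\mapsto\xi(x)v$ of $X(A)$. \textbf{Theorem.} Let $(\mathcal C,F,\{\dot\varphi_\beta\}_{\beta\in G})$ be a Tannakian crossed $G$-category with $\mathcal C$ small. There is a crossed Hopf $G$-algebra $H=H(\mathcal C)$, with $H_\alpha\cong\mathrm{End}^\vee(F_\alpha)$ as coalgebras for all $\alpha\in G$, such that $\mathrm{Com}\,H$ is a Tannakian crossed $G$-category and $\mathcal C$ is equivalent to $\mathrm{Com}\,H$ as a Tannakian crossed $G$-category. It is unique up to isomorphism: every crossed Hopf $G$-algebra $K$ such that $\mathcal C$ is equivalent to $\mathrm{Com}\,K$ as a Tannakian crossed $G$-category is isomorphic to $H$. -/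

import Mathlib

open CategoryTheory MonoidalCategory TensorProduct Coalgebra

universe uG w t t' u v u' v'

/-! ### Crossed Hopf `G`-algebras -/

/-- A crossed Hopf `G`-algebra over a field `k`: a family of coalgebras `H α` (`α : G`) with
multiplications `H α ⊗ H β → H (αβ)`, a unit, conjugation isomorphisms
`φ_β : H α ≃ H (β α β⁻¹)` and an (invertible) antipode `S_α : H α ≃ H α⁻¹`.
`LinearEquiv.cast` is the transport `H α ≃ H β` along an equality `α = β` in `G`. -/
structure CrossedHopfAlgebra (G : Type uG) [Group G] (k : Type w) [Field k] where
  /-- the `α`-th component -/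
  comp : G → Type t
  [instAddCommGroup : ∀ a, AddCommGroup (comp a)]
  [instModule : ∀ a, Module k (comp a)]
  [instCoalgebra : ∀ a, Coalgebra k (comp a)]
  /-- the multiplication, a morphism of coalgebras -/
  mul : ∀ a b, comp a ⊗[k] comp b →ₗc[k] comp (a * b)
  mul_assoc : ∀ a b c (x : comp a) (y : comp b) (z : comp c),
    LinearEquiv.cast (R := k) (M := comp) (_root_.mul_assoc a b c)
      (mul (a * b) c (mul a b (x ⊗ₜ y) ⊗ₜ z)) = mul a (b * c) (x ⊗ₜ mul b c (y ⊗ₜ z))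
  /-- the unit `1 = η(1)`; it is grouplike -/
  one : comp 1
  counit_one : counit (R := k) one = 1
  comul_one : comul (R := k) one = one ⊗ₜ[k] one
  one_mul : ∀ a (x : comp a),
    LinearEquiv.cast (R := k) (M := comp) (_root_.one_mul a) (mul 1 a (one ⊗ₜ x)) = x
  mul_one : ∀ a (x : comp a),
    LinearEquiv.cast (R := k) (M := comp) (_root_.mul_one a) (mul a 1 (x ⊗ₜ one)) = x
  /-- the conjugation `φ_β`, by isomorphisms of coalgebras -/
  conj : ∀ b a, comp a ≃ₗc[k] comp (b * a * b⁻¹)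
  conj_mul : ∀ c a b (x : comp a) (y : comp b),
    LinearEquiv.cast (R := k) (M := comp)
        (show c * (a * b) * c⁻¹ = (c * a * c⁻¹) * (c * b * c⁻¹) by group)
      (conj c (a * b) (mul a b (x ⊗ₜ y))) = mul _ _ (conj c a x ⊗ₜ conj c b y)
  conj_one : ∀ c, LinearEquiv.cast (R := k) (M := comp) (show c * 1 * c⁻¹ = 1 by group)
    (conj c 1 one) = one
  conj_conj : ∀ b c a (x : comp a),
    LinearEquiv.cast (R := k) (M := comp)
        (show b * c * a * (b * c)⁻¹ = b * (c * a * c⁻¹) * b⁻¹ by group)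
      (conj (b * c) a x) = conj b _ (conj c a x)
  /-- the antipode -/
  antipode : ∀ a, comp a ≃ₗ[k] comp a⁻¹
  antipode_mul : ∀ a (x : comp a),
    LinearEquiv.cast (R := k) (M := comp) (inv_mul_cancel a)
      (mul a⁻¹ a ((antipode a).toLinearMap.rTensor (comp a) (comul (R := k) x)))
      = counit (R := k) x • one
  mul_antipode : ∀ a (x : comp a),
    LinearEquiv.cast (R := k) (M := comp) (mul_inv_cancel a)
      (mul a a⁻¹ ((antipode a).toLinearMap.lTensor (comp a) (comul (R := k) x)))
      = counit (R := k) x • one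

namespace CrossedHopfAlgebra

attribute [instance] instAddCommGroup instModule instCoalgebra

variable {G : Type uG} [Group G] {k : Type w} [Field k]

/-- An isomorphism of crossed Hopf `G`-algebras. -/
structure Iso (H : CrossedHopfAlgebra.{uG, w, t} G k) (K : CrossedHopfAlgebra.{uG, w, t'} G k) where
  equiv : ∀ a, H.comp a ≃ₗc[k] K.comp a
  map_mul : ∀ a b (x : H.comp a) (y : H.comp b),
    equiv (a * b) (H.mul a b (x ⊗ₜ y)) = K.mul a b (equiv a x ⊗ₜ equiv b y)
  map_one : equiv 1 H.one = K.one
  map_conj : ∀ b a (x : H.comp a), equiv _ (H.conj b a x) = K.conj b a (equiv a x)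
  map_antipode : ∀ a (x : H.comp a), equiv _ (H.antipode a x) = K.antipode a (equiv a x)

end CrossedHopfAlgebra

/-! ### Crossed `G`-categories -/

/-- The structure of a crossed `G`-category on a tensor category `C`.  The decomposition of `C` as
a disjoint union of subcategories `C_α` is given by the degree function `deg : C → G`
(`C_α` consists of the objects of degree `α`, and there are no arrows between different components);
the conjugation is an action of `G` on `C` by strict tensor automorphisms. -/
structure CrossedCat (G : Type uG) [Group G] (C : Type u) [Category.{v} C]
    [MonoidalCategory C] where
  deg : C → G
  deg_eq_of_hom : ∀ {U V : C}, (U ⟶ V) → deg U = deg V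
  deg_tensor : ∀ U V : C, deg (U ⊗ V) = deg U * deg V
  /-- the conjugation `Φ` -/
  conj : G → C ⥤ C
  conj_one : conj 1 = 𝟭 C
  conj_mul : ∀ a b, conj (a * b) = conj b ⋙ conj a
  deg_conj : ∀ b U, deg ((conj b).obj U) = b * deg U * b⁻¹
  conj_unit : ∀ b, (conj b).obj (𝟙_ C) = 𝟙_ C
  conj_tensor : ∀ b (U V : C), (conj b).obj (U ⊗ V) = (conj b).obj U ⊗ (conj b).obj V
  conj_tensorHom : ∀ b {U U' V V' : C} (f : U ⟶ U') (g : V ⟶ V'),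
    (conj b).map (f ⊗ₘ g) = eqToHom (conj_tensor b U V) ≫
      ((conj b).map f ⊗ₘ (conj b).map g) ≫ eqToHom (conj_tensor b U' V').symm
  conj_associator : ∀ b (U V W : C),
    (conj b).map (α_ U V W).hom =
      eqToHom (by rw [conj_tensor, conj_tensor]) ≫
        (α_ ((conj b).obj U) ((conj b).obj V) ((conj b).obj W)).hom ≫
          eqToHom (by rw [conj_tensor, conj_tensor])
  conj_leftUnitor : ∀ b (U : C),
    (conj b).map (λ_ U).hom =
      eqToHom (by rw [conj_tensor, conj_unit]) ≫ (λ_ ((conj b).obj U)).hom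
  conj_rightUnitor : ∀ b (U : C),
    (conj b).map (ρ_ U).hom =
      eqToHom (by rw [conj_tensor, conj_unit]) ≫ (ρ_ ((conj b).obj U)).hom

namespace CrossedCat

variable {G : Type uG} [Group G] {C : Type u} [Category.{v} C] [MonoidalCategory C]

/-- The `α`-th component `C_α`. -/
abbrev Component (X : CrossedCat G C) (a : G) : Type u :=
  ObjectProperty.FullSubcategory (fun U : C => X.deg U = a)

/-- The inclusion of the `α`-th component. -/
abbrev incl (X : CrossedCat G C) (a : G) : X.Component a ⥤ C :=
  ObjectProperty.ι (fun U : C => X.deg U = a)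

/-- The functor `U ⊗ _ : C_γ ⥤ C_{αγ}`, for `U` of degree `α`. -/
def tensorLeftComp (X : CrossedCat G C) (U : C) (c : G) :
    X.Component c ⥤ X.Component (X.deg U * c) :=
  ObjectProperty.lift _ (X.incl c ⋙ tensorLeft U) (fun V => by
    change X.deg (U ⊗ V.obj) = _
    rw [X.deg_tensor, V.property])

/-- The functor `_ ⊗ U : C_γ ⥤ C_{γα}`, for `U` of degree `α`. -/
def tensorRightComp (X : CrossedCat G C) (U : C) (c : G) :
    X.Component c ⥤ X.Component (c * X.deg U) :=
  ObjectProperty.lift _ (X.incl c ⋙ tensorRight U) (fun V => by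
    change X.deg (V.obj ⊗ U) = _
    rw [X.deg_tensor, V.property])

/-- The functor `Φ_β : C_γ ⥤ C_{βγβ⁻¹}`. -/
def conjComp (X : CrossedCat G C) (b c : G) : X.Component c ⥤ X.Component (b * c * b⁻¹) :=
  ObjectProperty.lift _ (X.incl c ⋙ X.conj b) (fun V => by
    change X.deg ((X.conj b).obj V.obj) = _
    rw [X.deg_conj, V.property])

/-- A crossed `G`-category is autonomous: there is a choice of left duals
`(U*, b_U : 𝟙 ⟶ U ⊗ U*, d_U : U* ⊗ U ⟶ 𝟙)` and of right duals
`(*U, b'_U : 𝟙 ⟶ *U ⊗ U, d'_U : U ⊗ *U ⟶ 𝟙)`, both compatible with the conjugation.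
(In an `ExactPairing X Y`, the coevaluation is `η_ X Y : 𝟙 ⟶ X ⊗ Y`, and the evaluation is
`ε_ X Y : Y ⊗ X ⟶ 𝟙`.) -/
structure Autonomous (X : CrossedCat G C) where
  leftDual : C → C
  leftPairing : ∀ U, ExactPairing U (leftDual U)
  conj_leftDual : ∀ b U, (X.conj b).obj (leftDual U) = leftDual ((X.conj b).obj U)
  conj_left_coev : ∀ b U,
    (X.conj b).map (η_ U (leftDual U)) =
      eqToHom (X.conj_unit b) ≫ η_ ((X.conj b).obj U) (leftDual ((X.conj b).obj U)) ≫
        eqToHom (by rw [X.conj_tensor, conj_leftDual])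
  conj_left_ev : ∀ b U,
    (X.conj b).map (ε_ U (leftDual U)) =
      eqToHom (by rw [X.conj_tensor, conj_leftDual]) ≫
        ε_ ((X.conj b).obj U) (leftDual ((X.conj b).obj U)) ≫ eqToHom (X.conj_unit b).symm
  rightDual : C → C
  rightPairing : ∀ U, ExactPairing (rightDual U) U
  conj_rightDual : ∀ b U, (X.conj b).obj (rightDual U) = rightDual ((X.conj b).obj U)
  conj_right_coev : ∀ b U,
    (X.conj b).map (η_ (rightDual U) U) =
      eqToHom (X.conj_unit b) ≫ η_ (rightDual ((X.conj b).obj U)) ((X.conj b).obj U) ≫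
        eqToHom (by rw [X.conj_tensor, conj_rightDual])
  conj_right_ev : ∀ b U,
    (X.conj b).map (ε_ (rightDual U) U) =
      eqToHom (by rw [X.conj_tensor, conj_rightDual]) ≫
        ε_ (rightDual ((X.conj b).obj U)) ((X.conj b).obj U) ≫ eqToHom (X.conj_unit b).symm

/-- A `k`-linear abelian crossed `G`-category: every component is a `k`-linear abelian category,
and tensoring with an object and the conjugations are additive and exact on the components. -/
structure AbelianLinear (k : Type w) [Field k] (X : CrossedCat G C) where
  [abelian : ∀ a, Abelian (X.Component a)]
  [linear : ∀ a, Linear k (X.Component a)]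
  tensorLeft_additive : ∀ U c, (X.tensorLeftComp U c).Additive
  tensorLeft_left_exact : ∀ U c, Limits.PreservesFiniteLimits (X.tensorLeftComp U c)
  tensorLeft_right_exact : ∀ U c, Limits.PreservesFiniteColimits (X.tensorLeftComp U c)
  tensorRight_additive : ∀ U c, (X.tensorRightComp U c).Additive
  tensorRight_left_exact : ∀ U c, Limits.PreservesFiniteLimits (X.tensorRightComp U c)
  tensorRight_right_exact : ∀ U c, Limits.PreservesFiniteColimits (X.tensorRightComp U c)
  conj_additive : ∀ b c, (X.conjComp b c).Additive
  conj_left_exact : ∀ b c, Limits.PreservesFiniteLimits (X.conjComp b c)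
  conj_right_exact : ∀ b c, Limits.PreservesFiniteColimits (X.conjComp b c)

end CrossedCat

/-! ### Fiber crossed functors and Tannakian crossed `G`-categories -/

/-- A crossed `G`-category `C` with a (strong) tensor functor `F` to finite-dimensional vector
spaces and tensor natural isomorphisms `φ̇_β : F ≅ F ∘ Φ_β` with `φ̇_1 = id` and
`φ̇_{β₁} ∘ φ̇_{β₂} = φ̇_{β₁β₂}`. -/
structure CrossedCatOverVect (G : Type uG) [Group G] (k : Type w) [Field k]
    (C : Type u) [Category.{v} C] [MonoidalCategory C] extends CrossedCat G C where
  F : C ⥤ FGModuleCat.{w} k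
  [monoidal : F.Monoidal]
  phi : ∀ b, F ≅ conj b ⋙ F
  phi_one : ∀ U, (phi 1).hom.app U =
    eqToHom (show F.obj U = F.obj ((conj 1).obj U) by rw [conj_one]; rfl)
  phi_mul : ∀ a b U, (phi (a * b)).hom.app U =
    (phi b).hom.app U ≫ (phi a).hom.app ((conj b).obj U) ≫
      eqToHom (show F.obj ((conj a).obj ((conj b).obj U)) = F.obj ((conj (a * b)).obj U) by
        rw [conj_mul]; rfl)
  phi_unit : ∀ b, Functor.LaxMonoidal.ε F ≫ (phi b).hom.app (𝟙_ C) =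
    Functor.LaxMonoidal.ε F ≫ F.map (eqToHom (conj_unit b).symm)
  phi_tensor : ∀ b U V, Functor.LaxMonoidal.μ F U V ≫ (phi b).hom.app (U ⊗ V) =
    ((phi b).hom.app U ⊗ₘ (phi b).hom.app V) ≫
      Functor.LaxMonoidal.μ F ((conj b).obj U) ((conj b).obj V) ≫
        F.map (eqToHom (conj_tensor b U V).symm)

namespace CrossedCatOverVect

attribute [instance] monoidal

variable {G : Type uG} [Group G] {k : Type w} [Field k]
  {C : Type u} [Category.{v} C] [MonoidalCategory C]
  {D : Type u'} [Category.{v'} D] [MonoidalCategory D]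

/-- The restriction `F_α` of `F` to the component `C_α`. -/
abbrev fiber (X : CrossedCatOverVect G k C) (a : G) :
    X.toCrossedCat.Component a ⥤ FGModuleCat.{w} k :=
  X.toCrossedCat.incl a ⋙ X.F

/-- `(C, F, φ̇)` is a Tannakian crossed `G`-category: `C` is autonomous and `k`-linear abelian,
and `F` is faithful, `k`-linear and exact.  (A strong tensor functor preserves dualities.) -/
structure IsTannakian (X : CrossedCatOverVect G k C) : Prop where
  autonomous : Nonempty X.toCrossedCat.Autonomous
  faithful : X.F.Faithful
  abelian_exact : ∃ A : X.toCrossedCat.AbelianLinear k, ∀ a,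
    letI := A.abelian a
    letI := A.linear a
    (X.fiber a).Additive ∧ (X.fiber a).Linear k ∧
      Limits.PreservesFiniteLimits (X.fiber a) ∧ Limits.PreservesFiniteColimits (X.fiber a)

/-- An equivalence of crossed `G`-categories over vector spaces: an equivalence of
categories `E`, which is a tensor functor, preserves the components, and commutes with the
conjugations up to coherent isomorphisms `κ_β : E ∘ Φ_β ≅ Φ_β ∘ E`, such that the fiber functor of
`X` is the composite of `E` with the fiber functor of `Y`, as a tensor functor and
together with the isomorphisms `φ̇`. -/
structure Equivalence (X : CrossedCatOverVect G k C) (Y : CrossedCatOverVect G k D) where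
  E : C ⥤ D
  [isEquivalence : E.IsEquivalence]
  [monoidalE : E.Monoidal]
  deg_obj : ∀ U, Y.deg (E.obj U) = X.deg U
  kappa : ∀ b, X.conj b ⋙ E ≅ E ⋙ Y.conj b
  kappa_mul : ∀ a b U, (kappa (a * b)).hom.app U =
    eqToHom (show E.obj ((X.conj (a * b)).obj U) = E.obj ((X.conj a).obj ((X.conj b).obj U)) by
        rw [X.conj_mul]; rfl) ≫
      (kappa a).hom.app ((X.conj b).obj U) ≫ (Y.conj a).map ((kappa b).hom.app U) ≫
        eqToHom (show (Y.conj a).obj ((Y.conj b).obj (E.obj U)) =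
          (Y.conj (a * b)).obj (E.obj U) by rw [Y.conj_mul]; rfl)
  kappa_unit : ∀ b,
    Functor.LaxMonoidal.ε E ≫ E.map (eqToHom (X.conj_unit b).symm) ≫ (kappa b).hom.app (𝟙_ C) =
      eqToHom (Y.conj_unit b).symm ≫ (Y.conj b).map (Functor.LaxMonoidal.ε E)
  kappa_tensor : ∀ b U V,
    Functor.LaxMonoidal.μ E ((X.conj b).obj U) ((X.conj b).obj V) ≫
        E.map (eqToHom (X.conj_tensor b U V).symm) ≫ (kappa b).hom.app (U ⊗ V) =
      ((kappa b).hom.app U ⊗ₘ (kappa b).hom.app V) ≫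
        eqToHom (Y.conj_tensor b (E.obj U) (E.obj V)).symm ≫
          (Y.conj b).map (Functor.LaxMonoidal.μ E U V)
  fiber_eq : X.F = E ⋙ Y.F
  fiber_unit : Functor.LaxMonoidal.ε X.F ≫ (eqToHom fiber_eq).app (𝟙_ C) =
    Functor.LaxMonoidal.ε (E ⋙ Y.F)
  fiber_tensor : ∀ U V,
    Functor.LaxMonoidal.μ X.F U V ≫ (eqToHom fiber_eq).app (U ⊗ V) =
      ((eqToHom fiber_eq).app U ⊗ₘ (eqToHom fiber_eq).app V) ≫
        Functor.LaxMonoidal.μ (E ⋙ Y.F) U V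
  fiber_phi : ∀ b U,
    (X.phi b).hom.app U ≫ (eqToHom fiber_eq).app ((X.conj b).obj U) ≫
        Y.F.map ((kappa b).hom.app U) =
      (eqToHom fiber_eq).app U ≫ (Y.phi b).hom.app (E.obj U)

end CrossedCatOverVect

/-! ### The crossed `G`-category of comodules -/

namespace CrossedHopfAlgebra

variable {G : Type uG} [Group G] {k : Type w} [Field k]

section cast

variable (H : CrossedHopfAlgebra.{uG, w, t} G k)

/-- The transport `H α ≃ H β` along an equality `α = β`. -/
abbrev cast {a b : G} (h : a = b) : H.comp a ≃ₗ[k] H.comp b :=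
  LinearEquiv.cast (R := k) (M := H.comp) h

theorem cast_rfl {a : G} (h : a = a) (x : H.comp a) : H.cast h x = x := rfl

theorem cast_cast {a b c : G} (h : a = b) (h' : b = c) (x : H.comp a) :
    H.cast h' (H.cast h x) = H.cast (h.trans h') x := by
  subst h; subst h'; rfl

theorem mul_cast {a a' b b' : G} (h : a = a') (h' : b = b') (x : H.comp a) (y : H.comp b) :
    H.mul a' b' (H.cast h x ⊗ₜ H.cast h' y) =
      H.cast (by rw [h, h']) (H.mul a b (x ⊗ₜ y)) := by
  subst h; subst h'; rfl

theorem conj_cast {a a' b b' : G} (h : b = b') (h' : a = a') (x : H.comp a) :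
    H.conj b' a' (H.cast h' x) = H.cast (by rw [h, h']) (H.conj b a x) := by
  subst h; subst h'; rfl

theorem conj_one_apply {a : G} (x : H.comp a) :
    H.cast (show 1 * a * 1⁻¹ = a by group) (H.conj 1 a x) = x := by
  have h := H.conj_conj 1 1 a x
  have h2 : H.conj 1 _ (H.conj 1 a x) =
      H.conj 1 _ (H.cast (show a = 1 * a * 1⁻¹ by group) x) := by
    rw [← h]
    exact (H.conj_cast (b := 1 * 1) (b' := 1) (by group) (by group) x).symm
  have h3 := (H.conj 1 (1 * a * 1⁻¹)).injective h2
  rw [h3, cast_cast]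
  rfl

end cast

/-- A finite-dimensional left comodule over one of the components of `H`: an object of `Com H`. -/
structure Comod (H : CrossedHopfAlgebra.{uG, w, t} G k) where
  deg : G
  V : FGModuleCat.{w} k
  coact : V →ₗ[k] H.comp deg ⊗[k] V
  coassoc : ∀ m : V, TensorProduct.assoc k (H.comp deg) (H.comp deg) V
      ((comul (R := k) (A := H.comp deg)).rTensor V (coact m)) =
    coact.lTensor (H.comp deg) (coact m)
  counit_coact : ∀ m : V, TensorProduct.lid k V
    ((counit (R := k) (A := H.comp deg)).rTensor V (coact m)) = m

namespace Comod

variable {H : CrossedHopfAlgebra.{uG, w, t} G k}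

/-- An arrow of `Com H`: a linear map between two comodules over the same component that commutes
with the coactions. -/
structure Hom (M N : Comod H) where
  deg_eq : M.deg = N.deg
  f : M.V ⟶ N.V
  comm : ∀ m : M.V, N.coact (f.hom.hom m) =
    TensorProduct.map (H.cast deg_eq).toLinearMap f.hom.hom (M.coact m)

theorem Hom.ext' {M N : Comod H} {f g : Hom M N} (h : f.f = g.f) : f = g := by
  cases f; cases g; cases h; rfl

theorem map_cast_rfl {V : Type*} [AddCommGroup V] [Module k V] {a : G} (h : a = a)
    (x : H.comp a ⊗[k] V) :
    TensorProduct.map (H.cast h).toLinearMap (LinearMap.id : V →ₗ[k] V) x = x := by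
  have : (H.cast h).toLinearMap = LinearMap.id := rfl
  rw [this, TensorProduct.map_id]; rfl

instance : Category (Comod H) where
  Hom := Hom
  id M := ⟨rfl, 𝟙 _, fun m => (map_cast_rfl rfl (M.coact m)).symm⟩
  comp {M N P} f g := ⟨f.deg_eq.trans g.deg_eq, f.f ≫ g.f, fun m => by
    change P.coact (g.f.hom.hom (f.f.hom.hom m)) = _
    rw [g.comm, f.comm]
    generalize M.coact m = t
    induction t with
    | zero => simp
    | add x y hx hy => simp only [map_add, hx, hy]
    | tmul x y => 
      simp only [TensorProduct.map_tmul, LinearEquiv.coe_coe, cast_cast]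
      rfl⟩
  id_comp f := Hom.ext' (Category.id_comp f.f)
  comp_id f := Hom.ext' (Category.comp_id f.f)
  assoc f g h := Hom.ext' (Category.assoc f.f g.f h.f)

@[ext] theorem hom_ext {M N : Comod H} {f g : M ⟶ N} (h : f.f = g.f) : f = g := Hom.ext' h

/-- The forgetful functor. -/
def forget (H : CrossedHopfAlgebra.{uG, w, t} G k) : Comod H ⥤ FGModuleCat.{w} k where
  obj M := M.V
  map f := f.f

instance : (forget H).Faithful where
  map_injective h := hom_ext h

/-- An isomorphism in `Com H` from a linear isomorphism commuting with the coactions. -/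
def isoMk {M N : Comod H} (h : M.deg = N.deg) (e : M.V ≅ N.V)
    (comm : ∀ m : M.V, N.coact (e.hom.hom.hom m) =
      TensorProduct.map (H.cast h).toLinearMap e.hom.hom.hom (M.coact m)) : M ≅ N where
  hom := ⟨h, e.hom, comm⟩
  inv := ⟨h.symm, e.inv, fun n => by
    obtain ⟨m, rfl⟩ : ∃ m, e.hom.hom.hom m = n :=
      ⟨e.inv.hom.hom n, by
        have := congrArg (fun g => g.hom.hom n) e.inv_hom_id
        exact this⟩
    have h1 : ∀ m, e.inv.hom.hom (e.hom.hom.hom m) = m := fun m =>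
      congrArg (fun g => g.hom.hom m) e.hom_inv_id
    rw [comm, h1]
    generalize M.coact m = t
    induction t with
    | zero => simp
    | add x y hx hy => 
      simp only [map_add]
      rw [← hx, ← hy]
    | tmul x y => 
      simp only [TensorProduct.map_tmul, LinearEquiv.coe_coe, cast_cast, h1]
      rfl⟩
  hom_inv_id := hom_ext e.hom_inv_id
  inv_hom_id := hom_ext e.inv_hom_id

/-- The coaction `m ⊗ n ↦ m_α n_β ⊗ m_M ⊗ n_N` on a tensor product. -/
def tensorCoact (M N : Comod H) :
    M.V ⊗[k] N.V →ₗ[k] H.comp (M.deg * N.deg) ⊗[k] (M.V ⊗[k] N.V) :=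
  ((H.mul M.deg N.deg).toLinearMap.rTensor (M.V ⊗[k] N.V)) ∘ₗ
    (TensorProduct.tensorTensorTensorComm k _ _ _ _).toLinearMap ∘ₗ
      TensorProduct.map M.coact N.coact

theorem mul_coassoc_aux {A B P V W : Type*} [AddCommGroup A] [Module k A] [Coalgebra k A]
    [AddCommGroup B] [Module k B] [Coalgebra k B] [AddCommGroup P] [Module k P] [Coalgebra k P]
    [AddCommGroup V] [Module k V] [AddCommGroup W] [Module k W]
    (f : A ⊗[k] B →ₗc[k] P) (r : V →ₗ[k] A ⊗[k] V) (q : W →ₗ[k] B ⊗[k] W)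
    (hr : ∀ m, TensorProduct.assoc k A A V ((comul (R := k) (A := A)).rTensor V (r m)) =
      r.lTensor A (r m))
    (hq : ∀ m, TensorProduct.assoc k B B W ((comul (R := k) (A := B)).rTensor W (q m)) =
      q.lTensor B (q m)) (m : V ⊗[k] W) :
    let c : V ⊗[k] W →ₗ[k] P ⊗[k] (V ⊗[k] W) := (f.toLinearMap.rTensor (V ⊗[k] W)) ∘ₗ
      (TensorProduct.tensorTensorTensorComm k A V B W).toLinearMap ∘ₗ TensorProduct.map r q
    TensorProduct.assoc k P P (V ⊗[k] W) ((comul (R := k) (A := P)).rTensor _ (c m)) =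
      c.lTensor P (c m) := by
  intro c
  let Ψ : (A ⊗[k] (A ⊗[k] V)) ⊗[k] (B ⊗[k] (B ⊗[k] W)) →ₗ[k] P ⊗[k] (P ⊗[k] (V ⊗[k] W)) :=
    TensorProduct.map f.toLinearMap (f.toLinearMap.rTensor (V ⊗[k] W) ∘ₗ
      (TensorProduct.tensorTensorTensorComm k A V B W).toLinearMap) ∘ₗ
      (TensorProduct.tensorTensorTensorComm k A (A ⊗[k] V) B (B ⊗[k] W)).toLinearMap
  have hL : ∀ (t : A ⊗[k] V) (s : B ⊗[k] W),
      TensorProduct.assoc k P P (V ⊗[k] W) ((comul (R := k) (A := P)).rTensor _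
        (f.toLinearMap.rTensor (V ⊗[k] W)
          (TensorProduct.tensorTensorTensorComm k A V B W (t ⊗ₜ s)))) =
      Ψ (TensorProduct.assoc k A A V ((comul (R := k) (A := A)).rTensor V t) ⊗ₜ
        TensorProduct.assoc k B B W ((comul (R := k) (A := B)).rTensor W s)) := by
    intro t s
    induction t with
    | zero => simp
    | add x y hx hy => simp only [TensorProduct.add_tmul, map_add, hx, hy]
    | tmul a v =>
      induction s with
      | zero => simp
      | add x y hx hy => simp only [TensorProduct.tmul_add, map_add, hx, hy]
      | tmul b w =>
        have h1 : comul (R := k) (f (a ⊗ₜ b)) =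
            TensorProduct.map f.toLinearMap f.toLinearMap
              (TensorProduct.tensorTensorTensorComm k A A B B
                (comul (R := k) a ⊗ₜ comul (R := k) b)) :=
          (CoalgHomClass.map_comp_comul_apply f (a ⊗ₜ b)).symm
        simp only [TensorProduct.tensorTensorTensorComm_tmul, LinearMap.rTensor_tmul]
        change TensorProduct.assoc k P P (V ⊗[k] W) (comul (R := k) (f (a ⊗ₜ b)) ⊗ₜ _) = _
        rw [h1]
        generalize comul (R := k) a = x
        generalize comul (R := k) b = y
        induction x with
        | zero => simp
        | add x y hx hy => simp only [TensorProduct.add_tmul, map_add, hx, hy]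
        | tmul a a' =>
          induction y with
          | zero => simp
          | add x y hx hy => simp only [TensorProduct.tmul_add, TensorProduct.add_tmul, map_add, hx, hy]
          | tmul b b' => simp [Ψ]
  have hR : ∀ (t : A ⊗[k] V) (s : B ⊗[k] W),
      c.lTensor P (f.toLinearMap.rTensor (V ⊗[k] W)
          (TensorProduct.tensorTensorTensorComm k A V B W (t ⊗ₜ s))) =
      Ψ (r.lTensor A t ⊗ₜ q.lTensor B s) := by
    intro t s
    induction t with
    | zero => simp
    | add x y hx hy => simp only [TensorProduct.add_tmul, map_add, hx, hy]
    | tmul a v =>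
      induction s with
      | zero => simp
      | add x y hx hy => simp only [TensorProduct.tmul_add, map_add, hx, hy]
      | tmul b w => simp [Ψ, c]
  induction m with
  | zero => simp
  | add x y hx hy => simp only [map_add, hx, hy]
  | tmul v w =>
    have : c (v ⊗ₜ w) = f.toLinearMap.rTensor (V ⊗[k] W)
          (TensorProduct.tensorTensorTensorComm k A V B W (r v ⊗ₜ q w)) := rfl
    rw [this, hL, hR, hr, hq]

theorem mul_counit_aux {A B P V W : Type*} [AddCommGroup A] [Module k A] [Coalgebra k A]
    [AddCommGroup B] [Module k B] [Coalgebra k B] [AddCommGroup P] [Module k P] [Coalgebra k P]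
    [AddCommGroup V] [Module k V] [AddCommGroup W] [Module k W]
    (f : A ⊗[k] B →ₗc[k] P) (r : V →ₗ[k] A ⊗[k] V) (q : W →ₗ[k] B ⊗[k] W)
    (hr : ∀ m, TensorProduct.lid k V ((counit (R := k) (A := A)).rTensor V (r m)) = m)
    (hq : ∀ m, TensorProduct.lid k W ((counit (R := k) (A := B)).rTensor W (q m)) = m)
    (m : V ⊗[k] W) :
    let c : V ⊗[k] W →ₗ[k] P ⊗[k] (V ⊗[k] W) := (f.toLinearMap.rTensor (V ⊗[k] W)) ∘ₗ
      (TensorProduct.tensorTensorTensorComm k A V B W).toLinearMap ∘ₗ TensorProduct.map r q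
    TensorProduct.lid k (V ⊗[k] W) ((counit (R := k) (A := P)).rTensor _ (c m)) = m := by
  intro c
  have hL : ∀ (t : A ⊗[k] V) (s : B ⊗[k] W),
      TensorProduct.lid k (V ⊗[k] W) ((counit (R := k) (A := P)).rTensor _
        (f.toLinearMap.rTensor (V ⊗[k] W)
          (TensorProduct.tensorTensorTensorComm k A V B W (t ⊗ₜ s)))) =
      TensorProduct.lid k V ((counit (R := k) (A := A)).rTensor V t) ⊗ₜ
        TensorProduct.lid k W ((counit (R := k) (A := B)).rTensor W s) := by
    intro t s
    induction t with
    | zero => simp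
    | add x y hx hy => simp only [TensorProduct.add_tmul, map_add, hx, hy]
    | tmul a v =>
      induction s with
      | zero => simp
      | add x y hx hy => simp only [TensorProduct.tmul_add, map_add, hx, hy]
      | tmul b w =>
        have h1 : counit (R := k) (f (a ⊗ₜ b)) = counit (R := k) a * counit (R := k) b := by
          rw [CoalgHomClass.counit_comp_apply]
          simp [mul_comm]
        simp only [TensorProduct.tensorTensorTensorComm_tmul, LinearMap.rTensor_tmul]
        change TensorProduct.lid k (V ⊗[k] W) (counit (R := k) (f (a ⊗ₜ b)) ⊗ₜ _) = _
        rw [h1]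
        simp only [TensorProduct.lid_tmul, TensorProduct.tmul_smul]
        rw [mul_comm, mul_smul, TensorProduct.smul_tmul']
  induction m with
  | zero => simp
  | add x y hx hy => simp only [map_add, hx, hy]
  | tmul v w =>
    have : c (v ⊗ₜ w) = f.toLinearMap.rTensor (V ⊗[k] W)
          (TensorProduct.tensorTensorTensorComm k A V B W (r v ⊗ₜ q w)) := rfl
    rw [this, hL, hr, hq]

theorem conj_coassoc_aux {A B V : Type*} [AddCommGroup A] [Module k A] [Coalgebra k A]
    [AddCommGroup B] [Module k B] [Coalgebra k B] [AddCommGroup V] [Module k V]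
    (f : A →ₗc[k] B) (r : V →ₗ[k] A ⊗[k] V)
    (hr : ∀ m, TensorProduct.assoc k A A V ((comul (R := k) (A := A)).rTensor V (r m)) =
      r.lTensor A (r m)) (m : V) :
    let c : V →ₗ[k] B ⊗[k] V := f.toLinearMap.rTensor V ∘ₗ r
    TensorProduct.assoc k B B V ((comul (R := k) (A := B)).rTensor V (c m)) =
      c.lTensor B (c m) := by
  intro c
  have hL : ∀ t : A ⊗[k] V, TensorProduct.assoc k B B V ((comul (R := k) (A := B)).rTensor V
        (f.toLinearMap.rTensor V t)) =
      TensorProduct.map f.toLinearMap (f.toLinearMap.rTensor V)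
        (TensorProduct.assoc k A A V ((comul (R := k) (A := A)).rTensor V t)) := by
    intro t
    induction t with
    | zero => simp
    | add x y hx hy => simp only [map_add, hx, hy]
    | tmul a v =>
      have h1 : comul (R := k) (f a) =
          TensorProduct.map f.toLinearMap f.toLinearMap (comul (R := k) a) :=
        (CoalgHomClass.map_comp_comul_apply f a).symm
      simp only [LinearMap.rTensor_tmul]
      change TensorProduct.assoc k B B V (comul (R := k) (f a) ⊗ₜ _) = _
      rw [h1]
      generalize comul (R := k) a = x
      induction x with
      | zero => simp
      | add x y hx hy => simp only [TensorProduct.add_tmul, map_add, hx, hy]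
      | tmul a a' => simp
  have hR : ∀ t : A ⊗[k] V, c.lTensor B (f.toLinearMap.rTensor V t) =
      TensorProduct.map f.toLinearMap (f.toLinearMap.rTensor V) (r.lTensor A t) := by
    intro t
    induction t with
    | zero => simp
    | add x y hx hy => simp only [map_add, hx, hy]
    | tmul a v => simp [c]
  change TensorProduct.assoc k B B V ((comul (R := k) (A := B)).rTensor V
    (f.toLinearMap.rTensor V (r m))) = c.lTensor B (f.toLinearMap.rTensor V (r m))
  rw [hL, hR, hr]

/-- The tensor product of comodules. -/
def tensorObj (M N : Comod H) : Comod H where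
  deg := M.deg * N.deg
  V := M.V ⊗ N.V
  coact := tensorCoact M N
  coassoc := mul_coassoc_aux (H.mul M.deg N.deg) M.coact N.coact M.coassoc N.coassoc
  counit_coact := mul_counit_aux (H.mul M.deg N.deg) M.coact N.coact M.counit_coact N.counit_coact

/-- The ground field with the coaction `c ↦ 1 ⊗ c`. -/
def tensorUnit (H : CrossedHopfAlgebra.{uG, w, t} G k) : Comod H where
  deg := 1
  V := 𝟙_ (FGModuleCat k)
  coact := TensorProduct.mk k (H.comp 1) k H.one
  coassoc m := by
    change TensorProduct.assoc k _ _ k (LinearMap.rTensor k _ (H.one ⊗ₜ (show k from m))) =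
      LinearMap.lTensor _ _ (H.one ⊗ₜ (show k from m))
    simp [H.comul_one]
  counit_coact m := by
    change TensorProduct.lid k k (LinearMap.rTensor k _ (H.one ⊗ₜ (show k from m))) = m
    simp [H.counit_one]

/-- The conjugate comodule `Φ_β(M)`: the vector space `M` with the coaction
`m ↦ φ_β(m_α) ⊗ m_M`. -/
def conjObj (b : G) (M : Comod H) : Comod H where
  deg := b * M.deg * b⁻¹
  V := M.V
  coact := (H.conj b M.deg).toCoalgHom.toLinearMap.rTensor M.V ∘ₗ M.coact
  coassoc := conj_coassoc_aux (H.conj b M.deg).toCoalgHom M.coact M.coassoc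
  counit_coact m := by
    rw [LinearMap.comp_apply, ← LinearMap.comp_apply (LinearMap.rTensor _ _),
      ← LinearMap.rTensor_comp]
    have : counit (R := k) ∘ₗ (H.conj b M.deg).toCoalgHom.toLinearMap =
      counit (R := k) (A := H.comp M.deg) := CoalgHomClass.counit_comp (H.conj b M.deg)
    rw [this]
    exact M.counit_coact m

section aux

variable {A A' B B' P P' Q R V V' W W' Z : Type*}
  [AddCommGroup A] [Module k A] [AddCommGroup A'] [Module k A']
  [AddCommGroup B] [Module k B] [AddCommGroup B'] [Module k B']
  [AddCommGroup P] [Module k P] [AddCommGroup P'] [Module k P']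
  [AddCommGroup Q] [Module k Q] [AddCommGroup R] [Module k R]
  [AddCommGroup V] [Module k V] [AddCommGroup V'] [Module k V']
  [AddCommGroup W] [Module k W] [AddCommGroup W'] [Module k W']
  [AddCommGroup Z] [Module k Z]

theorem tensorHom_aux (mu : A ⊗[k] B →ₗ[k] P) (mu' : A' ⊗[k] B' →ₗ[k] P')
    (cA : A →ₗ[k] A') (cB : B →ₗ[k] B') (cP : P →ₗ[k] P')
    (hmu : ∀ a b, mu' (cA a ⊗ₜ cB b) = cP (mu (a ⊗ₜ b)))
    (r : V →ₗ[k] A ⊗[k] V) (r' : V' →ₗ[k] A' ⊗[k] V')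
    (q : W →ₗ[k] B ⊗[k] W) (q' : W' →ₗ[k] B' ⊗[k] W')
    (f : V →ₗ[k] V') (g : W →ₗ[k] W')
    (hf : ∀ m, r' (f m) = TensorProduct.map cA f (r m))
    (hg : ∀ m, q' (g m) = TensorProduct.map cB g (q m)) (m : V ⊗[k] W) :
    ((mu'.rTensor (V' ⊗[k] W')) ∘ₗ (TensorProduct.tensorTensorTensorComm k _ _ _ _).toLinearMap ∘ₗ
        TensorProduct.map r' q') (TensorProduct.map f g m) =
      TensorProduct.map cP (TensorProduct.map f g)
        (((mu.rTensor (V ⊗[k] W)) ∘ₗ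
          (TensorProduct.tensorTensorTensorComm k _ _ _ _).toLinearMap ∘ₗ
            TensorProduct.map r q) m) := by
  induction m with
  | zero => simp
  | add x y hx hy => simp only [map_add, hx, hy]
  | tmul x y =>
    simp only [LinearMap.comp_apply, TensorProduct.map_tmul, hf, hg, LinearEquiv.coe_coe]
    generalize r x = t
    generalize q y = s
    induction t with
    | zero => simp
    | add x y hx hy => simp only [TensorProduct.add_tmul, map_add, hx, hy]
    | tmul a v =>
      induction s with
      | zero => simp
      | add x y hx hy => simp only [TensorProduct.tmul_add, map_add, hx, hy]
      | tmul b w => simp [hmu]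

theorem associator_aux (mAB : A ⊗[k] B →ₗ[k] P) (mP : P ⊗[k] B' →ₗ[k] P')
    (mBC : B ⊗[k] B' →ₗ[k] Q) (mQ : A ⊗[k] Q →ₗ[k] R) (c : P' →ₗ[k] R)
    (h : ∀ x y z, c (mP (mAB (x ⊗ₜ y) ⊗ₜ z)) = mQ (x ⊗ₜ mBC (y ⊗ₜ z)))
    (r : V →ₗ[k] A ⊗[k] V) (q : W →ₗ[k] B ⊗[k] W) (p : Z →ₗ[k] B' ⊗[k] Z)
    (m : (V ⊗[k] W) ⊗[k] Z) :
    (mQ.rTensor (V ⊗[k] (W ⊗[k] Z)) ∘ₗ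
      (TensorProduct.tensorTensorTensorComm k _ _ _ _).toLinearMap ∘ₗ
        TensorProduct.map r (mBC.rTensor (W ⊗[k] Z) ∘ₗ
          (TensorProduct.tensorTensorTensorComm k _ _ _ _).toLinearMap ∘ₗ
            TensorProduct.map q p)) (TensorProduct.assoc k V W Z m) =
      TensorProduct.map c (TensorProduct.assoc k V W Z).toLinearMap
        ((mP.rTensor ((V ⊗[k] W) ⊗[k] Z) ∘ₗ
          (TensorProduct.tensorTensorTensorComm k _ _ _ _).toLinearMap ∘ₗ
            TensorProduct.map (mAB.rTensor (V ⊗[k] W) ∘ₗ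
              (TensorProduct.tensorTensorTensorComm k _ _ _ _).toLinearMap ∘ₗ
                TensorProduct.map r q) p) m) := by
  induction m with
  | zero => simp
  | add x y hx hy => simp only [map_add, hx, hy]
  | tmul xy z =>
    induction xy with
    | zero => simp
    | add x y hx hy => simp only [TensorProduct.add_tmul, map_add, hx, hy]
    | tmul x y =>
      simp only [LinearMap.comp_apply, TensorProduct.map_tmul, LinearEquiv.coe_coe,
        TensorProduct.assoc_tmul]
      generalize r x = t
      generalize q y = s
      generalize p z = u
      induction t with
      | zero => simp
      | add x y hx hy => simp only [TensorProduct.add_tmul, map_add, hx, hy]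
      | tmul a u =>
        induction s with
        | zero => simp
        | add x y hx hy =>
          simp only [TensorProduct.tmul_add, TensorProduct.add_tmul, map_add, hx, hy]
        | tmul b v =>
          rename_i u'
          induction u' with
          | zero => simp
          | add x y hx hy => simp only [TensorProduct.tmul_add, map_add, hx, hy]
          | tmul c w => simp [h]

theorem leftUnitor_aux (mu : A ⊗[k] B →ₗ[k] P) (c : P →ₗ[k] B) (e : A)
    (h : ∀ x, c (mu (e ⊗ₜ x)) = x) (r : V →ₗ[k] B ⊗[k] V) (m : k ⊗[k] V) :
    r (TensorProduct.lid k V m) = TensorProduct.map c (TensorProduct.lid k V).toLinearMap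
      ((mu.rTensor (k ⊗[k] V) ∘ₗ
        (TensorProduct.tensorTensorTensorComm k _ _ _ _).toLinearMap ∘ₗ
          TensorProduct.map (TensorProduct.mk k A k e) r) m) := by
  induction m with
  | zero => simp
  | add x y hx hy => simp only [map_add, hx, hy]
  | tmul x y =>
    simp only [LinearMap.comp_apply, TensorProduct.map_tmul, LinearEquiv.coe_coe,
      TensorProduct.lid_tmul, map_smul, TensorProduct.mk_apply]
    generalize r y = t
    induction t with
    | zero => simp
    | add x y hx hy => simp only [TensorProduct.tmul_add, map_add, smul_add, hx, hy]
    | tmul a v => simp [h]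

theorem rightUnitor_aux (mu : B ⊗[k] A →ₗ[k] P) (c : P →ₗ[k] B) (e : A)
    (h : ∀ x, c (mu (x ⊗ₜ e)) = x) (r : V →ₗ[k] B ⊗[k] V) (m : V ⊗[k] k) :
    r (TensorProduct.rid k V m) = TensorProduct.map c (TensorProduct.rid k V).toLinearMap
      ((mu.rTensor (V ⊗[k] k) ∘ₗ
        (TensorProduct.tensorTensorTensorComm k _ _ _ _).toLinearMap ∘ₗ
          TensorProduct.map r (TensorProduct.mk k A k e)) m) := by
  induction m with
  | zero => simp
  | add x y hx hy => simp only [map_add, hx, hy]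
  | tmul x y =>
    simp only [LinearMap.comp_apply, TensorProduct.map_tmul, LinearEquiv.coe_coe,
      TensorProduct.rid_tmul, map_smul, TensorProduct.mk_apply]
    generalize r x = t
    induction t with
    | zero => simp
    | add x y hx hy => simp only [TensorProduct.add_tmul, map_add, smul_add, hx, hy]
    | tmul a v => simp [h]

theorem conj_hom_aux (pA : A →ₗ[k] A') (pB : B →ₗ[k] B') (cA : A →ₗ[k] B) (cA' : A' →ₗ[k] B')
    (h : ∀ a, pB (cA a) = cA' (pA a)) (r : V →ₗ[k] A ⊗[k] V) (q : W →ₗ[k] B ⊗[k] W)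
    (f : V →ₗ[k] W) (hf : ∀ m, q (f m) = TensorProduct.map cA f (r m)) (m : V) :
    (pB.rTensor W ∘ₗ q) (f m) = TensorProduct.map cA' f ((pA.rTensor V ∘ₗ r) m) := by
  simp only [LinearMap.comp_apply, hf]
  generalize r m = t
  induction t with
  | zero => simp
  | add x y hx hy => simp only [map_add, hx, hy]
  | tmul a v => simp [h]

theorem conj_obj_aux (p : A →ₗ[k] B) (p' : A →ₗ[k] P) (c : B →ₗ[k] P) (h : ∀ a, c (p a) = p' a)
    (t : A ⊗[k] V) :
    p'.rTensor V t = TensorProduct.map c LinearMap.id (p.rTensor V t) := by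
  induction t with
  | zero => simp
  | add x y hx hy => simp only [map_add, hx, hy]
  | tmul a v => simp [h]

theorem conj_tensor_aux (mu : A ⊗[k] B →ₗ[k] P) (mu' : A' ⊗[k] B' →ₗ[k] P')
    (pA : A →ₗ[k] A') (pB : B →ₗ[k] B') (pP : P →ₗ[k] Q) (c : Q →ₗ[k] P')
    (h : ∀ a b, c (pP (mu (a ⊗ₜ b))) = mu' (pA a ⊗ₜ pB b))
    (r : V →ₗ[k] A ⊗[k] V) (q : W →ₗ[k] B ⊗[k] W) (m : V ⊗[k] W) :
    (mu'.rTensor (V ⊗[k] W) ∘ₗ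
      (TensorProduct.tensorTensorTensorComm k _ _ _ _).toLinearMap ∘ₗ
        TensorProduct.map (pA.rTensor V ∘ₗ r) (pB.rTensor W ∘ₗ q)) m =
      TensorProduct.map c LinearMap.id ((pP.rTensor (V ⊗[k] W) ∘ₗ mu.rTensor (V ⊗[k] W) ∘ₗ
        (TensorProduct.tensorTensorTensorComm k _ _ _ _).toLinearMap ∘ₗ
          TensorProduct.map r q) m) := by
  induction m with
  | zero => simp
  | add x y hx hy => simp only [map_add, hx, hy]
  | tmul x y =>
    simp only [LinearMap.comp_apply, TensorProduct.map_tmul, LinearEquiv.coe_coe]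
    generalize r x = t
    generalize q y = s
    induction t with
    | zero => simp
    | add x y hx hy => simp only [TensorProduct.add_tmul, map_add, hx, hy]
    | tmul a v =>
      induction s with
      | zero => simp
      | add x y hx hy => simp only [TensorProduct.tmul_add, map_add, hx, hy]
      | tmul b w => simp [h]

end aux

/-- The tensor product of arrows. -/
def tensorHom {M M' N N' : Comod H} (f : M ⟶ M') (g : N ⟶ N') :
    tensorObj M N ⟶ tensorObj M' N' where
  deg_eq := congrArg₂ (· * ·) f.deg_eq g.deg_eq
  f := f.f ⊗ₘ g.f
  comm := tensorHom_aux (H.mul _ _).toLinearMap (H.mul _ _).toLinearMap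
    (H.cast f.deg_eq).toLinearMap (H.cast g.deg_eq).toLinearMap (H.cast _).toLinearMap
    (H.mul_cast f.deg_eq g.deg_eq) M.coact M'.coact N.coact N'.coact f.f.hom.hom g.f.hom.hom
    f.comm g.comm

/-- The associator: that of vector spaces. -/
def associator (M N P : Comod H) :
    tensorObj (tensorObj M N) P ≅ tensorObj M (tensorObj N P) :=
  isoMk (_root_.mul_assoc _ _ _) (α_ M.V N.V P.V)
    (associator_aux (H.mul _ _).toLinearMap (H.mul _ _).toLinearMap (H.mul _ _).toLinearMap
      (H.mul _ _).toLinearMap (H.cast _).toLinearMap (H.mul_assoc _ _ _)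
      M.coact N.coact P.coact)

/-- The left unitor: that of vector spaces. -/
def leftUnitor (M : Comod H) : tensorObj (tensorUnit H) M ≅ M :=
  isoMk (_root_.one_mul _) (λ_ M.V)
    (leftUnitor_aux (H.mul _ _).toLinearMap (H.cast _).toLinearMap H.one (H.one_mul _) M.coact)

/-- The right unitor: that of vector spaces. -/
def rightUnitor (M : Comod H) : tensorObj M (tensorUnit H) ≅ M :=
  isoMk (_root_.mul_one _) (ρ_ M.V)
    (rightUnitor_aux (H.mul _ _).toLinearMap (H.cast _).toLinearMap H.one (H.mul_one _) M.coact)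

instance : MonoidalCategoryStruct (Comod H) where
  tensorObj := tensorObj
  tensorHom := tensorHom
  whiskerLeft M _ _ f := tensorHom (𝟙 M) f
  whiskerRight f N := tensorHom f (𝟙 N)
  tensorUnit := tensorUnit H
  associator := associator
  leftUnitor := leftUnitor
  rightUnitor := rightUnitor

/-- The forgetful functor strictly preserves tensor products. -/
def inducingData (H : CrossedHopfAlgebra.{uG, w, t} G k) :
    Monoidal.InducingFunctorData (forget H) where
  μIso M N := Iso.refl (M.V ⊗ N.V)
  εIso := Iso.refl (𝟙_ (FGModuleCat k))
  whiskerLeft_eq M _ _ f := by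
    change 𝟙 M.V ⊗ₘ f.f = 𝟙 _ ≫ (M.V ◁ f.f) ≫ 𝟙 _
    simp
  whiskerRight_eq f N := by
    change f.f ⊗ₘ 𝟙 N.V = 𝟙 _ ≫ (f.f ▷ N.V) ≫ 𝟙 _
    simp
  tensorHom_eq f g := by
    change f.f ⊗ₘ g.f = 𝟙 _ ≫ (f.f ⊗ₘ g.f) ≫ 𝟙 _
    simp
  associator_eq M N P := by
    change (α_ M.V N.V P.V).hom = (𝟙 _ ≫ (𝟙 (MonoidalCategory.tensorObj M.V N.V) ⊗ₘ 𝟙 P.V)) ≫ (α_ M.V N.V P.V).hom ≫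
      ((𝟙 M.V ⊗ₘ 𝟙 (MonoidalCategory.tensorObj N.V P.V)) ≫ 𝟙 _)
    rw [MonoidalCategory.id_tensorHom_id, MonoidalCategory.id_tensorHom_id, Category.id_comp,
      Category.id_comp, Category.comp_id, Category.comp_id]
  leftUnitor_eq M := by
    change (λ_ M.V).hom = (𝟙 _ ≫ (𝟙 (𝟙_ (FGModuleCat k)) ⊗ₘ 𝟙 M.V)) ≫ (λ_ M.V).hom
    simp
  rightUnitor_eq M := by
    change (ρ_ M.V).hom = (𝟙 _ ≫ (𝟙 M.V ⊗ₘ 𝟙 (𝟙_ (FGModuleCat k)))) ≫ (ρ_ M.V).hom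
    rw [MonoidalCategory.id_tensorHom_id, Category.id_comp, Category.id_comp]

instance : MonoidalCategory (Comod H) := Monoidal.induced (forget H) (inducingData H)

instance : (forget H).Monoidal := Monoidal.fromInducedMonoidal (forget H) (inducingData H)

/-- Two comodules on the same vector space are equal if their coactions agree. -/
theorem obj_ext {M N : Comod H} (h : M.deg = N.deg) (hV : M.V = N.V)
    (hc : ∀ m : M.V, N.coact ((eqToHom hV).hom.hom m) =
      TensorProduct.map (H.cast h).toLinearMap (eqToHom hV).hom.hom (M.coact m)) : M = N := by
  obtain ⟨d, V, c, h1, h2⟩ := M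
  obtain ⟨d', V', c', h1', h2'⟩ := N
  change d = d' at h
  change V = V' at hV
  subst h
  subst hV
  have : c = c' := by
    ext m
    exact ((hc m).trans (map_cast_rfl rfl (c m))).symm
  subst this
  rfl

theorem eqToHom_f {M N : Comod H} (h : M = N) :
    Hom.f (eqToHom h) = eqToHom (congrArg Comod.V h) := by
  subst h; rfl

/-- The conjugation functor `Φ_β`, the identity on the underlying linear maps. -/
def conj (H : CrossedHopfAlgebra.{uG, w, t} G k) (b : G) : Comod H ⥤ Comod H where
  obj M := conjObj b M
  map {M N} f := ⟨congrArg (fun d => b * d * b⁻¹) f.deg_eq, f.f,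
    conj_hom_aux (H.conj b M.deg).toCoalgHom.toLinearMap (H.conj b N.deg).toCoalgHom.toLinearMap
      (H.cast f.deg_eq).toLinearMap (H.cast _).toLinearMap (H.conj_cast rfl f.deg_eq)
      M.coact N.coact f.f.hom.hom f.comm⟩
  map_id _ := rfl
  map_comp _ _ := rfl

theorem conj_one_obj (M : Comod H) : (conj H 1).obj M = M :=
  obj_ext (show 1 * M.deg * 1⁻¹ = M.deg by group) rfl (fun m =>
    (congrFun (congrArg DFunLike.coe (LinearMap.rTensor_id (R := k) M.V (H.comp M.deg)))
      (M.coact m)).symm.trans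
    (conj_obj_aux (H.conj 1 M.deg).toCoalgHom.toLinearMap LinearMap.id (H.cast _).toLinearMap
      (fun a => H.conj_one_apply a) (M.coact m)))

theorem conj_mul_obj (b c : G) (M : Comod H) :
    (conj H (b * c)).obj M = (conj H b).obj ((conj H c).obj M) :=
  obj_ext (show b * c * M.deg * (b * c)⁻¹ = b * (c * M.deg * c⁻¹) * b⁻¹ by group) rfl (fun m =>
    (LinearMap.rTensor_comp_apply (R := k) M.V (H.conj b _).toCoalgHom.toLinearMap
      (H.conj c M.deg).toCoalgHom.toLinearMap (M.coact m)).symm.trans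
    (conj_obj_aux (H.conj (b * c) M.deg).toCoalgHom.toLinearMap
      ((H.conj b _).toCoalgHom.toLinearMap ∘ₗ (H.conj c M.deg).toCoalgHom.toLinearMap)
      (H.cast _).toLinearMap (fun a => H.conj_conj b c _ a) (M.coact m)))

theorem conj_unit_obj (b : G) : (conj H b).obj (𝟙_ (Comod H)) = 𝟙_ (Comod H) :=
  obj_ext (show b * 1 * b⁻¹ = 1 by group) rfl (fun m =>
    congrArg (fun x => x ⊗ₜ[k] (show k from m)) (H.conj_one b).symm)

theorem conj_tensor_obj (b : G) (M N : Comod H) :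
    (conj H b).obj (tensorObj M N) = tensorObj ((conj H b).obj M) ((conj H b).obj N) :=
  obj_ext (show b * (M.deg * N.deg) * b⁻¹ = (b * M.deg * b⁻¹) * (b * N.deg * b⁻¹) by group) rfl
    (conj_tensor_aux (H.mul _ _).toLinearMap (H.mul _ _).toLinearMap
      (H.conj b M.deg).toCoalgHom.toLinearMap (H.conj b N.deg).toCoalgHom.toLinearMap
      (H.conj b _).toCoalgHom.toLinearMap (H.cast _).toLinearMap (H.conj_mul b _ _)
      M.coact N.coact)

theorem comp_f {M N P : Comod H} (f : M ⟶ N) (g : N ⟶ P) :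
    Hom.f (f ≫ g) = Hom.f f ≫ Hom.f g := rfl

theorem eqToHom_self {V : FGModuleCat.{w} k} (h : V = V) : eqToHom h = 𝟙 V := rfl

end Comod

open Comod in
/-- The crossed `G`-category `Com H` of finite-dimensional left comodules over the components
of `H`, with the forgetful functor to vector spaces and `φ̇_β : M → Φ_β(M)` the identity of the
underlying vector space. -/
def com (H : CrossedHopfAlgebra.{uG, w, t} G k) : CrossedCatOverVect G k (Comod H) where
  deg := Comod.deg
  deg_eq_of_hom f := f.deg_eq
  deg_tensor _ _ := rfl
  conj := Comod.conj H
  conj_one := CategoryTheory.Functor.ext conj_one_obj (fun M N f => hom_ext (by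
    rw [comp_f, comp_f, eqToHom_f, eqToHom_f]
    exact (Category.id_comp _).trans (Category.comp_id _) |>.symm))
  conj_mul b c := CategoryTheory.Functor.ext (conj_mul_obj b c) (fun M N f => hom_ext (by
    rw [comp_f, comp_f, eqToHom_f, eqToHom_f]
    exact (Category.id_comp _).trans (Category.comp_id _) |>.symm))
  deg_conj _ _ := rfl
  conj_unit := conj_unit_obj
  conj_tensor := conj_tensor_obj
  conj_tensorHom b _ _ _ _ f g := hom_ext (by
    rw [comp_f, comp_f, eqToHom_f, eqToHom_f]
    exact (Category.id_comp _).trans (Category.comp_id _) |>.symm)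
  conj_associator b M N P := hom_ext (by
    rw [comp_f, comp_f, eqToHom_f, eqToHom_f]
    exact (Category.id_comp _).trans (Category.comp_id _) |>.symm)
  conj_leftUnitor b M := hom_ext (by
    rw [comp_f, eqToHom_f]
    exact (Category.id_comp _).symm)
  conj_rightUnitor b M := hom_ext (by
    rw [comp_f, eqToHom_f]
    exact (Category.id_comp _).symm)
  F := forget H
  phi b := NatIso.ofComponents (fun M => Iso.refl M.V) (fun f =>
    (Category.comp_id _).trans (Category.id_comp _).symm)
  phi_one _ := rfl
  phi_mul a b M := ((Category.id_comp _).trans (Category.id_comp _)).symm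
  phi_unit b := by
    change _ = _ ≫ Hom.f (eqToHom (C := Comod H) _)
    rw [eqToHom_f]
    rfl
  phi_tensor b M N := by
    change _ = _ ≫ _ ≫ Hom.f (eqToHom (C := Comod H) _)
    rw [eqToHom_f]
    change 𝟙 (MonoidalCategory.tensorObj M.V N.V) ≫ 𝟙 _ = (𝟙 M.V ⊗ₘ 𝟙 N.V) ≫ 𝟙 (MonoidalCategory.tensorObj M.V N.V) ≫ 𝟙 _
    simp

end CrossedHopfAlgebra

/-! ### The coalgebra `End^∨(X)` -/

section EndCheck

open scoped DirectSum

variable {k : Type w} [Field k] {D : Type u} [Category.{v} D]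

open Classical in
/-- The generator `[h]` in the direct sum `⨁_A End(X(A))`. -/
noncomputable def preEndCheckOf (X : D ⥤ FGModuleCat.{w} k) (A : D) :
    Module.End k (X.obj A) →ₗ[k] ⨁ A : D, Module.End k (X.obj A) :=
  DirectSum.lof k D (fun A => Module.End k (X.obj A)) A

/-- The relations `[h ∘ X(f)] = [X(f) ∘ h]`, for `f : A ⟶ B` and `h : X(B) → X(A)`. -/
noncomputable def endCheckRel (X : D ⥤ FGModuleCat.{w} k) :
    Submodule k (⨁ A : D, Module.End k (X.obj A)) :=
  Submodule.span k {x | ∃ (A B : D) (f : A ⟶ B) (h : X.obj B →ₗ[k] X.obj A),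
    x = preEndCheckOf X A (h ∘ₗ (X.map f).hom.hom) - preEndCheckOf X B ((X.map f).hom.hom ∘ₗ h)}

/-- The coend `End^∨(X)` of the bifunctor `Hom(X(-), X(-))`. -/
abbrev EndCheck (X : D ⥤ FGModuleCat.{w} k) : Type (max u w) :=
  (⨁ A : D, Module.End k (X.obj A)) ⧸ endCheckRel X

namespace EndCheck

variable (X : D ⥤ FGModuleCat.{w} k)

/-- The class `[h]` of an endomorphism `h` of `X(A)`. -/
noncomputable def of (A : D) : Module.End k (X.obj A) →ₗ[k] EndCheck X :=
  (endCheckRel X).mkQ ∘ₗ preEndCheckOf X A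

theorem of_comp {A B : D} (f : A ⟶ B) (h : X.obj B →ₗ[k] X.obj A) :
    of X A (h ∘ₗ (X.map f).hom.hom) = of X B ((X.map f).hom.hom ∘ₗ h) := by
  refine (Submodule.Quotient.eq _).2 (Submodule.subset_span ⟨A, B, f, h, rfl⟩)

open Classical in
/-- Linear maps out of `End^∨(X)`. -/
noncomputable def lift {M : Type*} [AddCommGroup M] [Module k M]
    (g : ∀ A, Module.End k (X.obj A) →ₗ[k] M)
    (hg : ∀ {A B : D} (f : A ⟶ B) (h : X.obj B →ₗ[k] X.obj A),
      g A (h ∘ₗ (X.map f).hom.hom) = g B ((X.map f).hom.hom ∘ₗ h)) : EndCheck X →ₗ[k] M :=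
  (endCheckRel X).liftQ (DirectSum.toModule k D M g) (by
    refine Submodule.span_le.2 ?_
    rintro _ ⟨A, B, f, h, rfl⟩
    simp [preEndCheckOf, DirectSum.toModule_lof, hg])

theorem lift_of {M : Type*} [AddCommGroup M] [Module k M]
    (g : ∀ A, Module.End k (X.obj A) →ₗ[k] M)
    (hg : ∀ {A B : D} (f : A ⟶ B) (h : X.obj B →ₗ[k] X.obj A),
      g A (h ∘ₗ (X.map f).hom.hom) = g B ((X.map f).hom.hom ∘ₗ h)) (A : D)
    (h : Module.End k (X.obj A)) : lift X g hg (of X A h) = g A h := by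
  classical
  change DirectSum.toModule k D M g (preEndCheckOf X A h) = _
  simp [preEndCheckOf, DirectSum.toModule_lof]

/-- The rank one operator `x ↦ ξ(x) v`, that is `ξ ⊗ v`. -/
abbrev rankOne {V W : Type*} [AddCommGroup V] [Module k V] [AddCommGroup W] [Module k W]
    (ξ : Module.Dual k V) (v : W) : V →ₗ[k] W := LinearMap.smulRight ξ v

theorem sum_rankOne {V W : Type*} [AddCommGroup V] [Module k V] [Module.Finite k V]
    [AddCommGroup W] [Module k W] (h : V →ₗ[k] W) :
    ∑ i, rankOne ((Module.finBasis k V).coord i) (h (Module.finBasis k V i)) = h := by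
  refine (Module.finBasis k V).ext fun j => ?_
  simp [LinearMap.sum_apply, Finsupp.single_apply, ite_smul]

theorem hom_ext' {M : Type*} [AddCommGroup M] [Module k M] {f g : EndCheck X →ₗ[k] M}
    (h : ∀ A (ξ : Module.Dual k (X.obj A)) (v : X.obj A),
      f (of X A (rankOne ξ v)) = g (of X A (rankOne ξ v))) : f = g := by
  classical
  refine Submodule.linearMap_qext _ (DirectSum.linearMap_ext k fun A => LinearMap.ext fun e => ?_)
  change f (of X A e) = g (of X A e)
  rw [← sum_rankOne e]
  simp only [map_sum, h]

/-- The linear map `v ↦ [ξ ⊗ v]`. -/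
noncomputable def rk {A : D} (ξ : Module.Dual k (X.obj A)) : X.obj A →ₗ[k] EndCheck X where
  toFun v := of X A (rankOne ξ v)
  map_add' v w := by
    rw [← map_add]; congr 1; ext x; simp [rankOne]
  map_smul' c v := by
    rw [RingHom.id_apply, ← map_smul]; congr 1; ext x; exact smul_comm _ _ _

theorem rk_sum {A : D} {ι : Type*} (s : Finset ι) (ξ : ι → Module.Dual k (X.obj A)) (v : X.obj A) :
    rk X (∑ i ∈ s, ξ i) v = ∑ i ∈ s, rk X (ξ i) v := by
  change of X A _ = ∑ i ∈ s, of X A _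
  rw [← map_sum]; congr 1; ext x; simp [rankOne, Finset.sum_smul]

theorem rk_smul {A : D} (c : k) (ξ : Module.Dual k (X.obj A)) (v : X.obj A) :
    rk X (c • ξ) v = c • rk X ξ v := by
  change of X A _ = c • of X A _
  rw [← map_smul]; congr 1; ext x; simp [rankOne, mul_smul]

theorem rk_map {A B : D} (f : A ⟶ B) (ξ : Module.Dual k (X.obj B)) (v : X.obj A) :
    rk X ξ ((X.map f).hom.hom v) = rk X (ξ ∘ₗ (X.map f).hom.hom) v := by
  have h1 : (X.map f).hom.hom ∘ₗ rankOne ξ v = rankOne ξ ((X.map f).hom.hom v) := by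
    ext x; simp [rankOne]
  have h2 : rankOne ξ v ∘ₗ (X.map f).hom.hom = rankOne (ξ ∘ₗ (X.map f).hom.hom) v := by
    ext x; simp [rankOne]
  change of X B _ = of X A _
  rw [← h1, ← h2, of_comp]

theorem sum_coord_comp {V W : Type*} [AddCommGroup V] [Module k V] [Module.Finite k V]
    [AddCommGroup W] [Module k W] (ξ : Module.Dual k W) (L : V →ₗ[k] W) :
    ξ ∘ₗ L = ∑ j, ξ (L (Module.finBasis k V j)) • (Module.finBasis k V).coord j := by
  refine (Module.finBasis k V).ext fun j => ?_
  simp [Finsupp.single_apply]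

/-- The local comultiplication `h ↦ ∑_{j,l} [e_l^* ⊗ h(e_j)] ⊗ [e_j^* ⊗ e_l]`, for a basis `e` of
`X(A)`. On `h = e_j^i = e_i^* ⊗ e_j` it is `∑_l [e^l_j] ⊗ [e^i_l]`. -/
noncomputable def comulLocal (A : D) :
    Module.End k (X.obj A) →ₗ[k] EndCheck X ⊗[k] EndCheck X :=
  ∑ j, ∑ l, (TensorProduct.mk k _ _).flip
      (rk X ((Module.finBasis k (X.obj A)).coord j) (Module.finBasis k (X.obj A) l)) ∘ₗ
    rk X ((Module.finBasis k (X.obj A)).coord l) ∘ₗ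
      LinearMap.applyₗ (Module.finBasis k (X.obj A) j)

theorem comulLocal_apply (A : D) (h : Module.End k (X.obj A)) :
    comulLocal X A h = ∑ j, ∑ l,
      rk X ((Module.finBasis k (X.obj A)).coord l) (h (Module.finBasis k (X.obj A) j)) ⊗ₜ[k]
        rk X ((Module.finBasis k (X.obj A)).coord j) (Module.finBasis k (X.obj A) l) := by
  simp [comulLocal, LinearMap.sum_apply]

theorem comulLocal_rankOne (A : D) (ξ : Module.Dual k (X.obj A)) (v : X.obj A) :
    comulLocal X A (rankOne ξ v) = ∑ l,
      rk X ((Module.finBasis k (X.obj A)).coord l) v ⊗ₜ[k]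
        rk X ξ (Module.finBasis k (X.obj A) l) := by
  rw [comulLocal_apply, Finset.sum_comm]
  refine Finset.sum_congr rfl fun l _ => ?_
  have h1 : ξ = ∑ j, ξ (Module.finBasis k (X.obj A) j) • (Module.finBasis k (X.obj A)).coord j :=
    sum_coord_comp ξ LinearMap.id
  conv_rhs => rw [h1, rk_sum, TensorProduct.tmul_sum]
  refine Finset.sum_congr rfl fun j _ => ?_
  rw [rk_smul]
  simp [rankOne, TensorProduct.smul_tmul]

/-- `∑_l [e_l^* ⊗ v] ⊗ [ξ ⊗ L e_l] = ∑_m [(e'_m^* ∘ L) ⊗ v] ⊗ [ξ ⊗ e'_m]`. -/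
theorem comul_sum_map {A B : D} (L : X.obj A →ₗ[k] X.obj B) (ξ : Module.Dual k (X.obj B))
    (v : X.obj A) :
    ∑ l, rk X ((Module.finBasis k (X.obj A)).coord l) v ⊗ₜ[k]
        rk X ξ (L (Module.finBasis k (X.obj A) l)) =
      ∑ m, rk X ((Module.finBasis k (X.obj B)).coord m ∘ₗ L) v ⊗ₜ[k]
        rk X ξ (Module.finBasis k (X.obj B) m) := by
  have h1 : ∀ l, L (Module.finBasis k (X.obj A) l) = ∑ m,
      (Module.finBasis k (X.obj B)).coord m (L (Module.finBasis k (X.obj A) l)) •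
        Module.finBasis k (X.obj B) m := fun l =>
    ((Module.finBasis k (X.obj B)).sum_repr _).symm
  have h2 : ∀ l, rk X ξ (L (Module.finBasis k (X.obj A) l)) = ∑ m,
      (Module.finBasis k (X.obj B)).coord m (L (Module.finBasis k (X.obj A) l)) •
        rk X ξ (Module.finBasis k (X.obj B) m) := fun l => by
    conv_lhs => rw [h1, map_sum]
    simp only [map_smul]
  simp only [h2, sum_coord_comp _ L, rk_sum, rk_smul, TensorProduct.tmul_sum,
    TensorProduct.sum_tmul, TensorProduct.tmul_smul, TensorProduct.smul_tmul']
  rw [Finset.sum_comm]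

theorem comulLocal_dinatural {A B : D} (f : A ⟶ B) (h : X.obj B →ₗ[k] X.obj A) :
    comulLocal X A (h ∘ₗ (X.map f).hom.hom) = comulLocal X B ((X.map f).hom.hom ∘ₗ h) := by
  have key : ∀ (ξ : Module.Dual k (X.obj B)) (v : X.obj A),
      comulLocal X A (rankOne ξ v ∘ₗ (X.map f).hom.hom) =
        comulLocal X B ((X.map f).hom.hom ∘ₗ rankOne ξ v) := by
    intro ξ v
    have h1 : (X.map f).hom.hom ∘ₗ rankOne ξ v = rankOne ξ ((X.map f).hom.hom v) := by
      ext x; simp [rankOne]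
    have h2 : rankOne ξ v ∘ₗ (X.map f).hom.hom = rankOne (ξ ∘ₗ (X.map f).hom.hom) v := by
      ext x; simp [rankOne]
    rw [h1, h2, comulLocal_rankOne, comulLocal_rankOne]
    simp only [← rk_map X f ξ, rk_map X f _ v]
    exact comul_sum_map X (X.map f).hom.hom ξ v
  have hs := sum_rankOne h
  have h1 : h ∘ₗ (X.map f).hom.hom = ∑ i, rankOne ((Module.finBasis k (X.obj B)).coord i)
      (h (Module.finBasis k (X.obj B) i)) ∘ₗ (X.map f).hom.hom := by
    conv_lhs => rw [← hs]
    ext x; simp [LinearMap.sum_apply]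
  have h2 : (X.map f).hom.hom ∘ₗ h = ∑ i, (X.map f).hom.hom ∘ₗ
      rankOne ((Module.finBasis k (X.obj B)).coord i) (h (Module.finBasis k (X.obj B) i)) := by
    conv_lhs => rw [← hs]
    ext x; simp [LinearMap.sum_apply]
  rw [h1, h2, map_sum, map_sum]
  exact Finset.sum_congr rfl fun i _ => key _ _

/-- The comultiplication of `End^∨(X)`: `Δ[e^i_j] = ∑_l [e^l_j] ⊗ [e^i_l]`. This is the convention
for which `v ↦ ∑_l [e_l^* ⊗ v] ⊗ e_l` makes `X(A)` a left comodule. -/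
noncomputable def comulMap : EndCheck X →ₗ[k] EndCheck X ⊗[k] EndCheck X :=
  lift X (comulLocal X) (comulLocal_dinatural X)

theorem comulMap_rk (A : D) (ξ : Module.Dual k (X.obj A)) (v : X.obj A) :
    comulMap X (rk X ξ v) = ∑ l,
      rk X ((Module.finBasis k (X.obj A)).coord l) v ⊗ₜ[k]
        rk X ξ (Module.finBasis k (X.obj A) l) :=
  (lift_of X _ (comulLocal_dinatural X) A _).trans (comulLocal_rankOne X A ξ v)

/-- The counit of `End^∨(X)`: `ε[h] = Tr(h)`. -/
noncomputable def counitMap : EndCheck X →ₗ[k] k :=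
  lift X (fun A => LinearMap.trace k (X.obj A)) (fun {_ _} _ _ => LinearMap.trace_comp_comm' _ _)

theorem counitMap_rk (A : D) (ξ : Module.Dual k (X.obj A)) (v : X.obj A) :
    counitMap X (rk X ξ v) = ξ v :=
  (lift_of X (fun A => LinearMap.trace k (X.obj A))
    (fun {_ _} _ _ => LinearMap.trace_comp_comm' _ _) A _).trans (by
    have := LinearMap.trace_eq_contract_apply (R := k) (M := X.obj A) (ξ ⊗ₜ v)
    rw [contractLeft_apply] at this
    rw [← this]
    rfl)

noncomputable instance : Coalgebra k (EndCheck X) where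
  comul := comulMap X
  counit := counitMap X
  coassoc := hom_ext' X fun A ξ v => by
    change TensorProduct.assoc k _ _ _ ((comulMap X).rTensor _ (comulMap X (rk X ξ v))) =
      (comulMap X).lTensor _ (comulMap X (rk X ξ v))
    simp only [comulMap_rk, map_sum, LinearMap.rTensor_tmul, LinearMap.lTensor_tmul,
      TensorProduct.sum_tmul, TensorProduct.tmul_sum, TensorProduct.assoc_tmul]
    rw [Finset.sum_comm]
  rTensor_counit_comp_comul := hom_ext' X fun A ξ v => by
    change (counitMap X).rTensor _ (comulMap X (rk X ξ v)) = 1 ⊗ₜ[k] rk X ξ v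
    simp only [comulMap_rk, map_sum, LinearMap.rTensor_tmul, counitMap_rk]
    have : ∀ l, (Module.finBasis k (X.obj A)).coord l v ⊗ₜ[k]
        rk X ξ (Module.finBasis k (X.obj A) l) = (1 : k) ⊗ₜ[k]
          rk X ξ ((Module.finBasis k (X.obj A)).coord l v • Module.finBasis k (X.obj A) l) := by
      intro l
      rw [map_smul, ← TensorProduct.smul_tmul, smul_eq_mul, mul_one]
    simp only [this]
    rw [← TensorProduct.tmul_sum, ← map_sum]
    congr 2
    exact (Module.finBasis k (X.obj A)).sum_repr v
  lTensor_counit_comp_comul := hom_ext' X fun A ξ v => by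
    change (counitMap X).lTensor _ (comulMap X (rk X ξ v)) = rk X ξ v ⊗ₜ[k] 1
    simp only [comulMap_rk, map_sum, LinearMap.lTensor_tmul, counitMap_rk]
    have : ∀ l, rk X ((Module.finBasis k (X.obj A)).coord l) v ⊗ₜ[k]
        ξ (Module.finBasis k (X.obj A) l) =
          rk X (ξ (Module.finBasis k (X.obj A) l) • (Module.finBasis k (X.obj A)).coord l) v
            ⊗ₜ[k] (1 : k) := by
      intro l
      rw [rk_smul, TensorProduct.smul_tmul, smul_eq_mul, mul_one]
    simp only [this]
    rw [← TensorProduct.sum_tmul, ← rk_sum]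
    exact congrArg (fun z => rk X z v ⊗ₜ[k] (1 : k)) (sum_coord_comp ξ LinearMap.id).symm

end EndCheck

end EndCheck

/-! ### The coend of a fiber functor and its elements -/

namespace EndCheck

section Basic

variable {k : Type w} [Field k] {D : Type u} [Category.{v} D] (X : D ⥤ FGModuleCat.{w} k)

/-! The proof is Tannakian reconstruction by matrix coefficients. The coend of a fiber functor F_α
is spanned by classes [ξ ⊗ v], with v in F(U) and ξ in its dual, which are bilinear and satisfy [ξ ⊗
F(f)v] = [(ξ ∘ F(f)) ⊗ v]. Structure on the category turns into structure on these classes. Tensor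
products give [ξ ⊗ u][η ⊗ v] = [(ξ ⊗ η) ⊗ (u ⊗ v)], the unit object gives 1, and φ̇_β gives [ξ ⊗ u]
↦ [ξφ̇_β⁻¹ ⊗ φ̇_β u]. A dual Y of U identifies F(Y) with F(U)^*, and the antipode is [ξ ⊗ u] ↦ [u ⊗
ξ], read on Y. Each axiom of H then comes from an arrow of the category that carries one coefficient
to another (`coef_eq_of_hom`): an associator, a unitor, a coherence of the conjugation, an
evaluation or a coevaluation.

Sending U to F(U) with these coefficients defines a tensor functor to comodules, and the main point
is that it is an equivalence on each component. The key is to recognize when [ξ ⊗ x] vanishes. Left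
exactness makes the category of pairs (A, x) cofiltered, and the coend maps to the filtered colimit
of the spaces F(A)^* over it. Hence [ξ ⊗ x] = 0 only if x is the image of some y along an arrow f
with ξ ∘ F(f) = 0 (`exists_of_rk_eq_zero`). By finite dimension and passage to an image, x then lies
in a subobject on which ξ ↦ [ξ ⊗ x] is injective (`exists_cyclic`). Fullness follows by applying
this to points (x, t x) of the graph of a comodule map t (`exists_hom_of_forall_rk`). For essential
surjectivity, every comodule is a quotient of some F(B) (`exists_cover`). Covering the kernel as
well presents the comodule by an arrow of the category, whose cokernel realizes it
(`exists_obj_equiv`).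

The category of comodules is autonomous because the antipode of the coend reverses the
comultiplication. Its abelian structure is transported from the given category, and exactness of
tensoring and of conjugation is checked on underlying spaces.

For uniqueness, an equivalence with comodules over K sends [ξ ⊗ u] to a matrix coefficient in K.
This map is injective because the vectors with vanishing coefficient against ξ form a subcomodule,
which must come from an object. It is surjective because every element of a coalgebra is a
coefficient of a finite-dimensional comodule (`exists_coaction`). It respects products, unit and
conjugation by naturality, and the antipode because convolution inverses are unique
(`eq_of_convolution`). -/

theorem map_comp_apply {A B C : D} (f : A ⟶ B) (g : B ⟶ C) (x : X.obj A) :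
    (X.map (f ≫ g)).hom.hom x = (X.map g).hom.hom ((X.map f).hom.hom x) := by
  rw [X.map_comp]; rfl

theorem map_id_apply (A : D) (x : X.obj A) : (X.map (𝟙 A)).hom.hom x = x := by
  rw [X.map_id]; rfl

theorem rk_add_left {A : D} (ξ η : Module.Dual k (X.obj A)) (v : X.obj A) :
    rk X (ξ + η) v = rk X ξ v + rk X η v := by
  change of X A _ = of X A _ + of X A _
  rw [← map_add]; congr 1; ext x; simp [rankOne, add_smul]

/-- The bilinear map `(ξ, v) ↦ [ξ ⊗ v]`. -/
noncomputable def rkₗ (A : D) : Module.Dual k (X.obj A) →ₗ[k] X.obj A →ₗ[k] EndCheck X where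
  toFun ξ := rk X ξ
  map_add' ξ η := LinearMap.ext fun v => rk_add_left X ξ η v
  map_smul' c ξ := LinearMap.ext fun v => rk_smul X c ξ v

@[simp] theorem rkₗ_apply (A : D) (ξ : Module.Dual k (X.obj A)) (v : X.obj A) :
    rkₗ X A ξ v = rk X ξ v := rfl

variable {X} in
/-- Induction over sums of the classes `[ξ ⊗ v]`. -/
theorem rk_induction {P : EndCheck X → Prop} (h0 : P 0)
    (hrk : ∀ A (ξ : Module.Dual k (X.obj A)) (v : X.obj A), P (rk X ξ v))
    (hadd : ∀ x y, P x → P y → P (x + y)) (x : EndCheck X) : P x := by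
  classical
  obtain ⟨z, rfl⟩ := Submodule.mkQ_surjective _ x
  induction z using DirectSum.induction_on with
  | zero => rw [map_zero]; exact h0
  | add x y hx hy => rw [map_add]; exact hadd _ _ hx hy
  | of A h =>
    change P (of X A h)
    rw [← sum_rankOne h, map_sum]
    exact Finset.sum_induction _ P hadd h0 fun i _ => hrk _ _ _

/-! ### Maps out of the coend from dinatural bilinear maps -/

section liftRk

variable {M : Type*} [AddCommGroup M] [Module k M]
  (c : ∀ A, Module.Dual k (X.obj A) →ₗ[k] X.obj A →ₗ[k] M)

/-- The linear map `End(X(A)) → M` induced by a bilinear map on `X(A)^* × X(A)`. -/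
noncomputable def ofBilin (A : D) : Module.End k (X.obj A) →ₗ[k] M :=
  ∑ i, c A ((Module.finBasis k (X.obj A)).coord i) ∘ₗ
    LinearMap.applyₗ (Module.finBasis k (X.obj A) i)

theorem ofBilin_rankOne (A : D) (ξ : Module.Dual k (X.obj A)) (v : X.obj A) :
    ofBilin X c A (rankOne ξ v) = c A ξ v := by
  have h1 : ξ = ∑ j, ξ (Module.finBasis k (X.obj A) j) • (Module.finBasis k (X.obj A)).coord j :=
    sum_coord_comp ξ LinearMap.id
  have h2 : c A ξ v = ∑ j, ξ (Module.finBasis k (X.obj A) j) •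
      c A ((Module.finBasis k (X.obj A)).coord j) v := by
    conv_lhs => rw [h1]
    simp only [map_sum, map_smul, LinearMap.sum_apply, LinearMap.smul_apply]
  rw [h2]
  simp [ofBilin, rankOne, LinearMap.sum_apply]

/-- Both sides are linear in `h`, and every `h` is a sum of rank one operators, for which the
relation is exactly `hc`. -/
theorem ofBilin_dinatural
    (hc : ∀ (A B : D) (f : A ⟶ B) (ξ : Module.Dual k (X.obj B)) (v : X.obj A),
      c B ξ ((X.map f).hom.hom v) = c A (ξ ∘ₗ (X.map f).hom.hom) v)
    {A B : D} (f : A ⟶ B) (h : X.obj B →ₗ[k] X.obj A) :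
    ofBilin X c A (h ∘ₗ (X.map f).hom.hom) = ofBilin X c B ((X.map f).hom.hom ∘ₗ h) := by
  suffices H : ofBilin X c A ∘ₗ (LinearMap.lcomp k (X.obj A) (X.map f).hom.hom) =
      ofBilin X c B ∘ₗ (LinearMap.llcomp k (X.obj B) (X.obj A) (X.obj B) (X.map f).hom.hom) from
    LinearMap.congr_fun H h
  refine LinearMap.ext fun h => ?_
  rw [← sum_rankOne h, map_sum, map_sum]
  refine Finset.sum_congr rfl fun i _ => ?_
  generalize (Module.finBasis k (X.obj B)).coord i = ξ
  generalize h (Module.finBasis k (X.obj B) i) = v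
  change ofBilin X c A (rankOne ξ v ∘ₗ (X.map f).hom.hom) =
    ofBilin X c B ((X.map f).hom.hom ∘ₗ rankOne ξ v)
  have h1 : (X.map f).hom.hom ∘ₗ rankOne ξ v = rankOne ξ ((X.map f).hom.hom v) := by
    ext x; simp [rankOne]
  have h2 : rankOne ξ v ∘ₗ (X.map f).hom.hom = rankOne (ξ ∘ₗ (X.map f).hom.hom) v := by
    ext x; simp [rankOne]
  rw [h1, h2, ofBilin_rankOne, ofBilin_rankOne]
  exact (hc A B f ξ v).symm

/-- The linear map out of the coend with given values on the classes `[ξ ⊗ v]`. -/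
noncomputable def liftRk
    (hc : ∀ (A B : D) (f : A ⟶ B) (ξ : Module.Dual k (X.obj B)) (v : X.obj A),
      c B ξ ((X.map f).hom.hom v) = c A (ξ ∘ₗ (X.map f).hom.hom) v) :
    EndCheck X →ₗ[k] M :=
  lift X (ofBilin X c) (ofBilin_dinatural X c hc)

theorem liftRk_rk
    (hc : ∀ (A B : D) (f : A ⟶ B) (ξ : Module.Dual k (X.obj B)) (v : X.obj A),
      c B ξ ((X.map f).hom.hom v) = c A (ξ ∘ₗ (X.map f).hom.hom) v)
    {A : D} (ξ : Module.Dual k (X.obj A)) (v : X.obj A) :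
    liftRk X c hc (rk X ξ v) = c A ξ v :=
  (lift_of X _ (ofBilin_dinatural X c hc) A _).trans (ofBilin_rankOne X c A ξ v)

end liftRk

end Basic

/-! ### The filtered colimit of dual spaces over the category of elements -/

section Filtered

open Limits

variable {k : Type w} [Field k] {D : Type u} [Category.{v} D] (X : D ⥤ FGModuleCat.{w} k)

/-- The underlying functor to sets. -/
abbrev toType : D ⥤ Type w := X ⋙ forget₂ (FGModuleCat.{w} k) (ModuleCat.{w} k) ⋙ forget _

/-- The functor `(A, x) ↦ X(A)^*` on the opposite category of elements. -/
def dualDiagram : AsSmall.{w} (toType X).Elementsᵒᵖ ⥤ ModuleCat.{max u v w} k :=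
  AsSmall.down ⋙
  { obj p := ModuleCat.of k (ULift.{max u v} (Module.Dual k (X.obj p.unop.1)))
    map f := ModuleCat.ofHom (ULift.moduleEquiv.symm.toLinearMap ∘ₗ
      (X.map f.unop.1).hom.hom.dualMap ∘ₗ ULift.moduleEquiv.toLinearMap)
    map_id _ := ModuleCat.hom_ext (LinearMap.ext fun ξ => ULift.ext _ _
      (LinearMap.ext fun x => congrArg ξ.down (map_id_apply X _ x)))
    map_comp _ _ := ModuleCat.hom_ext (LinearMap.ext fun ξ => ULift.ext _ _
      (LinearMap.ext fun x => congrArg ξ.down (map_comp_apply X _ _ x))) }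

/-- The object of the index category given by `x ∈ X(A)`. -/
def pt {A : D} (x : X.obj A) : AsSmall.{w} (toType X).Elementsᵒᵖ :=
  ⟨Opposite.op ⟨A, x⟩⟩

/-- The class of `ξ` at `(A, x)` in the colimit. -/
noncomputable def germ {A : D} (x : X.obj A) :
    Module.Dual k (X.obj A) →ₗ[k] (colimit (dualDiagram X) : ModuleCat.{max u v w} k) :=
  (colimit.ι (dualDiagram X) (pt X x)).hom ∘ₗ ULift.moduleEquiv.symm.toLinearMap

theorem germ_map {A B : D} (f : A ⟶ B) (x : X.obj A) (ξ : Module.Dual k (X.obj B)) :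
    germ X ((X.map f).hom.hom x) ξ = germ X x (ξ ∘ₗ (X.map f).hom.hom) := by
  let φ : pt X ((X.map f).hom.hom x) ⟶ pt X x := ⟨Quiver.Hom.op ⟨f, rfl⟩⟩
  have := colimit.w (dualDiagram X) φ
  exact (congrArg (fun g => g.hom (ULift.up ξ)) this).symm

/-- Left exactness makes the category of elements cofiltered, so the colimit is filtered, and an
element vanishes in a filtered colimit only if it already vanishes at a later stage. An arrow to a
later stage is an arrow of `D` into `A` hitting `x`. -/
theorem exists_of_germ_eq_zero [HasFiniteLimits D] [PreservesFiniteLimits X] {A : D} (x : X.obj A)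
    (ξ : Module.Dual k (X.obj A)) (h : germ X x ξ = 0) :
    ∃ (B : D) (f : B ⟶ A) (y : X.obj B), (X.map f).hom.hom y = x ∧
      ξ ∘ₗ (X.map f).hom.hom = 0 := by
  have : IsCofiltered (toType X).Elements := Functor.isCofiltered_elements _
  have : IsFiltered (AsSmall.{w} (toType X).Elementsᵒᵖ) :=
    IsFiltered.of_equivalence AsSmall.equiv
  -- Filtered colimits of modules are computed on underlying sets, by way of abelian groups.
  have : PreservesColimit (dualDiagram X) (forget (ModuleCat.{max u v w} k)) :=
    inferInstanceAs (PreservesColimit (dualDiagram X)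
      (forget₂ (ModuleCat.{max u v w} k) AddCommGrpCat.{max u v w} ⋙ forget _))
  obtain ⟨⟨⟨B, y⟩⟩, ⟨f⟩, hf⟩ := Concrete.colimit_rep_eq_zero.{w, max u v w} k (dualDiagram X) (pt X x) (ULift.up ξ) h
  exact ⟨B, f.unop.1, y, f.unop.2, congrArg ULift.down hf⟩

end Filtered

end EndCheck

/-! ### Coactions and their matrix coefficients -/

namespace Coaction

variable {k : Type*} [Field k] {A B V W Z : Type*} [AddCommGroup A] [Module k A]
  [AddCommGroup B] [Module k B] [AddCommGroup V] [Module k V] [AddCommGroup W] [Module k W]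
  [AddCommGroup Z] [Module k Z]

/-- The contraction `a ⊗ v ↦ ζ(v) a`. -/
noncomputable def slice (A : Type*) [AddCommGroup A] [Module k A] (ζ : Module.Dual k V) :
    A ⊗[k] V →ₗ[k] A :=
  (TensorProduct.rid k A).toLinearMap ∘ₗ ζ.lTensor A

@[simp] theorem slice_tmul (ζ : Module.Dual k V) (a : A) (v : V) :
    slice A ζ (a ⊗ₜ v) = ζ v • a := by
  simp [slice]

theorem slice_add (ζ η : Module.Dual k V) (t : A ⊗[k] V) :
    slice A (ζ + η) t = slice A ζ t + slice A η t := by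
  simp [slice, LinearMap.lTensor_add]

theorem slice_smul (c : k) (ζ : Module.Dual k V) (t : A ⊗[k] V) :
    slice A (c • ζ) t = c • slice A ζ t := by
  simp [slice, LinearMap.lTensor_smul]

/-- The contraction as a bilinear map. -/
noncomputable def sliceₗ (A : Type*) [AddCommGroup A] [Module k A] :
    Module.Dual k V →ₗ[k] A ⊗[k] V →ₗ[k] A where
  toFun := slice A
  map_add' ζ η := LinearMap.ext (slice_add ζ η)
  map_smul' c ζ := LinearMap.ext (slice_smul c ζ)

@[simp] theorem sliceₗ_apply (ζ : Module.Dual k V) (t : A ⊗[k] V) : sliceₗ A ζ t = slice A ζ t := rfl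

theorem slice_sum {ι : Type*} (s : Finset ι) (ζ : ι → Module.Dual k V) (t : A ⊗[k] V) :
    slice A (∑ i ∈ s, ζ i) t = ∑ i ∈ s, slice A (ζ i) t := by
  simp only [← sliceₗ_apply, map_sum, LinearMap.sum_apply]

theorem slice_map (f : A →ₗ[k] B) (g : V →ₗ[k] W) (ζ : Module.Dual k W) (t : A ⊗[k] V) :
    slice B ζ (TensorProduct.map f g t) = f (slice A (ζ ∘ₗ g) t) := by
  induction t with
  | zero => simp
  | add x y hx hy => simp only [map_add, hx, hy]
  | tmul a v => simp

theorem slice_rTensor (f : A →ₗ[k] B) (ζ : Module.Dual k V) (t : A ⊗[k] V) :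
    slice B ζ (f.rTensor V t) = f (slice A ζ t) := slice_map f LinearMap.id ζ t

theorem slice_lTensor (g : V →ₗ[k] W) (ζ : Module.Dual k W) (t : A ⊗[k] V) :
    slice A ζ (g.lTensor A t) = slice A (ζ ∘ₗ g) t := slice_map LinearMap.id g ζ t

theorem sum_slice {ι : Type*} [Fintype ι] (b : Module.Basis ι k V) (t : A ⊗[k] V) :
    ∑ i, slice A (b.coord i) t ⊗ₜ[k] b i = t := by
  induction t with
  | zero => simp
  | add x y hx hy => simp only [map_add, TensorProduct.add_tmul, Finset.sum_add_distrib, hx, hy]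
  | tmul a v =>
    simp only [slice_tmul, TensorProduct.smul_tmul, ← TensorProduct.tmul_sum]
    rw [show ∑ i, b.coord i v • b i = v from b.sum_repr v]

/-- The contractions with the coordinates of a basis are the coordinates of A ⊗ V ≅ ⨁ A. Finiteness
of the basis is not needed. -/
theorem slice_ext_basis {ι : Type*} (b : Module.Basis ι k V) {s t : A ⊗[k] V}
    (h : ∀ i, slice A (b.coord i) s = slice A (b.coord i) t) : s = t := by
  classical
  apply (TensorProduct.equivFinsuppOfBasisRight b).injective
  ext i
  have key : ∀ t : A ⊗[k] V, TensorProduct.equivFinsuppOfBasisRight b t i =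
      slice A (b.coord i) t := by
    intro t
    induction t with
    | zero => simp
    | add x y hx hy => simp only [map_add, Finsupp.add_apply, hx, hy]
    | tmul a v => simp
  rw [key, key, h]

theorem slice_ext {s t : A ⊗[k] V} (h : ∀ ζ, slice A ζ s = slice A ζ t) : s = t :=
  slice_ext_basis (Module.Basis.ofVectorSpace k V) fun _ => h _

/-- The sum `∑ B(e_i^*, e_i)` does not depend on the basis `e`. -/
theorem sum_coord_eq {ι κ : Type*} [Fintype ι] [Fintype κ] (b : Module.Basis ι k V)
    (c : Module.Basis κ k V) (β : Module.Dual k V →ₗ[k] V →ₗ[k] Z) :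
    ∑ i, β (b.coord i) (b i) = ∑ j, β (c.coord j) (c j) := by
  have h1 : ∀ i, b i = ∑ j, c.coord j (b i) • c j := fun i => (c.sum_repr (b i)).symm
  have h2 : ∀ j, c.coord j = ∑ i, c.coord j (b i) • b.coord i := fun j =>
    b.ext fun l => by
      classical
      simp [Finsupp.single_apply]
  calc ∑ i, β (b.coord i) (b i) = ∑ i, ∑ j, c.coord j (b i) • β (b.coord i) (c j) := by
        refine Finset.sum_congr rfl fun i _ => ?_
        conv_lhs => rw [h1 i]
        simp only [map_sum, map_smul]
    _ = ∑ j, β (c.coord j) (c j) := by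
        rw [Finset.sum_comm]
        refine Finset.sum_congr rfl fun j _ => ?_
        conv_rhs => rw [h2 j]
        simp only [map_sum, map_smul, LinearMap.sum_apply, LinearMap.smul_apply]

theorem dualDistrib_basis_coord {ι κ : Type*} (b : Module.Basis ι k V)
    (c : Module.Basis κ k W) (i : ι) (j : κ) :
    (b.tensorProduct c).coord (i, j) =
      TensorProduct.dualDistrib k V W (b.coord i ⊗ₜ c.coord j) := by
  classical
  refine (b.tensorProduct c).ext fun ⟨i', j'⟩ => ?_
  simp only [Module.Basis.tensorProduct_apply, TensorProduct.dualDistrib_apply]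
  simp only [Module.Basis.coord_apply, Module.Basis.tensorProduct_repr_tmul_apply,
    Module.Basis.repr_self, smul_eq_mul]
  exact mul_comm _ _

theorem slice_ext_tensor {s t : A ⊗[k] (V ⊗[k] W)}
    (h : ∀ ζ η, slice A (TensorProduct.dualDistrib k V W (ζ ⊗ₜ η)) s =
      slice A (TensorProduct.dualDistrib k V W (ζ ⊗ₜ η)) t) : s = t :=
  slice_ext_basis ((Module.Basis.ofVectorSpace k V).tensorProduct
    (Module.Basis.ofVectorSpace k W)) fun ⟨i, j⟩ => by
      rw [dualDistrib_basis_coord, h]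

/-- The matrix coefficients of a tensor product of coactions. -/
theorem slice_tensor (mu : A ⊗[k] B →ₗ[k] Z) (r : V →ₗ[k] A ⊗[k] V) (q : W →ₗ[k] B ⊗[k] W)
    (ζ : Module.Dual k V) (η : Module.Dual k W) (v : V) (w : W) :
    slice Z (TensorProduct.dualDistrib k V W (ζ ⊗ₜ η))
      ((mu.rTensor (V ⊗[k] W) ∘ₗ (TensorProduct.tensorTensorTensorComm k _ _ _ _).toLinearMap ∘ₗ
        TensorProduct.map r q) (v ⊗ₜ w)) = mu (slice A ζ (r v) ⊗ₜ slice B η (q w)) := by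
  simp only [LinearMap.comp_apply, TensorProduct.map_tmul, LinearEquiv.coe_coe]
  generalize r v = s
  generalize q w = t
  induction s with
  | zero => simp
  | add x y hx hy => simp only [TensorProduct.add_tmul, map_add, hx, hy]
  | tmul a v =>
    induction t with
    | zero => simp
    | add x y hx hy => simp only [TensorProduct.tmul_add, map_add, hx, hy]
    | tmul b w =>
      simp only [TensorProduct.tensorTensorTensorComm_tmul, LinearMap.rTensor_tmul, slice_tmul,
        TensorProduct.dualDistrib_apply, TensorProduct.tmul_smul, ← TensorProduct.smul_tmul',
        map_smul, smul_smul, mul_comm]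

/-- The coaction with given matrix coefficients. -/
noncomputable def ofCoeff {ι : Type*} [Fintype ι] (b : Module.Basis ι k V)
    (c : Module.Dual k V →ₗ[k] V →ₗ[k] A) : V →ₗ[k] A ⊗[k] V :=
  ∑ i, (TensorProduct.mk k A V).flip (b i) ∘ₗ c (b.coord i)

theorem slice_ofCoeff {ι : Type*} [Fintype ι] (b : Module.Basis ι k V)
    (c : Module.Dual k V →ₗ[k] V →ₗ[k] A) (ζ : Module.Dual k V) (v : V) :
    slice A ζ (ofCoeff b c v) = c ζ v := by
  have h : ζ = ∑ i, ζ (b i) • b.coord i := b.ext fun l => by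
    simp
  have h2 : c ζ v = ∑ i, ζ (b i) • c (b.coord i) v := by
    conv_lhs => rw [h]
    simp only [map_sum, map_smul, LinearMap.sum_apply, LinearMap.smul_apply]
  rw [h2]
  simp [ofCoeff, LinearMap.sum_apply]

section Coalgebra

variable [Coalgebra k A]

/-- Coassociativity of a coaction. -/
def IsCoassoc (r : V →ₗ[k] A ⊗[k] V) : Prop :=
  ∀ m, TensorProduct.assoc k A A V ((comul (R := k) (A := A)).rTensor V (r m)) = r.lTensor A (r m)

/-- Counitality of a coaction. -/
def IsCounital (r : V →ₗ[k] A ⊗[k] V) : Prop :=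
  ∀ m, TensorProduct.lid k V ((counit (R := k) (A := A)).rTensor V (r m)) = m

theorem lTensor_slice_assoc (ζ : Module.Dual k V) (t : A ⊗[k] V) :
    (slice A ζ).lTensor A
      (TensorProduct.assoc k A A V ((comul (R := k) (A := A)).rTensor V t)) =
      comul (R := k) (slice A ζ t) := by
  induction t with
  | zero => simp
  | add x y hx hy => simp only [map_add, hx, hy]
  | tmul a v =>
    simp only [LinearMap.rTensor_tmul, slice_tmul, map_smul]
    generalize comul (R := k) a = s
    induction s with
    | zero => simp
    | add x y hx hy => simp only [map_add, TensorProduct.add_tmul, smul_add, hx, hy]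
    | tmul a b => simp

/-- This is coassociativity with its last leg contracted against ζ. In this form the comodule axioms
become statements about matrix coefficients alone. -/
theorem comul_slice {r : V →ₗ[k] A ⊗[k] V} (hr : IsCoassoc r) (ζ : Module.Dual k V) (v : V) :
    comul (R := k) (slice A ζ (r v)) = (slice A ζ ∘ₗ r).lTensor A (r v) := by
  rw [← lTensor_slice_assoc, hr, LinearMap.lTensor_comp]; rfl

theorem comul_slice_basis {r : V →ₗ[k] A ⊗[k] V} (hr : IsCoassoc r) {ι : Type*} [Fintype ι]
    (b : Module.Basis ι k V) (ζ : Module.Dual k V) (v : V) :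
    comul (R := k) (slice A ζ (r v)) =
      ∑ i, slice A (b.coord i) (r v) ⊗ₜ[k] slice A ζ (r (b i)) := by
  rw [comul_slice hr]
  conv_lhs => rw [← sum_slice b (r v)]
  simp

/-- Contractions of the last leg separate elements of A ⊗ A ⊗ V, so the identity on coefficients
gives back coassociativity. -/
theorem isCoassoc_of_comul_slice {r : V →ₗ[k] A ⊗[k] V}
    (h : ∀ ζ v, comul (R := k) (slice A ζ (r v)) = (slice A ζ ∘ₗ r).lTensor A (r v)) :
    IsCoassoc r := by
  intro m
  let e := (TensorProduct.assoc k A A V).symm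
  apply e.injective
  refine slice_ext fun ζ => ?_
  have key : ∀ t, slice (A ⊗[k] A) ζ (e t) = (slice A ζ).lTensor A t := by
    intro t
    obtain ⟨t, rfl⟩ := (TensorProduct.assoc k A A V).surjective t
    simp only [e, LinearEquiv.symm_apply_apply]
    induction t with
    | zero => simp
    | add x y hx hy => simp only [map_add, hx, hy]
    | tmul a v =>
      induction a with
      | zero => simp
      | add x y hx hy => simp only [TensorProduct.add_tmul, map_add, hx, hy]
      | tmul a b => simp
  rw [key, key, lTensor_slice_assoc, h, LinearMap.lTensor_comp]; rfl

theorem slice_lid_counit (ζ : Module.Dual k V) (t : A ⊗[k] V) :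
    ζ (TensorProduct.lid k V ((counit (R := k) (A := A)).rTensor V t)) =
      counit (R := k) (slice A ζ t) := by
  induction t with
  | zero => simp
  | add x y hx hy => simp only [map_add, hx, hy]
  | tmul a v => simp [mul_comm]

theorem counit_slice {r : V →ₗ[k] A ⊗[k] V} (hr : IsCounital r) (ζ : Module.Dual k V) (v : V) :
    counit (R := k) (slice A ζ (r v)) = ζ v := by
  rw [← slice_lid_counit, hr]

theorem isCounital_of_counit_slice {r : V →ₗ[k] A ⊗[k] V}
    (h : ∀ ζ v, counit (R := k) (slice A ζ (r v)) = ζ v) : IsCounital r := by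
  intro m
  rw [← sub_eq_zero]
  refine (Module.forall_dual_apply_eq_zero_iff k _).1 fun ζ => ?_
  rw [map_sub, slice_lid_counit, h, sub_self]

theorem isCoassoc_ofCoeff {ι : Type*} [Fintype ι] (b : Module.Basis ι k V)
    (c : Module.Dual k V →ₗ[k] V →ₗ[k] A)
    (hc : ∀ ζ v, comul (R := k) (c ζ v) = ∑ i, c (b.coord i) v ⊗ₜ[k] c ζ (b i)) :
    IsCoassoc (ofCoeff b c) :=
  isCoassoc_of_comul_slice fun ζ v => by
    rw [slice_ofCoeff, hc]
    conv_rhs => rw [← sum_slice b (ofCoeff b c v)]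
    simp [slice_ofCoeff]

theorem isCounital_ofCoeff {ι : Type*} [Fintype ι] (b : Module.Basis ι k V)
    (c : Module.Dual k V →ₗ[k] V →ₗ[k] A) (hc : ∀ ζ v, counit (R := k) (c ζ v) = ζ v) :
    IsCounital (ofCoeff b c) :=
  isCounital_of_counit_slice fun ζ v => by rw [slice_ofCoeff, hc]

/-- A coaction restricts to a subspace if the matrix coefficients of the subspace with respect to
functionals vanishing on it are zero. -/
theorem exists_restrict {r : V →ₗ[k] A ⊗[k] V} (hr : IsCoassoc r) (hr' : IsCounital r)
    (j : W →ₗ[k] V) (hj : Function.Injective j)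
    (h : ∀ (ζ : Module.Dual k V) (w : W), ζ ∘ₗ j = 0 → slice A ζ (r (j w)) = 0) :
    ∃ q : W →ₗ[k] A ⊗[k] W, IsCoassoc q ∧ IsCounital q ∧
      ∀ ζ w, slice A ζ (r (j w)) = slice A (ζ ∘ₗ j) (q w) := by
  obtain ⟨p, hp⟩ := LinearMap.exists_leftInverse_of_injective j (LinearMap.ker_eq_bot.2 hj)
  -- The left inverse `p` is only linear. It serves because ζ − ζ ∘ j ∘ p vanishes on `W`, so by `h`
  -- the two functionals give the same coefficients there.
  let q : W →ₗ[k] A ⊗[k] W := p.lTensor A ∘ₗ r ∘ₗ j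
  have hq : ∀ ζ w, slice A ζ (r (j w)) = slice A (ζ ∘ₗ j) (q w) := by
    intro ζ w
    simp only [q, LinearMap.comp_apply, slice_lTensor]
    rw [← sub_eq_zero, ← sliceₗ_apply, ← sliceₗ_apply, ← LinearMap.sub_apply, ← map_sub]
    refine h _ w ?_
    rw [LinearMap.sub_comp, LinearMap.comp_assoc, LinearMap.comp_assoc, hp, LinearMap.comp_id,
      sub_self]
  have hq' : ∀ ζ w, slice A ζ (q w) = slice A (ζ ∘ₗ p) (r (j w)) := by
    intro ζ w
    simp only [q, LinearMap.comp_apply, slice_lTensor]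
  have hq2 : ∀ w, j.lTensor A (q w) = r (j w) := fun w =>
    slice_ext fun ζ => by rw [slice_lTensor, hq]
  refine ⟨q, isCoassoc_of_comul_slice fun ζ w => ?_, isCounital_of_counit_slice fun ζ w => ?_, hq⟩
  · rw [hq', comul_slice hr, ← hq2, ← LinearMap.comp_apply, ← LinearMap.lTensor_comp]
    congr 2
    ext w'
    simp only [LinearMap.comp_apply, hq']
  · rw [hq', counit_slice hr', LinearMap.comp_apply]
    exact congrArg ζ (LinearMap.congr_fun hp w)

end Coalgebra

end Coaction

/-! ### Reconstruction of an abelian category from an exact faithful fiber functor -/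

namespace EndCheck

open Limits Coaction ZeroObject

variable {k : Type w} [Field k] {D : Type u} [Category.{v} D]

theorem map_injective_of_mono (ω : D ⥤ FGModuleCat.{w} k) [PreservesFiniteLimits ω] {A B : D}
    (f : A ⟶ B) [Mono f] : Function.Injective (ω.map f).hom.hom :=
  (ModuleCat.mono_iff_injective
    ((forget₂ (FGModuleCat.{w} k) (ModuleCat.{w} k)).map (ω.map f))).1 inferInstance

theorem map_surjective_of_epi (ω : D ⥤ FGModuleCat.{w} k) [PreservesFiniteColimits ω] {A B : D}
    (f : A ⟶ B) [Epi f] : Function.Surjective (ω.map f).hom.hom :=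
  (ModuleCat.epi_iff_surjective
    ((forget₂ (FGModuleCat.{w} k) (ModuleCat.{w} k)).map (ω.map f))).1 inferInstance

theorem epi_of_map_surjective (ω : D ⥤ FGModuleCat.{w} k) [ω.Faithful] {A B : D}
    (f : A ⟶ B) (h : Function.Surjective (ω.map f).hom.hom) : Epi f := by
  have : Epi (ω.map f) := (forget₂ (FGModuleCat.{w} k) (ModuleCat.{w} k)).epi_of_epi_map
    ((ModuleCat.epi_iff_surjective _).2 h)
  exact ω.epi_of_epi_map this

variable [Abelian D] (ω : D ⥤ FGModuleCat.{w} k)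

/-! ### Consequences of biproducts: sums of classes are classes -/

section Biproduct

variable [ω.Additive]

theorem map_add_apply {A B : D} (f g : A ⟶ B) (x : ω.obj A) :
    (ω.map (f + g)).hom.hom x = (ω.map f).hom.hom x + (ω.map g).hom.hom x := by
  rw [ω.map_add]; rfl

theorem map_zero_apply {A B : D} (x : ω.obj A) : (ω.map (0 : A ⟶ B)).hom.hom x = 0 := by
  rw [ω.map_zero]; rfl

/-- The element of `ω(A ⊞ B)` with components `x` and `y`. -/
noncomputable def pair {A B : D} (x : ω.obj A) (y : ω.obj B) : ω.obj (A ⊞ B) :=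
  (ω.map biprod.inl).hom.hom x + (ω.map biprod.inr).hom.hom y

@[simp] theorem fst_pair {A B : D} (x : ω.obj A) (y : ω.obj B) :
    (ω.map (biprod.fst : A ⊞ B ⟶ A)).hom.hom (pair ω x y) = x := by
  rw [pair, map_add, ← map_comp_apply, ← map_comp_apply, biprod.inl_fst, biprod.inr_fst,
    map_id_apply, map_zero_apply, add_zero]

@[simp] theorem snd_pair {A B : D} (x : ω.obj A) (y : ω.obj B) :
    (ω.map (biprod.snd : A ⊞ B ⟶ B)).hom.hom (pair ω x y) = y := by
  rw [pair, map_add, ← map_comp_apply, ← map_comp_apply, biprod.inl_snd, biprod.inr_snd,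
    map_id_apply, map_zero_apply, zero_add]

theorem rk_pair_fst {A B : D} (x : ω.obj A) (y : ω.obj B) (ξ : Module.Dual k (ω.obj A)) :
    rk ω (ξ ∘ₗ (ω.map (biprod.fst : A ⊞ B ⟶ A)).hom.hom) (pair ω x y) = rk ω ξ x := by
  rw [← rk_map, fst_pair]

theorem rk_pair_snd {A B : D} (x : ω.obj A) (y : ω.obj B) (ξ : Module.Dual k (ω.obj B)) :
    rk ω (ξ ∘ₗ (ω.map (biprod.snd : A ⊞ B ⟶ B)).hom.hom) (pair ω x y) = rk ω ξ y := by
  rw [← rk_map, snd_pair]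

/-- Every element of the coend is the class of a rank one operator. -/
theorem exists_rk (a : EndCheck ω) :
    ∃ (A : D) (ξ : Module.Dual k (ω.obj A)) (x : ω.obj A), a = rk ω ξ x := by
  induction a using rk_induction with
  | h0 => exact ⟨0, 0, 0, (map_zero _).symm⟩
  | hrk A ξ v => exact ⟨A, ξ, v, rfl⟩
  | hadd a b ha hb =>
    obtain ⟨A, ξ, x, rfl⟩ := ha
    obtain ⟨B, η, y, rfl⟩ := hb
    exact ⟨A ⊞ B, ξ ∘ₗ (ω.map biprod.fst).hom.hom + η ∘ₗ (ω.map biprod.snd).hom.hom,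
      pair ω x y, by rw [rk_add_left, rk_pair_fst, rk_pair_snd]⟩

/-- Every tensor arises by pushing the canonical coaction of a single vector `x` of some ω(A) along
a linear map `g`. Pure tensors use `exists_rk`, and sums are absorbed into a biproduct. -/
theorem exists_slice_eq_rk {V : Type*} [AddCommGroup V] [Module k V] (t : EndCheck ω ⊗[k] V) :
    ∃ (A : D) (g : ω.obj A →ₗ[k] V) (x : ω.obj A),
      ∀ ζ : Module.Dual k V, slice (EndCheck ω) ζ t = rk ω (ζ ∘ₗ g) x := by
  induction t with
  | zero => exact ⟨0, 0, 0, fun ζ => by simp⟩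
  | tmul a v =>
    obtain ⟨A, ξ, x, rfl⟩ := exists_rk ω a
    refine ⟨A, ξ.smulRight v, x, fun ζ => ?_⟩
    have h : ζ ∘ₗ ξ.smulRight v = ζ v • ξ := by
      ext y
      simp [mul_comm]
    rw [slice_tmul, h, rk_smul]
  | add s t hs ht =>
    obtain ⟨A, g, x, hg⟩ := hs
    obtain ⟨B, h, y, hh⟩ := ht
    refine ⟨A ⊞ B, g ∘ₗ (ω.map biprod.fst).hom.hom + h ∘ₗ (ω.map biprod.snd).hom.hom,
      pair ω x y, fun ζ => ?_⟩
    rw [map_add, hg, hh, LinearMap.comp_add, rk_add_left, ← LinearMap.comp_assoc,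
      ← LinearMap.comp_assoc, rk_pair_fst, rk_pair_snd]

/-- The vectors x, y and x + y index different terms of the diagram, so additivity is not automatic.
All three are images of `pair ω x y`, under the arrows `fst`, `snd` and `fst + snd` from A ⊞ A, and
there the claim is linearity in the functional. -/
theorem germ_add {A : D} (x y : ω.obj A) (ξ : Module.Dual k (ω.obj A)) :
    germ ω (x + y) ξ = germ ω x ξ + germ ω y ξ := by
  have h : (ω.map (biprod.fst + biprod.snd : A ⊞ A ⟶ A)).hom.hom (pair ω x y) = x + y := by
    rw [map_add_apply, fst_pair, snd_pair]
  have h1 : germ ω x ξ = germ ω (pair ω x y) (ξ ∘ₗ (ω.map biprod.fst).hom.hom) := by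
    rw [← germ_map, fst_pair]
  have h2 : germ ω y ξ = germ ω (pair ω x y) (ξ ∘ₗ (ω.map biprod.snd).hom.hom) := by
    rw [← germ_map, snd_pair]
  rw [← h, germ_map, h1, h2, ← map_add]
  refine congrArg _ (LinearMap.ext fun z => ?_)
  rw [LinearMap.comp_apply, map_add_apply, map_add]
  rfl

end Biproduct

theorem ker_map_cokernel [ω.Additive] [PreservesFiniteLimits ω] [PreservesFiniteColimits ω]
    {A B : D} (f : A ⟶ B) :
    LinearMap.ker (ω.map (cokernel.π f)).hom.hom = LinearMap.range (ω.map f).hom.hom := by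
  have := ((ShortComplex.exact_cokernel f).map
    (ω ⋙ forget₂ (FGModuleCat.{w} k) (ModuleCat.{w} k)))
  exact this.moduleCat_range_eq_ker.symm

variable [Linear k D] [ω.Linear k]

theorem map_smul_apply {A B : D} (c : k) (f : A ⟶ B) (x : ω.obj A) :
    (ω.map (c • f)).hom.hom x = c • (ω.map f).hom.hom x := by
  rw [ω.map_smul]; rfl

theorem germ_smul {A : D} (c : k) (x : ω.obj A) (ξ : Module.Dual k (ω.obj A)) :
    germ ω (c • x) ξ = c • germ ω x ξ := by
  have h : (ω.map (c • 𝟙 A)).hom.hom x = c • x := by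
    rw [map_smul_apply, map_id_apply]
  rw [← h, germ_map, ← map_smul]
  refine congrArg _ (LinearMap.ext fun z => ?_)
  rw [LinearMap.comp_apply, map_smul_apply, map_id_apply, map_smul]
  rfl

variable [ω.Additive]

/-- The germ is bilinear and dinatural, so it factors through the coend. -/
theorem germ_eq_zero_of_rk_eq_zero {A : D} {x : ω.obj A} {ξ : Module.Dual k (ω.obj A)}
    (h : rk ω ξ x = 0) : germ ω x ξ = 0 := by
  let c : ∀ A, Module.Dual k (ω.obj A) →ₗ[k] ω.obj A →ₗ[k]
      (colimit (dualDiagram ω) : ModuleCat.{max u v w} k) := fun A =>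
    LinearMap.mk₂ k (fun ξ x => germ ω x ξ) (fun ξ η x => map_add _ _ _)
      (fun c ξ x => map_smul _ _ _) (fun ξ x y => germ_add ω x y ξ)
      (fun c ξ x => germ_smul ω c x ξ)
  have := liftRk_rk ω c (fun A B f ξ v => germ_map ω f v ξ) ξ x
  rw [h, map_zero] at this
  exact this.symm

/-! ### Vanishing of classes, cyclic subobjects and fullness -/

section Exact

variable [PreservesFiniteLimits ω]

theorem exists_of_rk_eq_zero {A : D} {x : ω.obj A} {ξ : Module.Dual k (ω.obj A)}
    (h : rk ω ξ x = 0) : ∃ (B : D) (f : B ⟶ A) (y : ω.obj B), (ω.map f).hom.hom y = x ∧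
      ξ ∘ₗ (ω.map f).hom.hom = 0 :=
  exists_of_germ_eq_zero ω x ξ (germ_eq_zero_of_rk_eq_zero ω h)

/-- The functionals are killed one at a time, each along a further arrow into the object already
found; functionals killed earlier stay killed after composition. -/
theorem exists_of_forall_rk_eq_zero {A : D} (x : ω.obj A)
    (s : Finset (Module.Dual k (ω.obj A))) (h : ∀ ξ ∈ s, rk ω ξ x = 0) :
    ∃ (B : D) (f : B ⟶ A) (y : ω.obj B), (ω.map f).hom.hom y = x ∧
      ∀ ξ ∈ s, ξ ∘ₗ (ω.map f).hom.hom = 0 := by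
  classical
  induction s using Finset.induction_on with
  | empty => exact ⟨A, 𝟙 A, x, map_id_apply ω A x, by simp⟩
  | insert ξ s _ ih =>
    obtain ⟨B, f, y, hy, hf⟩ := ih fun η hη => h η (Finset.mem_insert_of_mem hη)
    obtain ⟨B', g, z, hz, hg⟩ := exists_of_rk_eq_zero ω (x := y) (ξ := ξ ∘ₗ (ω.map f).hom.hom)
      (by rw [← rk_map, hy]; exact h ξ (Finset.mem_insert_self _ _))
    refine ⟨B', g ≫ f, z, by rw [map_comp_apply, hz, hy], fun η hη => ?_⟩
    have hgf : (ω.map (g ≫ f)).hom.hom = (ω.map f).hom.hom ∘ₗ (ω.map g).hom.hom :=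
      LinearMap.ext (map_comp_apply ω g f)
    rw [hgf, ← LinearMap.comp_assoc]
    rcases Finset.mem_insert.1 hη with rfl | hη
    · exact hg
    · rw [hf η hη, LinearMap.zero_comp]

variable [PreservesFiniteColimits ω]

/-- Every element `x ∈ ω(A)` comes from a subobject `B` of `A` on which the classes `[ξ ⊗ x]`
vanish only for `ξ = 0`. -/
theorem exists_cyclic {A : D} (x : ω.obj A) :
    ∃ (B : D) (i : B ⟶ A) (y : ω.obj B), (ω.map i).hom.hom y = x ∧
      ∀ ξ : Module.Dual k (ω.obj B), rk ω ξ y = 0 → ξ = 0 := by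
  -- `K` consists of all ξ with [ξ ⊗ x] = 0. It is finite-dimensional, so a single arrow `f` through
  -- which `x` passes kills all of it, and the image of `f` is the subobject wanted.
  let K : Submodule k (Module.Dual k (ω.obj A)) := LinearMap.ker ((rkₗ ω A).flip x)
  obtain ⟨s, hs⟩ : K.FG := IsNoetherian.noetherian K
  obtain ⟨B, f, y, hy, hf⟩ := exists_of_forall_rk_eq_zero ω x s fun ξ hξ => by
    have : ξ ∈ K := hs ▸ Submodule.subset_span hξ
    exact this
  have hK : ∀ ξ ∈ K, ξ ∘ₗ (ω.map f).hom.hom = 0 := by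
    intro ξ hξ
    rw [← hs] at hξ
    induction hξ using Submodule.span_induction with
    | mem ξ h => exact hf ξ h
    | zero => rw [LinearMap.zero_comp]
    | add ξ η _ _ h1 h2 => rw [LinearMap.add_comp, h1, h2, add_zero]
    | smul c ξ _ h => rw [LinearMap.smul_comp, h, smul_zero]
  have hfac : ∀ z, (ω.map f).hom.hom z = (ω.map (Abelian.image.ι f)).hom.hom
      ((ω.map (Abelian.factorThruImage f)).hom.hom z) := fun z => by
    rw [← map_comp_apply, Abelian.image.fac]
  refine ⟨Abelian.image f, Abelian.image.ι f,
    (ω.map (Abelian.factorThruImage f)).hom.hom y, ?_, fun ξ hξ => ?_⟩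
  · rw [← hfac, hy]
  -- A functional on the image with zero class extends along `p` to an element of `K`, so it
  -- vanishes on the range of `f`, which is the whole image.
  · obtain ⟨p, hp⟩ := LinearMap.exists_leftInverse_of_injective _
      (LinearMap.ker_eq_bot.2 (map_injective_of_mono ω (Abelian.image.ι f)))
    have h1 : (ξ ∘ₗ p) ∘ₗ (ω.map (Abelian.image.ι f)).hom.hom = ξ := by
      rw [LinearMap.comp_assoc, hp, LinearMap.comp_id]
    have h2 : ξ ∘ₗ p ∈ K := by
      change rk ω (ξ ∘ₗ p) x = 0
      rw [← hy, hfac, rk_map, h1, hξ]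
    have h3 := hK _ h2
    ext z
    obtain ⟨z, rfl⟩ := map_surjective_of_epi ω (Abelian.factorThruImage f) z
    conv_lhs => rw [← h1]
    have h4 := LinearMap.congr_fun h3 z
    rw [LinearMap.comp_apply, hfac] at h4
    exact h4

/-- The graph of `t` is covered by an object: a cyclic subobject of A ⊞ B containing (x, t x) lies
in the graph, and finitely many of them project onto A. The resulting epimorphism N ⟶ A and arrow N
⟶ B then yield the arrow by descent. -/
theorem exists_hom_of_forall_rk [ω.Faithful] {A B : D} (t : ω.obj A →ₗ[k] ω.obj B)
    (ht : ∀ (ζ : Module.Dual k (ω.obj B)) (x : ω.obj A), rk ω ζ (t x) = rk ω (ζ ∘ₗ t) x) :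
    ∃ f : A ⟶ B, (ω.map f).hom.hom = t := by
  have key : ∀ U : Submodule k (ω.obj A), U.FG → ∃ (N : D) (p : N ⟶ A) (q : N ⟶ B),
      t ∘ₗ (ω.map p).hom.hom = (ω.map q).hom.hom ∧ U ≤ LinearMap.range (ω.map p).hom.hom := by
    intro U hU
    induction U, hU using Submodule.fg_induction with
    | singleton x =>
      obtain ⟨N, i, z, hz, hN⟩ := exists_cyclic ω (pair ω x (t x))
      have hp : (ω.map (i ≫ biprod.fst)).hom.hom z = x := by
        rw [map_comp_apply, hz, fst_pair]
      have hq : (ω.map (i ≫ biprod.snd)).hom.hom z = t x := by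
        rw [map_comp_apply, hz, snd_pair]
      refine ⟨N, i ≫ biprod.fst, i ≫ biprod.snd, ?_, ?_⟩
      · refine LinearMap.ext fun y => ?_
        rw [← sub_eq_zero]
        refine (Module.forall_dual_apply_eq_zero_iff k _).1 fun ζ => ?_
        -- This functional tests ζ(t p − q) on `N`. Its class at the cyclic vector is [(ζ ∘ t) ⊗ x]
        -- − [ζ ⊗ t x] = 0 by `ht`, so cyclicity makes the functional itself zero.
        have := hN (ζ ∘ₗ t ∘ₗ (ω.map (i ≫ biprod.fst)).hom.hom -
          ζ ∘ₗ (ω.map (i ≫ biprod.snd)).hom.hom) (by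
            rw [← rkₗ_apply, map_sub, LinearMap.sub_apply, rkₗ_apply, rkₗ_apply,
              ← LinearMap.comp_assoc, ← rk_map, ← rk_map, hp, hq, ht, sub_self])
        rw [map_sub]
        exact LinearMap.congr_fun this y
      · rw [Submodule.span_singleton_le_iff_mem]
        exact ⟨z, hp⟩
    | sup U₁ U₂ h₁ h₂ ih₁ ih₂ =>
      obtain ⟨N₁, p₁, q₁, e₁, r₁⟩ := ih₁
      obtain ⟨N₂, p₂, q₂, e₂, r₂⟩ := ih₂
      refine ⟨N₁ ⊞ N₂, biprod.fst ≫ p₁ + biprod.snd ≫ p₂, biprod.fst ≫ q₁ + biprod.snd ≫ q₂,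
        LinearMap.ext fun y => ?_, sup_le (r₁.trans ?_) (r₂.trans ?_)⟩
      · simp only [LinearMap.comp_apply, map_add_apply, map_comp_apply, map_add, ← e₁, ← e₂]
      · rintro _ ⟨x, rfl⟩
        exact ⟨pair ω x 0, by simp only [map_add_apply, map_comp_apply, fst_pair, snd_pair,
          map_zero, add_zero]⟩
      · rintro _ ⟨x, rfl⟩
        exact ⟨pair ω 0 x, by simp only [map_add_apply, map_comp_apply, fst_pair, snd_pair,
          map_zero, zero_add]⟩
  obtain ⟨N, p, q, e, r⟩ := key ⊤ (Module.finite_def.1 inferInstance)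
  have hp : Function.Surjective (ω.map p).hom.hom := LinearMap.range_eq_top.1 (top_le_iff.1 r)
  have := epi_of_map_surjective ω p hp
  -- Faithfulness reduces this to vector spaces, where ω(q) = t ∘ ω(p) kills whatever ω(p) kills.
  have hk : kernel.ι p ≫ q = 0 := by
    apply ω.map_injective
    refine FGModuleCat.hom_ext (LinearMap.ext fun y => ?_)
    rw [map_comp_apply, map_zero_apply, ← e, LinearMap.comp_apply, ← map_comp_apply,
      kernel.condition, map_zero_apply, map_zero]
  refine ⟨Abelian.epiDesc p q hk, LinearMap.ext fun x => ?_⟩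
  obtain ⟨y, rfl⟩ := hp x
  rw [← map_comp_apply, Abelian.comp_epiDesc, ← e, LinearMap.comp_apply]

/-! ### Comodules over the coend come from objects -/

section EssSurj

variable {V : Type w} [AddCommGroup V] [Module k V] [Module.Finite k V]
  {r : V →ₗ[k] EndCheck ω ⊗[k] V}

/-- For a single vector `m`, the coaction of `m` is read off from a vector `x` of some ω(B) and a
linear map `g`, and B is shrunk until `x` is cyclic. Counitality gives g(x) = m, and coassociativity
forces `g` to be a comodule map. Biproducts then combine a finite set of generators. -/
theorem exists_cover (hr : IsCoassoc r) (hr' : IsCounital r) :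
    ∃ (B : D) (g : ω.obj B →ₗ[k] V), Function.Surjective g ∧
      ∀ ζ y, slice (EndCheck ω) ζ (r (g y)) = rk ω (ζ ∘ₗ g) y := by
  have key : ∀ U : Submodule k V, U.FG → ∃ (B : D) (g : ω.obj B →ₗ[k] V),
      U ≤ LinearMap.range g ∧ ∀ ζ y, slice (EndCheck ω) ζ (r (g y)) = rk ω (ζ ∘ₗ g) y := by
    intro U hU
    induction U, hU using Submodule.fg_induction with
    | singleton m =>
      obtain ⟨A, g₀, x₀, hg₀⟩ := exists_slice_eq_rk ω (r m)
      obtain ⟨B, i, x, hx, hB⟩ := exists_cyclic ω x₀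
      obtain ⟨g, hgdef⟩ : ∃ g, g = g₀ ∘ₗ (ω.map i).hom.hom := ⟨_, rfl⟩
      have hg : ∀ ζ, slice (EndCheck ω) ζ (r m) = rk ω (ζ ∘ₗ g) x := by
        intro ζ
        rw [hg₀, ← hx, rk_map, hgdef, LinearMap.comp_assoc]
      refine ⟨B, g, ?_, fun ζ y => ?_⟩
      · rw [Submodule.span_singleton_le_iff_mem]
        refine ⟨x, ?_⟩
        rw [← sub_eq_zero]
        refine (Module.forall_dual_apply_eq_zero_iff k _).1 fun ζ => ?_
        rw [map_sub, ← counit_slice hr' ζ m, hg]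
        exact sub_eq_zero.2 (counitMap_rk ω B (ζ ∘ₗ g) x).symm
      -- Cyclicity allows a functional to be recovered from its class at `x`. The map θ does so in
      -- the first leg and evaluates the result at `y`. Applied to the two expressions for Δ[(ζ ∘ g)
      -- ⊗ x], one from V and one from ω(B), it produces the two coefficients to be compared.
      · obtain ⟨P, hP⟩ := LinearMap.exists_leftInverse_of_injective ((rkₗ ω B).flip x)
          (LinearMap.ker_eq_bot'.2 hB)
        let θ : EndCheck ω ⊗[k] EndCheck ω →ₗ[k] EndCheck ω :=
          (TensorProduct.lid k _).toLinearMap ∘ₗ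
            ((LinearMap.applyₗ y) ∘ₗ P).rTensor (EndCheck ω)
        have hθ : ∀ ξ a, θ (rk ω ξ x ⊗ₜ a) = ξ y • a := by
          intro ξ a
          have : P (rk ω ξ x) = ξ := LinearMap.congr_fun hP ξ
          simp [θ, this]
        have h1 := congrArg θ (comul_slice_basis hr (Module.finBasis k V) ζ m)
        have h2 := congrArg θ (comulMap_rk ω B (ζ ∘ₗ g) x)
        rw [map_sum] at h1 h2
        simp only [hg, hθ] at h1 h2
        have h3 := h1.symm.trans h2
        calc slice (EndCheck ω) ζ (r (g y))
            = ∑ j, ((Module.finBasis k V).coord j ∘ₗ g) y •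
                slice (EndCheck ω) ζ (r (Module.finBasis k V j)) := by
              conv_lhs => rw [← (Module.finBasis k V).sum_repr (g y)]
              simp only [map_sum, map_smul]
              rfl
          _ = _ := h3
          _ = rk ω (ζ ∘ₗ g) y := by
              conv_rhs => rw [← (Module.finBasis k (ω.obj B)).sum_repr y]
              simp only [map_sum, map_smul]
              rfl
    | sup U₁ U₂ h₁ h₂ ih₁ ih₂ =>
      obtain ⟨B₁, g₁, r₁, e₁⟩ := ih₁
      obtain ⟨B₂, g₂, r₂, e₂⟩ := ih₂
      refine ⟨B₁ ⊞ B₂, g₁ ∘ₗ (ω.map biprod.fst).hom.hom + g₂ ∘ₗ (ω.map biprod.snd).hom.hom,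
        sup_le (r₁.trans ?_) (r₂.trans ?_), fun ζ y => ?_⟩
      · rintro _ ⟨x, rfl⟩
        exact ⟨pair ω x 0, by simp⟩
      · rintro _ ⟨x, rfl⟩
        exact ⟨pair ω 0 x, by simp⟩
      · simp only [LinearMap.add_apply, LinearMap.comp_apply, map_add, LinearMap.comp_add,
          rk_add_left, e₁, e₂, rk_map]
        rfl
  obtain ⟨B, g, h, e⟩ := key ⊤ (Module.finite_def.1 inferInstance)
  exact ⟨B, g, LinearMap.range_eq_top.1 (top_le_iff.1 h), e⟩

/-- Every finite-dimensional comodule over the coend comes from an object. -/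
theorem exists_obj_equiv [ω.Faithful] (hr : IsCoassoc r) (hr' : IsCounital r) :
    ∃ (Q : D) (e : ω.obj Q ≃ₗ[k] V),
      ∀ ζ y, slice (EndCheck ω) ζ (r (e y)) = rk ω (ζ ∘ₗ e.toLinearMap) y := by
  obtain ⟨B, g, hg, hgr⟩ := exists_cover ω hr hr'
  let b := Module.finBasis k (ω.obj B)
  -- The kernel of the cover is a subcomodule: a functional vanishing on it factors through `g`, and
  -- the coefficients of `g w = 0` are zero.
  obtain ⟨q, hq, hq', hqr⟩ := exists_restrict
    (isCoassoc_ofCoeff b (rkₗ ω B) (fun ζ v => comulMap_rk ω B ζ v))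
    (isCounital_ofCoeff b (rkₗ ω B) (fun ζ v => counitMap_rk ω B ζ v))
    (LinearMap.ker g).subtype (Submodule.injective_subtype _) (fun ζ w hζ => by
      have h1 : LinearMap.ker g ≤ LinearMap.ker ζ := fun y hy => LinearMap.congr_fun hζ ⟨y, hy⟩
      obtain ⟨p, hp⟩ := g.exists_rightInverse_of_surjective (LinearMap.range_eq_top.2 hg)
      have h2 : ζ = (ζ ∘ₗ p) ∘ₗ g := by
        refine LinearMap.ext fun y => ?_
        have : y - p (g y) ∈ LinearMap.ker g := by
          rw [LinearMap.mem_ker, map_sub, ← LinearMap.comp_apply g p, hp, LinearMap.id_apply,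
            sub_self]
        have := h1 this
        rw [LinearMap.mem_ker, map_sub, sub_eq_zero] at this
        exact this
      rw [slice_ofCoeff, rkₗ_apply, h2, ← hgr]
      have : g ((LinearMap.ker g).subtype w) = 0 := w.2
      rw [this, map_zero, map_zero])
  obtain ⟨B₂, g₂, hg₂, hgr₂⟩ := exists_cover ω hq hq'
  -- Covering the kernel gives a comodule map ω(B₂) → ω(B) with range ker g. By fullness it comes
  -- from an arrow `f`, and by exactness the cokernel of `f` maps to ω(B)/ker g ≅ V.
  obtain ⟨f, hf⟩ := exists_hom_of_forall_rk ω ((LinearMap.ker g).subtype ∘ₗ g₂) (fun ζ x => by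
    have := hqr ζ (g₂ x)
    rw [slice_ofCoeff, hgr₂] at this
    exact this)
  have hker : LinearMap.ker (ω.map (cokernel.π f)).hom.hom = LinearMap.ker g := by
    rw [ker_map_cokernel, hf, LinearMap.range_comp_of_range_eq_top _ (LinearMap.range_eq_top.2 hg₂),
      Submodule.range_subtype]
  have hπ := map_surjective_of_epi ω (cokernel.π f)
  let e : ω.obj (cokernel f) ≃ₗ[k] V :=
    (LinearMap.quotKerEquivOfSurjective _ hπ).symm ≪≫ₗ Submodule.quotEquivOfEq _ _ hker ≪≫ₗ
      LinearMap.quotKerEquivOfSurjective g hg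
  have he : ∀ x, e ((ω.map (cokernel.π f)).hom.hom x) = g x := by
    intro x
    have : (LinearMap.quotKerEquivOfSurjective _ hπ).symm ((ω.map (cokernel.π f)).hom.hom x) =
        Submodule.Quotient.mk x := by
      rw [LinearEquiv.symm_apply_eq]; rfl
    simp only [e, LinearEquiv.trans_apply, this]
    rfl
  refine ⟨cokernel f, e, fun ζ y => ?_⟩
  obtain ⟨x, rfl⟩ := hπ y
  have h : ζ ∘ₗ g = (ζ ∘ₗ e.toLinearMap) ∘ₗ (ω.map (cokernel.π f)).hom.hom :=
    LinearMap.ext fun z => congrArg ζ (he z).symm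
  rw [he, hgr, rk_map, h]

end EssSurj

end Exact

end EndCheck

/-! ### Monoidal functors to vector spaces, on elements -/

namespace FiberFunctor

open Coaction EndCheck

variable {k : Type w} [Field k] {C : Type u} [Category.{v} C] [MonoidalCategory C]
  (F : C ⥤ FGModuleCat.{w} k) [F.Monoidal]

/-- The isomorphism `F(U) ⊗ F(V) ≃ F(U ⊗ V)`. -/
def mu (U V : C) : F.obj U ⊗[k] F.obj V ≃ₗ[k] F.obj (U ⊗ V) :=
  FGModuleCat.isoToLinearEquiv (Functor.Monoidal.μIso F U V)

/-- The isomorphism `k ≃ F(𝟙)`. -/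
def unitEquiv : k ≃ₗ[k] F.obj (𝟙_ C) :=
  FGModuleCat.isoToLinearEquiv (Functor.Monoidal.εIso F)

/-- The image of `1` in `F(𝟙)`. -/
def unitVec : F.obj (𝟙_ C) := unitEquiv F 1

/-- The functional on `F(𝟙)` with value `1` at the image of `1`. -/
def unitFun : Module.Dual k (F.obj (𝟙_ C)) := (unitEquiv F).symm.toLinearMap

@[simp] theorem unitFun_unitVec : unitFun F (unitVec F) = 1 :=
  (unitEquiv F).symm_apply_apply 1

theorem unitFun_smul_unitVec (z : F.obj (𝟙_ C)) : unitFun F z • unitVec F = z := by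
  rw [unitVec, ← map_smul, smul_eq_mul, mul_one]
  exact (unitEquiv F).apply_symm_apply z

theorem map_whiskerLeft (U : C) {V V' : C} (g : V ⟶ V') (t : F.obj U ⊗[k] F.obj V) :
    (F.map (U ◁ g)).hom.hom (mu F U V t) =
      mu F U V' ((F.map g).hom.hom.lTensor (F.obj U) t) :=
  congrArg (fun h => h.hom.hom t) (Functor.LaxMonoidal.μ_natural_right F U g).symm

theorem map_whiskerRight {U U' : C} (f : U ⟶ U') (V : C) (t : F.obj U ⊗[k] F.obj V) :
    (F.map (f ▷ V)).hom.hom (mu F U V t) =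
      mu F U' V ((F.map f).hom.hom.rTensor (F.obj V) t) :=
  congrArg (fun h => h.hom.hom t) (Functor.LaxMonoidal.μ_natural_left F f V).symm

theorem map_associator (U V W : C) (x : F.obj U) (y : F.obj V) (z : F.obj W) :
    (F.map (α_ U V W).hom).hom.hom (mu F _ _ (mu F _ _ (x ⊗ₜ y) ⊗ₜ z)) =
      mu F _ _ (x ⊗ₜ mu F _ _ (y ⊗ₜ z)) :=
  congrArg (fun h => h.hom.hom ((x ⊗ₜ[k] y) ⊗ₜ[k] z)) (Functor.LaxMonoidal.associativity F U V W)

theorem map_associator_inv (U V W : C) (x : F.obj U) (y : F.obj V) (z : F.obj W) :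
    (F.map (α_ U V W).inv).hom.hom (mu F _ _ (x ⊗ₜ mu F _ _ (y ⊗ₜ z))) =
      mu F _ _ (mu F _ _ (x ⊗ₜ y) ⊗ₜ z) := by
  rw [← map_associator, ← map_comp_apply, Iso.hom_inv_id, map_id_apply]

theorem map_leftUnitor (U : C) (x : F.obj U) :
    (F.map (λ_ U).hom).hom.hom (mu F _ _ (unitVec F ⊗ₜ x)) = x :=
  (congrArg (fun h => h.hom.hom ((1 : k) ⊗ₜ[k] x)) (Functor.LaxMonoidal.left_unitality F U)).symm.trans
    (one_smul k x)

theorem map_rightUnitor (U : C) (x : F.obj U) :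
    (F.map (ρ_ U).hom).hom.hom (mu F _ _ (x ⊗ₜ unitVec F)) = x :=
  (congrArg (fun h => h.hom.hom (x ⊗ₜ[k] (1 : k))) (Functor.LaxMonoidal.right_unitality F U)).symm.trans
    (one_smul k x)

theorem map_leftUnitor_inv (U : C) (x : F.obj U) :
    (F.map (λ_ U).inv).hom.hom x = mu F _ _ (unitVec F ⊗ₜ x) := by
  conv_lhs => rw [← map_leftUnitor F U x]
  rw [← map_comp_apply, Iso.hom_inv_id, map_id_apply]

theorem map_rightUnitor_inv (U : C) (x : F.obj U) :
    (F.map (ρ_ U).inv).hom.hom x = mu F _ _ (x ⊗ₜ unitVec F) := by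
  conv_lhs => rw [← map_rightUnitor F U x]
  rw [← map_comp_apply, Iso.hom_inv_id, map_id_apply]

/-- The functional `ξ ⊗ η` on `F(U ⊗ V)`. -/
noncomputable def tensorFun {U V : C} (ξ : Module.Dual k (F.obj U)) (η : Module.Dual k (F.obj V)) :
    Module.Dual k (F.obj (U ⊗ V)) :=
  TensorProduct.dualDistrib k _ _ (ξ ⊗ₜ η) ∘ₗ (mu F U V).symm.toLinearMap

@[simp] theorem tensorFun_mu {U V : C} (ξ : Module.Dual k (F.obj U))
    (η : Module.Dual k (F.obj V)) (t : F.obj U ⊗[k] F.obj V) :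
    tensorFun F ξ η (mu F U V t) = TensorProduct.dualDistrib k _ _ (ξ ⊗ₜ η) t := by
  simp [tensorFun]

theorem tensorFun_mu_tmul {U V : C} (ξ : Module.Dual k (F.obj U))
    (η : Module.Dual k (F.obj V)) (x : F.obj U) (y : F.obj V) :
    tensorFun F ξ η (mu F U V (x ⊗ₜ y)) = ξ x * η y := by
  simp

theorem hom_ext_mu {U V : C} {M : Type*} [AddCommGroup M] [Module k M]
    {ξ η : F.obj (U ⊗ V) →ₗ[k] M}
    (h : ∀ x y, ξ (mu F U V (x ⊗ₜ y)) = η (mu F U V (x ⊗ₜ y))) : ξ = η := by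
  refine LinearMap.ext fun z => ?_
  obtain ⟨t, rfl⟩ := (mu F U V).surjective z
  induction t with
  | zero => simp
  | add x y hx hy => simp only [map_add, hx, hy]
  | tmul x y => exact h x y

/-- `(ξ, η) ↦ ξ ⊗ η` as a bilinear map. -/
noncomputable def tensorFunₗ (U V : C) : Module.Dual k (F.obj U) →ₗ[k]
    Module.Dual k (F.obj V) →ₗ[k] Module.Dual k (F.obj (U ⊗ V)) :=
  LinearMap.mk₂ k (tensorFun F)
    (fun _ _ _ => hom_ext_mu F fun _ _ => by simp [add_mul])
    (fun _ _ _ => hom_ext_mu F fun _ _ => by simp [mul_assoc])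
    (fun _ _ _ => hom_ext_mu F fun _ _ => by simp [mul_add])
    (fun _ _ _ => hom_ext_mu F fun _ _ => by simp)

@[simp] theorem tensorFunₗ_apply {U V : C} (ξ : Module.Dual k (F.obj U))
    (η : Module.Dual k (F.obj V)) : tensorFunₗ F U V ξ η = tensorFun F ξ η := rfl

/-! ### Fiber functors turn exact pairings into perfect pairings -/

section ExactPairing

variable (A B : C) [ExactPairing A B]

/-- The pairing `F(B) × F(A) → k` of an exact pairing. -/
noncomputable def ev : F.obj B →ₗ[k] F.obj A →ₗ[k] k :=
  TensorProduct.curry (unitFun F ∘ₗ (F.map (ε_ A B)).hom.hom ∘ₗ (mu F B A).toLinearMap)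

theorem map_evaluation (y : F.obj B) (x : F.obj A) :
    (F.map (ε_ A B)).hom.hom (mu F B A (y ⊗ₜ x)) = ev F A B y x • unitVec F :=
  (unitFun_smul_unitVec F _).symm

theorem unitFun_map_evaluation (y : F.obj B) (x : F.obj A) :
    unitFun F ((F.map (ε_ A B)).hom.hom (mu F B A (y ⊗ₜ x))) = ev F A B y x := rfl

/-- The element of `F(A) ⊗ F(B)` given by the coevaluation. -/
noncomputable def coev : F.obj A ⊗[k] F.obj B :=
  (mu F A B).symm ((F.map (η_ A B)).hom.hom (unitVec F))

theorem map_coevaluation :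
    (F.map (η_ A B)).hom.hom (unitVec F) = mu F A B (coev F A B) :=
  ((mu F A B).apply_symm_apply _).symm

/-- This is one zigzag identity of the exact pairing, pushed through `F` and evaluated at y ⊗ 1;
`key` follows the two middle arrows on an arbitrary tensor in place of the coevaluation. -/
theorem lid_rTensor_coev (y : F.obj B) :
    TensorProduct.lid k _ ((ev F A B y).rTensor (F.obj B) (coev F A B)) = y := by
  have key : ∀ t : F.obj A ⊗[k] F.obj B, (F.map (ε_ A B ▷ B)).hom.hom
      ((F.map (α_ B A B).inv).hom.hom (mu F _ _ (y ⊗ₜ mu F _ _ t))) =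
      mu F _ _ (unitVec F ⊗ₜ TensorProduct.lid k _ ((ev F A B y).rTensor (F.obj B) t)) := by
    intro t
    induction t with
    | zero => simp
    | add s t hs ht => simp only [map_add, TensorProduct.tmul_add, hs, ht]
    | tmul a b =>
      rw [map_associator_inv, map_whiskerRight, LinearMap.rTensor_tmul, map_evaluation]
      simp [TensorProduct.smul_tmul]
  have h := congrArg (fun f => (F.map f).hom.hom (mu F _ _ (y ⊗ₜ unitVec F)))
    (ExactPairing.coevaluation_evaluation A B)
  simp only [map_comp_apply] at h
  rw [map_rightUnitor, map_leftUnitor_inv, map_whiskerLeft, LinearMap.lTensor_tmul,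
    map_coevaluation, key] at h
  have h2 := congrArg (F.map (λ_ B).hom).hom.hom h
  rwa [map_leftUnitor, map_leftUnitor] at h2

/-- The other zigzag identity. Together they say that `ev` is a perfect pairing with inverse tensor
`coev`. -/
theorem rid_lTensor_coev (x : F.obj A) :
    slice (F.obj A) ((ev F A B).flip x) (coev F A B) = x := by
  have key : ∀ t : F.obj A ⊗[k] F.obj B, (F.map (A ◁ ε_ A B)).hom.hom
      ((F.map (α_ A B A).hom).hom.hom (mu F _ _ (mu F _ _ t ⊗ₜ x))) =
      mu F _ _ (slice (F.obj A) ((ev F A B).flip x) t ⊗ₜ unitVec F) := by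
    intro t
    induction t with
    | zero => simp
    | add s t hs ht => simp only [map_add, TensorProduct.add_tmul, hs, ht]
    | tmul a b =>
      rw [map_associator, map_whiskerLeft, LinearMap.lTensor_tmul, map_evaluation]
      simp [TensorProduct.smul_tmul]
  have h := congrArg (fun f => (F.map f).hom.hom (mu F _ _ (unitVec F ⊗ₜ x)))
    (ExactPairing.evaluation_coevaluation A B)
  simp only [map_comp_apply] at h
  rw [map_leftUnitor, map_rightUnitor_inv, map_whiskerRight, LinearMap.rTensor_tmul,
    map_coevaluation, key] at h
  have h2 := congrArg (F.map (ρ_ A).hom).hom.hom h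
  rwa [map_rightUnitor, map_rightUnitor] at h2

theorem apply_lid_rTensor {V W : Type*} [AddCommGroup V] [Module k V] [AddCommGroup W] [Module k W]
    (ξ : Module.Dual k V) (η : Module.Dual k W) (t : V ⊗[k] W) :
    η (TensorProduct.lid k W (ξ.rTensor W t)) = TensorProduct.dualDistrib k V W (ξ ⊗ₜ η) t := by
  induction t with
  | zero => simp
  | add s t hs ht => simp only [map_add, hs, ht]
  | tmul a b => simp

theorem apply_slice {V W : Type*} [AddCommGroup V] [Module k V] [AddCommGroup W] [Module k W]
    (ξ : Module.Dual k V) (η : Module.Dual k W) (t : V ⊗[k] W) :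
    ξ (slice V η t) = TensorProduct.dualDistrib k V W (ξ ⊗ₜ η) t := by
  induction t with
  | zero => simp
  | add s t hs ht => simp only [map_add, hs, ht]
  | tmul a b => simp [mul_comm]

/-- `F(A)` is the dual of `F(B)`. -/
noncomputable def leftDualEquiv : F.obj A ≃ₗ[k] Module.Dual k (F.obj B) :=
  LinearEquiv.ofLinearMap (ev F A B).flip ((sliceₗ (F.obj A)).flip (coev F A B))
    (LinearMap.ext fun ξ => LinearMap.ext fun y => by
      change ev F A B y (slice (F.obj A) ξ (coev F A B)) = ξ y
      rw [apply_slice, ← apply_lid_rTensor, lid_rTensor_coev])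
    (LinearMap.ext fun x => rid_lTensor_coev F A B x)

@[simp] theorem leftDualEquiv_apply (x : F.obj A) (y : F.obj B) :
    leftDualEquiv F A B x y = ev F A B y x := rfl

@[simp] theorem ev_leftDualEquiv_symm (ξ : Module.Dual k (F.obj B)) (y : F.obj B) :
    ev F A B y ((leftDualEquiv F A B).symm ξ) = ξ y :=
  LinearMap.congr_fun ((leftDualEquiv F A B).apply_symm_apply ξ) y

/-- `F(B)` is the dual of `F(A)`. -/
noncomputable def rightDualEquiv : F.obj B ≃ₗ[k] Module.Dual k (F.obj A) :=
  LinearEquiv.ofBijective (ev F A B) ⟨fun y y' h => by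
      rw [← lid_rTensor_coev F A B y, h, lid_rTensor_coev], fun ξ => by
    refine ⟨TensorProduct.lid k _ (ξ.rTensor (F.obj B) (coev F A B)), LinearMap.ext fun x => ?_⟩
    rw [← LinearMap.flip_apply, apply_lid_rTensor, ← apply_slice, rid_lTensor_coev]⟩

@[simp] theorem rightDualEquiv_apply (y : F.obj B) : rightDualEquiv F A B y = ev F A B y := rfl

@[simp] theorem ev_rightDualEquiv_symm (ξ : Module.Dual k (F.obj A)) :
    ev F A B ((rightDualEquiv F A B).symm ξ) = ξ :=
  (rightDualEquiv F A B).apply_symm_apply ξ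

end ExactPairing

/-- The mate of `f` under the two pairings becomes its transpose in vector spaces. This naturality
makes the antipode well defined on the coend. -/
theorem exists_left_mate {U V : C} (A A' : C) [ExactPairing A U] [ExactPairing A' V] (f : U ⟶ V) :
    ∃ g : A' ⟶ A, ∀ x y, ev F A U x ((F.map g).hom.hom y) = ev F A' V ((F.map f).hom.hom x) y := by
  have h := @leftAdjointMate_comp_evaluation C _ _ U V ⟨A⟩ ⟨A'⟩ f
  refine ⟨@leftAdjointMate C _ _ U V ⟨A⟩ ⟨A'⟩ f, fun x y => ?_⟩
  have h2 := congrArg (fun f => (F.map f).hom.hom (mu F _ _ (x ⊗ₜ y))) h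
  simp only [map_comp_apply] at h2
  rw [map_whiskerLeft, map_whiskerRight] at h2
  exact congrArg (unitFun F) h2

theorem exists_right_mate {U V : C} (B B' : C) [ExactPairing U B] [ExactPairing V B'] (f : U ⟶ V) :
    ∃ g : B' ⟶ B, ∀ x y, ev F U B ((F.map g).hom.hom y) x = ev F V B' y ((F.map f).hom.hom x) := by
  have h := @rightAdjointMate_comp_evaluation C _ _ U V ⟨B⟩ ⟨B'⟩ f
  refine ⟨@rightAdjointMate C _ _ U V ⟨B⟩ ⟨B'⟩ f, fun x y => ?_⟩
  have h2 := congrArg (fun f => (F.map f).hom.hom (mu F _ _ (y ⊗ₜ x))) h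
  simp only [map_comp_apply] at h2
  rw [map_whiskerLeft, map_whiskerRight] at h2
  exact congrArg (unitFun F) h2

end FiberFunctor

/-! ### The crossed Hopf algebra of a Tannakian crossed category -/

namespace CrossedCat

variable {G : Type uG} [Group G] {C : Type u} [Category.{v} C] [MonoidalCategory C]
  (X : CrossedCat G C)

theorem deg_unit : X.deg (𝟙_ C) = 1 := by
  have h := X.deg_eq_of_hom (λ_ (𝟙_ C)).hom
  rw [X.deg_tensor] at h
  exact mul_eq_right.1 h

theorem deg_mul_deg_of_exactPairing (A B : C) [ExactPairing A B] : X.deg A * X.deg B = 1 := by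
  rw [← X.deg_tensor, ← X.deg_eq_of_hom (η_ A B), deg_unit]

theorem deg_left_of_exactPairing (A B : C) [ExactPairing A B] {a : G} (h : X.deg B = a) :
    X.deg A = a⁻¹ :=
  h ▸ eq_inv_of_mul_eq_one_left (X.deg_mul_deg_of_exactPairing A B)

theorem deg_right_of_exactPairing (A B : C) [ExactPairing A B] {a : G} (h : X.deg A = a) :
    X.deg B = a⁻¹ :=
  h ▸ eq_inv_of_mul_eq_one_right (X.deg_mul_deg_of_exactPairing A B)

end CrossedCat

namespace CrossedCatOverVect

open FiberFunctor Coaction EndCheck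

variable {G : Type uG} [Group G] {k : Type w} [Field k]
  {C : Type u} [Category.{v} C] [MonoidalCategory C]
  (X : CrossedCatOverVect G k C)

/-- The class `[ξ ⊗ v]` in `End^∨(F_α)`, for an object `U` of degree `α`. -/
noncomputable def coef {a : G} (U : C) (h : X.deg U = a) :
    Module.Dual k (X.F.obj U) →ₗ[k] X.F.obj U →ₗ[k] EndCheck (X.fiber a) :=
  rkₗ (X.fiber a) ⟨U, h⟩

variable {a b c : G}

theorem coef_map {U V : C} (f : U ⟶ V) (hU : X.deg U = a) (hV : X.deg V = a)
    (ξ : Module.Dual k (X.F.obj V)) (v : X.F.obj U) :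
    X.coef V hV ξ ((X.F.map f).hom.hom v) = X.coef U hU (ξ ∘ₗ (X.F.map f).hom.hom) v :=
  rk_map (X.fiber a) (A := ⟨U, hU⟩) (B := ⟨V, hV⟩) (ObjectProperty.homMk f) ξ v

/-- The defining relation of the coend, in the form that serves for the algebra axioms: to identify
two coefficients it is enough to find an arrow matching the vectors forwards and the functionals
backwards. -/
theorem coef_eq_of_hom {U V : C} (f : U ⟶ V) (hU : X.deg U = a) (hV : X.deg V = a)
    {ξ : Module.Dual k (X.F.obj U)} {η : Module.Dual k (X.F.obj V)} {x : X.F.obj U}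
    {y : X.F.obj V} (hξ : ∀ z, η ((X.F.map f).hom.hom z) = ξ z)
    (hx : (X.F.map f).hom.hom x = y) : X.coef U hU ξ x = X.coef V hV η y := by
  rw [← hx, X.coef_map f hU hV]
  congr 2
  exact LinearMap.ext fun z => (hξ z).symm

theorem coef_cast {U : C} (hU : X.deg U = a) (h : a = b) (ξ : Module.Dual k (X.F.obj U))
    (v : X.F.obj U) :
    LinearEquiv.cast (R := k) (M := fun a => EndCheck (X.fiber a)) h (X.coef U hU ξ v) =
      X.coef U (hU.trans h) ξ v := by
  subst h; rfl

/-- The comultiplication is defined through one fixed basis, but the canonical tensor does not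
depend on it. The freedom allows bases adapted to tensor products, conjugates and duals. -/
theorem comul_coef {U : C} (hU : X.deg U = a) {ι : Type*} [Fintype ι]
    (e : Module.Basis ι k (X.F.obj U)) (ξ : Module.Dual k (X.F.obj U)) (v : X.F.obj U) :
    comul (R := k) (X.coef U hU ξ v) =
      ∑ i, X.coef U hU (e.coord i) v ⊗ₜ[k] X.coef U hU ξ (e i) := by
  refine (comulMap_rk (X.fiber a) ⟨U, hU⟩ ξ v).trans ?_
  exact sum_coord_eq (Module.finBasis k (X.F.obj U)) e
    (((TensorProduct.mk k _ _).compl₁₂ ((X.coef U hU).flip v) (X.coef U hU ξ)))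

theorem counit_coef {U : C} (hU : X.deg U = a) (ξ : Module.Dual k (X.F.obj U))
    (v : X.F.obj U) : counit (R := k) (X.coef U hU ξ v) = ξ v :=
  counitMap_rk (X.fiber a) ⟨U, hU⟩ ξ v

variable {X} in
theorem coef_ext {M : Type*} [AddCommGroup M] [Module k M] {f g : EndCheck (X.fiber a) →ₗ[k] M}
    (h : ∀ U hU ξ v, f (X.coef U hU ξ v) = g (X.coef U hU ξ v)) : f = g :=
  hom_ext' (X.fiber a) fun A ξ v => h A.obj A.property ξ v

variable {X} in
-- Biproducts in the component reduce every element to one class, so the axioms below need checking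
-- only on single coefficients.
theorem IsTannakian.exists_coef (hX : X.IsTannakian) (x : EndCheck (X.fiber a)) :
    ∃ U hU ξ v, x = X.coef U hU ξ v := by
  obtain ⟨A, hA⟩ := hX.abelian_exact
  let _ := A.abelian a
  let _ := A.linear a
  have : (X.fiber a).Additive := (hA a).1
  obtain ⟨U, ξ, v, h⟩ := exists_rk (X.fiber a) x
  exact ⟨U.obj, U.property, ξ, v, h⟩

section lift

variable {M : Type*} [AddCommGroup M] [Module k M]
  (c : ∀ U, X.deg U = a → (Module.Dual k (X.F.obj U) →ₗ[k] X.F.obj U →ₗ[k] M))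
  (hc : ∀ (U V : C) (hU : X.deg U = a) (hV : X.deg V = a) (f : U ⟶ V)
    (ξ : Module.Dual k (X.F.obj V)) (v : X.F.obj U),
    c V hV ξ ((X.F.map f).hom.hom v) = c U hU (ξ ∘ₗ (X.F.map f).hom.hom) v)

/-- The linear map out of `End^∨(F_α)` with given values on the classes `[ξ ⊗ v]`. -/
noncomputable def liftCoef : EndCheck (X.fiber a) →ₗ[k] M :=
  liftRk (X.fiber a) (fun A => c A.obj A.property)
    (fun A B f ξ v => hc A.obj B.obj A.property B.property f.hom ξ v)

theorem liftCoef_coef (U : C) (hU : X.deg U = a) (ξ : Module.Dual k (X.F.obj U)) (v : X.F.obj U) :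
    X.liftCoef c hc (X.coef U hU ξ v) = c U hU ξ v :=
  liftRk_rk (X.fiber a) (fun A => c A.obj A.property)
    (fun A B f ξ v => hc A.obj B.obj A.property B.property f.hom ξ v) (A := ⟨U, hU⟩) ξ v

end lift

theorem deg_tensor_eq {U V : C} (hU : X.deg U = a) (hV : X.deg V = b) :
    X.deg (U ⊗ V) = a * b := by
  rw [X.deg_tensor, hU, hV]

/-- Left multiplication by `[ξ ⊗ u]`. -/
noncomputable def coefMul (U : C) (hU : X.deg U = a) (b : G) (ξ : Module.Dual k (X.F.obj U))
    (u : X.F.obj U) : EndCheck (X.fiber b) →ₗ[k] EndCheck (X.fiber (a * b)) :=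
  X.liftCoef (fun V hV => (X.coef (U ⊗ V) (X.deg_tensor_eq hU hV)).compl₁₂
      (tensorFunₗ X.F U V ξ) ((mu X.F U V).toLinearMap ∘ₗ TensorProduct.mk k _ _ u))
    (fun V V' hV hV' f η v => by
      refine (X.coef_eq_of_hom (U ◁ f) _ _ (fun z => ?_) ?_).symm
      · refine LinearMap.congr_fun (f := tensorFun X.F ξ η ∘ₗ (X.F.map (U ◁ f)).hom.hom)
          (hom_ext_mu X.F fun x y => ?_) z
        rw [LinearMap.comp_apply, FiberFunctor.map_whiskerLeft]
        simp
      · exact FiberFunctor.map_whiskerLeft X.F U f _)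

theorem coefMul_coef {U V : C} (hU : X.deg U = a) (hV : X.deg V = b)
    (ξ : Module.Dual k (X.F.obj U)) (u : X.F.obj U) (η : Module.Dual k (X.F.obj V))
    (v : X.F.obj V) : X.coefMul U hU b ξ u (X.coef V hV η v) =
      X.coef (U ⊗ V) (X.deg_tensor_eq hU hV) (tensorFun X.F ξ η) (mu X.F U V (u ⊗ₜ v)) :=
  liftCoef_coef X _ _ V hV η v

/-- Left multiplication by `[ξ ⊗ u]`, as a bilinear map. -/
noncomputable def coefMulₗ (U : C) (hU : X.deg U = a) (b : G) : Module.Dual k (X.F.obj U) →ₗ[k]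
    X.F.obj U →ₗ[k] EndCheck (X.fiber b) →ₗ[k] EndCheck (X.fiber (a * b)) :=
  LinearMap.mk₂ k (X.coefMul U hU b)
    (fun ξ ξ' u => coef_ext fun V hV η v => by
      rw [LinearMap.add_apply, coefMul_coef, coefMul_coef, coefMul_coef, ← tensorFunₗ_apply,
        map_add, LinearMap.add_apply, map_add]
      rfl)
    (fun r ξ u => coef_ext fun V hV η v => by
      rw [LinearMap.smul_apply, coefMul_coef, coefMul_coef, ← tensorFunₗ_apply,
        map_smul, LinearMap.smul_apply, map_smul]
      rfl)
    (fun ξ u u' => coef_ext fun V hV η v => by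
      rw [LinearMap.add_apply, coefMul_coef, coefMul_coef, coefMul_coef, TensorProduct.add_tmul,
        map_add, map_add])
    (fun r ξ u => coef_ext fun V hV η v => by
      rw [LinearMap.smul_apply, coefMul_coef, coefMul_coef, ← TensorProduct.smul_tmul',
        map_smul, map_smul])

/-- Dinaturality in the left factor, witnessed by the arrow `f ▷ V`; dinaturality in the right
factor was settled with `U ◁ f` when the map was constructed. -/
theorem coefMul_map {U U' : C} (hU : X.deg U = a) (hU' : X.deg U' = a) (f : U ⟶ U')
    (ξ : Module.Dual k (X.F.obj U')) (u : X.F.obj U) :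
    X.coefMul U' hU' b ξ ((X.F.map f).hom.hom u) =
      X.coefMul U hU b (ξ ∘ₗ (X.F.map f).hom.hom) u :=
  coef_ext fun V hV η v => by
    rw [coefMul_coef, coefMul_coef]
    refine (X.coef_eq_of_hom (f ▷ V) _ _ (fun z => ?_) ?_).symm
    · refine LinearMap.congr_fun (f := tensorFun X.F ξ η ∘ₗ (X.F.map (f ▷ V)).hom.hom)
        (hom_ext_mu X.F fun x y => ?_) z
      rw [LinearMap.comp_apply, FiberFunctor.map_whiskerRight]
      simp
    · exact FiberFunctor.map_whiskerRight X.F f V _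

/-- The multiplication of the coends. -/
noncomputable def mulLin (a b : G) :
    EndCheck (X.fiber a) →ₗ[k] EndCheck (X.fiber b) →ₗ[k] EndCheck (X.fiber (a * b)) :=
  X.liftCoef (fun U hU => X.coefMulₗ U hU b)
    (fun _ _ hU hU' f ξ u => X.coefMul_map hU hU' f ξ u)

theorem mulLin_coef {U V : C} (hU : X.deg U = a) (hV : X.deg V = b)
    (ξ : Module.Dual k (X.F.obj U)) (u : X.F.obj U) (η : Module.Dual k (X.F.obj V))
    (v : X.F.obj V) : X.mulLin a b (X.coef U hU ξ u) (X.coef V hV η v) =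
      X.coef (U ⊗ V) (X.deg_tensor_eq hU hV) (tensorFun X.F ξ η) (mu X.F U V (u ⊗ₜ v)) := by
  have h : X.mulLin a b (X.coef U hU ξ u) = X.coefMul U hU b ξ u := liftCoef_coef X _ _ U hU ξ u
  rw [h, coefMul_coef]

/-- The basis `e_i ⊗ f_j` of `F(U ⊗ V)`. -/
noncomputable def tensorBasis {U V : C} {ι κ : Type*} (e : Module.Basis ι k (X.F.obj U))
    (f : Module.Basis κ k (X.F.obj V)) : Module.Basis (ι × κ) k (X.F.obj (U ⊗ V)) :=
  (e.tensorProduct f).map (mu X.F U V)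

theorem tensorBasis_apply {U V : C} {ι κ : Type*} (e : Module.Basis ι k (X.F.obj U))
    (f : Module.Basis κ k (X.F.obj V)) (i : ι) (j : κ) :
    X.tensorBasis e f (i, j) = mu X.F U V (e i ⊗ₜ f j) := by
  simp [tensorBasis]

theorem tensorBasis_coord {U V : C} {ι κ : Type*} (e : Module.Basis ι k (X.F.obj U))
    (f : Module.Basis κ k (X.F.obj V)) (i : ι) (j : κ) :
    (X.tensorBasis e f).coord (i, j) = tensorFun X.F (e.coord i) (f.coord j) := by
  refine LinearMap.ext fun z => ?_
  obtain ⟨t, rfl⟩ := (mu X.F U V).surjective z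
  rw [tensorFun_mu, ← dualDistrib_basis_coord]
  simp [tensorBasis]

/-- The multiplication, on the tensor product. -/
noncomputable def mulT (a b : G) :
    EndCheck (X.fiber a) ⊗[k] EndCheck (X.fiber b) →ₗ[k] EndCheck (X.fiber (a * b)) :=
  TensorProduct.lift (X.mulLin a b)

theorem mulT_coef {U V : C} (hU : X.deg U = a) (hV : X.deg V = b)
    (ξ : Module.Dual k (X.F.obj U)) (u : X.F.obj U) (η : Module.Dual k (X.F.obj V))
    (v : X.F.obj V) : X.mulT a b (X.coef U hU ξ u ⊗ₜ X.coef V hV η v) =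
      X.coef (U ⊗ V) (X.deg_tensor_eq hU hV) (tensorFun X.F ξ η) (mu X.F U V (u ⊗ₜ v)) := by
  rw [mulT, TensorProduct.lift.tmul, mulLin_coef]

theorem tensorCoalgebra_comul_tmul {A B : Type*} [AddCommGroup A] [Module k A] [Coalgebra k A]
    [AddCommGroup B] [Module k B] [Coalgebra k B] {ι κ : Type*} [Fintype ι] [Fintype κ] {x : A}
    {y : B} {p q : ι → A} {r s : κ → B} (hx : comul (R := k) x = ∑ i, p i ⊗ₜ[k] q i)
    (hy : comul (R := k) y = ∑ j, r j ⊗ₜ[k] s j) :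
    comul (R := k) (x ⊗ₜ[k] y) = ∑ i : ι × κ, (p i.1 ⊗ₜ[k] r i.2) ⊗ₜ[k] (q i.1 ⊗ₜ[k] s i.2) := by
  have h : comul (R := k) (x ⊗ₜ[k] y) = TensorProduct.tensorTensorTensorComm k A A B B
    (comul (R := k) x ⊗ₜ comul (R := k) y) := rfl
  rw [h, hx, hy, TensorProduct.sum_tmul, map_sum, Fintype.sum_prod_type]
  refine Finset.sum_congr rfl fun i _ => ?_
  rw [TensorProduct.tmul_sum, map_sum]
  exact Finset.sum_congr rfl fun j _ => TensorProduct.tensorTensorTensorComm_tmul _ _ _ _ _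

/-- In the product basis of F(U ⊗ V), whose coordinates are the products of coordinates, the two
sums agree term by term. -/
theorem map_mulT_comul {U V : C} (hU : X.deg U = a) (hV : X.deg V = b)
    (ξ : Module.Dual k (X.F.obj U)) (u : X.F.obj U) (η : Module.Dual k (X.F.obj V))
    (v : X.F.obj V) :
    TensorProduct.map (X.mulT a b) (X.mulT a b)
      (comul (R := k) (X.coef U hU ξ u ⊗ₜ[k] X.coef V hV η v)) =
      comul (R := k) (X.mulT a b (X.coef U hU ξ u ⊗ₜ X.coef V hV η v)) := by
  rw [mulT_coef]
  refine (congrArg (TensorProduct.map (X.mulT a b) (X.mulT a b)) (tensorCoalgebra_comul_tmul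
    (X.comul_coef hU (Module.finBasis k (X.F.obj U)) ξ u)
    (X.comul_coef hV (Module.finBasis k (X.F.obj V)) η v))).trans ?_
  refine (map_sum _ _ _).trans (Eq.trans ?_ (X.comul_coef _
    (X.tensorBasis (Module.finBasis k (X.F.obj U)) (Module.finBasis k (X.F.obj V))) _ _).symm)
  refine Finset.sum_congr rfl fun i _ => (TensorProduct.map_tmul _ _ _ _).trans ?_
  rw [mulT_coef, mulT_coef, tensorBasis_apply, tensorBasis_coord]

variable {X}

/-- The multiplication as a morphism of coalgebras. -/
noncomputable def IsTannakian.mulHom (hX : X.IsTannakian) (a b : G) :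
    EndCheck (X.fiber a) ⊗[k] EndCheck (X.fiber b) →ₗc[k] EndCheck (X.fiber (a * b)) where
  toLinearMap := X.mulT a b
  counit_comp := TensorProduct.ext' fun x y => by
    obtain ⟨U, hU, ξ, u, rfl⟩ := hX.exists_coef x
    obtain ⟨V, hV, η, v, rfl⟩ := hX.exists_coef y
    rw [LinearMap.comp_apply, TensorProduct.counit_tmul, mulT_coef, counit_coef, counit_coef,
      counit_coef, tensorFun_mu_tmul]
    exact mul_comm _ _
  map_comp_comul := TensorProduct.ext' fun x y => by
    obtain ⟨U, hU, ξ, u, rfl⟩ := hX.exists_coef x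
    obtain ⟨V, hV, η, v, rfl⟩ := hX.exists_coef y
    exact X.map_mulT_comul hU hV ξ u η v

theorem IsTannakian.mulHom_coef (hX : X.IsTannakian) {U V : C} (hU : X.deg U = a)
    (hV : X.deg V = b) (ξ : Module.Dual k (X.F.obj U)) (u : X.F.obj U)
    (η : Module.Dual k (X.F.obj V)) (v : X.F.obj V) :
    hX.mulHom a b (X.coef U hU ξ u ⊗ₜ X.coef V hV η v) =
      X.coef (U ⊗ V) (X.deg_tensor_eq hU hV) (tensorFun X.F ξ η) (mu X.F U V (u ⊗ₜ v)) :=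
  X.mulT_coef hU hV ξ u η v

variable (X)

/-- The isomorphism `F(U) ≃ F(Φ_β(U))`. -/
def phiE (b : G) (U : C) : X.F.obj U ≃ₗ[k] X.F.obj ((X.conj b).obj U) :=
  FGModuleCat.isoToLinearEquiv ((X.phi b).app U)

theorem phiE_map (b : G) {U V : C} (f : U ⟶ V) (u : X.F.obj U) :
    X.phiE b V ((X.F.map f).hom.hom u) =
      (X.F.map ((X.conj b).map f)).hom.hom (X.phiE b U u) :=
  congrArg (fun h => h.hom.hom u) ((X.phi b).hom.naturality f)

theorem phiE_one (U : C) (h : U = (X.conj 1).obj U) (u : X.F.obj U) :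
    X.phiE 1 U u = (X.F.map (eqToHom h)).hom.hom u := by
  rw [eqToHom_map]
  exact congrArg (fun h => h.hom.hom u) (X.phi_one U)

theorem phiE_mul (b c : G) (U : C)
    (h : (X.conj b).obj ((X.conj c).obj U) = (X.conj (b * c)).obj U) (u : X.F.obj U) :
    X.phiE (b * c) U u = (X.F.map (eqToHom h)).hom.hom (X.phiE b _ (X.phiE c U u)) := by
  rw [eqToHom_map]
  exact congrArg (fun h => h.hom.hom u) (X.phi_mul b c U)

theorem phiE_unit (b : G) : X.phiE b (𝟙_ C) (unitVec X.F) =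
    (X.F.map (eqToHom (X.conj_unit b).symm)).hom.hom (unitVec X.F) :=
  congrArg (fun h => h.hom.hom (1 : k)) (X.phi_unit b)

theorem phiE_tensor (b : G) (U V : C) (t : X.F.obj U ⊗[k] X.F.obj V) :
    X.phiE b (U ⊗ V) (mu X.F U V t) =
      (X.F.map (eqToHom (X.conj_tensor b U V).symm)).hom.hom
        (mu X.F _ _ (TensorProduct.map (X.phiE b U).toLinearMap (X.phiE b V).toLinearMap t)) :=
  congrArg (fun h => h.hom.hom t) (X.phi_tensor b U V)

theorem deg_conj_eq {U : C} (hU : X.deg U = a) (b : G) :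
    X.deg ((X.conj b).obj U) = b * a * b⁻¹ := by
  rw [X.deg_conj, hU]

/-- The conjugation of the coends. -/
noncomputable def conjLin (b a : G) :
    EndCheck (X.fiber a) →ₗ[k] EndCheck (X.fiber (b * a * b⁻¹)) :=
  X.liftCoef (fun U hU => (X.coef ((X.conj b).obj U) (X.deg_conj_eq hU b)).compl₁₂
      (X.phiE b U).symm.toLinearMap.dualMap (X.phiE b U).toLinearMap)
    (fun U V hU hV f ξ u => by
      refine (X.coef_eq_of_hom ((X.conj b).map f) _ _ (fun z => ?_) ?_).symm
      · obtain ⟨z, rfl⟩ := (X.phiE b U).surjective z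
        rw [← phiE_map]
        simp
      · exact (X.phiE_map b f u).symm)

theorem conjLin_coef (b : G) {U : C} (hU : X.deg U = a) (ξ : Module.Dual k (X.F.obj U))
    (u : X.F.obj U) : X.conjLin b a (X.coef U hU ξ u) =
      X.coef ((X.conj b).obj U) (X.deg_conj_eq hU b) (ξ ∘ₗ (X.phiE b U).symm.toLinearMap)
        (X.phiE b U u) :=
  liftCoef_coef X _ _ U hU ξ u

/-- The transport of the coends along equalities in `G`. -/
noncomputable abbrev castE (h : a = b) : EndCheck (X.fiber a) ≃ₗ[k] EndCheck (X.fiber b) :=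
  LinearEquiv.cast (R := k) (M := fun a => EndCheck (X.fiber a)) h

theorem conjLin_conjLin (b c a : G) (x : EndCheck (X.fiber a)) :
    X.castE (show b * c * a * (b * c)⁻¹ = b * (c * a * c⁻¹) * b⁻¹ by group)
      (X.conjLin (b * c) a x) = X.conjLin b _ (X.conjLin c a x) := by
  have e1 : b * c * a * (b * c)⁻¹ = b * (c * a * c⁻¹) * b⁻¹ := by group
  refine LinearMap.congr_fun (f := (X.castE e1).toLinearMap ∘ₗ X.conjLin (b * c) a)
    (g := X.conjLin b _ ∘ₗ X.conjLin c a) (coef_ext fun U hU ξ u => ?_) x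
  have e : (X.conj b).obj ((X.conj c).obj U) = (X.conj (b * c)).obj U := by
    rw [X.conj_mul]; rfl
  simp only [LinearMap.comp_apply, LinearEquiv.coe_coe, conjLin_coef, coef_cast]
  refine (X.coef_eq_of_hom (eqToHom e) _ _ (fun z => ?_) ?_).symm
  · obtain ⟨z, rfl⟩ := (X.phiE b _).surjective z
    obtain ⟨z, rfl⟩ := (X.phiE c _).surjective z
    rw [← X.phiE_mul b c U e]
    simp
  · exact (X.phiE_mul b c U e u).symm

theorem conjLin_one (a : G) (x : EndCheck (X.fiber a)) :
    X.castE (show 1 * a * 1⁻¹ = a by group) (X.conjLin 1 a x) = x := by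
  have e1 : 1 * a * 1⁻¹ = a := by group
  refine LinearMap.congr_fun (f := (X.castE e1).toLinearMap ∘ₗ X.conjLin 1 a)
    (g := LinearMap.id) (coef_ext fun U hU ξ u => ?_) x
  have e : U = (X.conj 1).obj U := by
    rw [X.conj_one]; rfl
  simp only [LinearMap.comp_apply, LinearEquiv.coe_coe, conjLin_coef, coef_cast]
  refine (X.coef_eq_of_hom (eqToHom e) _ _ (fun z => ?_) ?_).symm
  · rw [← X.phiE_one U e]
    simp
  · exact (X.phiE_one U e u).symm

theorem castE_castE (h : a = b) (h' : b = c) (x : EndCheck (X.fiber a)) :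
    X.castE h' (X.castE h x) = X.castE (h.trans h') x := by
  subst h; subst h'; rfl

theorem conjLin_castE {a' b' : G} (h : b = b') (h' : a = a') (x : EndCheck (X.fiber a)) :
    X.conjLin b' a' (X.castE h' x) = X.castE (by rw [h, h']) (X.conjLin b a x) := by
  subst h; subst h'; rfl

theorem conjLin_inv_conjLin (b a : G) (x : EndCheck (X.fiber a)) :
    X.conjLin b⁻¹ _ (X.conjLin b a x) = X.castE (by group) x := by
  rw [← conjLin_conjLin]
  conv_rhs => rw [← X.conjLin_one a x, castE_castE]
  have := X.conjLin_castE (inv_mul_cancel b).symm (rfl : a = a) x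
  rw [show X.castE (rfl : a = a) x = x from rfl] at this
  rw [this, castE_castE]

/-- Conjugation is a group action up to transport along equalities in `G`, so conjugation by b⁻¹
inverts conjugation by b. -/
theorem conjLin_bijective (b a : G) : Function.Bijective (X.conjLin b a) := by
  refine ⟨fun x y h => ?_, fun y => ?_⟩
  · have := congrArg (X.conjLin b⁻¹ _) h
    rw [conjLin_inv_conjLin, conjLin_inv_conjLin] at this
    exact (X.castE _).injective this
  · refine ⟨X.castE (by group) (X.conjLin b⁻¹ _ y), ?_⟩
    have h := X.conjLin_inv_conjLin b⁻¹ _ y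
    have h2 := X.conjLin_castE (inv_inv b) (show b⁻¹ * (b * a * b⁻¹) * b⁻¹⁻¹ = a by group)
      (X.conjLin b⁻¹ _ y)
    rw [h2, h, castE_castE]
    rfl

variable {X} in
/-- The conjugation as an isomorphism of coalgebras. -/
noncomputable def IsTannakian.conjEquiv (hX : X.IsTannakian) (b a : G) :
    EndCheck (X.fiber a) ≃ₗc[k] EndCheck (X.fiber (b * a * b⁻¹)) :=
  { LinearEquiv.ofBijective (X.conjLin b a) (X.conjLin_bijective b a) with
    counit_comp := LinearMap.ext fun x => by
      obtain ⟨U, hU, ξ, u, rfl⟩ := hX.exists_coef x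
      change counit (R := k) (X.conjLin b a _) = _
      rw [conjLin_coef, counit_coef, counit_coef]
      simp
    map_comp_comul := LinearMap.ext fun x => by
      obtain ⟨U, hU, ξ, u, rfl⟩ := hX.exists_coef x
      let e := Module.finBasis k (X.F.obj U)
      change TensorProduct.map (X.conjLin b a) (X.conjLin b a) (comul (R := k) _) =
        comul (R := k) (X.conjLin b a _)
      rw [conjLin_coef, X.comul_coef hU e, X.comul_coef _ (e.map (X.phiE b U)), map_sum]
      refine Finset.sum_congr rfl fun i _ => ?_
      rw [TensorProduct.map_tmul, conjLin_coef, conjLin_coef]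
      congr 2 }

variable {X} in
theorem IsTannakian.conjEquiv_coef (hX : X.IsTannakian) (b : G) {U : C} (hU : X.deg U = a)
    (ξ : Module.Dual k (X.F.obj U)) (u : X.F.obj U) :
    hX.conjEquiv b a (X.coef U hU ξ u) =
      X.coef ((X.conj b).obj U) (X.deg_conj_eq hU b) (ξ ∘ₗ (X.phiE b U).symm.toLinearMap)
        (X.phiE b U u) :=
  X.conjLin_coef b hU ξ u

end CrossedCatOverVect

/-! ### Antipode, unit and Hopf axioms of the coends -/

namespace CrossedCatOverVect

open FiberFunctor Coaction EndCheck

variable {G : Type uG} [Group G] {k : Type w} [Field k]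
  {C : Type u} [Category.{v} C] [MonoidalCategory C]
  (X : CrossedCatOverVect G k C) {a b c : G}

/-- The bilinear map `(ξ, u) ↦ [u ⊗ ξ]`, for an identification of `F(Y)` with the dual of `F(U)`
given by an exact pairing of `Y` with `U`. -/
noncomputable def antiLeft (Y U : C) [ExactPairing Y U] (hU : X.deg U = a) :
    Module.Dual k (X.F.obj U) →ₗ[k] X.F.obj U →ₗ[k] EndCheck (X.fiber a⁻¹) :=
  (X.coef Y (X.deg_left_of_exactPairing Y U hU)).flip.compl₁₂
    (leftDualEquiv X.F Y U).symm.toLinearMap (ev X.F Y U)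

theorem antiLeft_apply (Y U : C) [ExactPairing Y U] (hU : X.deg U = a)
    (ξ : Module.Dual k (X.F.obj U)) (u : X.F.obj U) : X.antiLeft Y U hU ξ u =
      X.coef Y (X.deg_left_of_exactPairing Y U hU) (ev X.F Y U u)
        ((leftDualEquiv X.F Y U).symm ξ) := rfl

/-- The mate of `f` matches the two coefficients. For f = 𝟙 it also shows that the result does not
depend on the choice of dual. -/
theorem antiLeft_map {Y Y' U V : C} [ExactPairing Y U] [ExactPairing Y' V] (hU : X.deg U = a)
    (hV : X.deg V = a) (f : U ⟶ V) (ξ : Module.Dual k (X.F.obj V)) (u : X.F.obj U) :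
    X.antiLeft Y' V hV ξ ((X.F.map f).hom.hom u) =
      X.antiLeft Y U hU (ξ ∘ₗ (X.F.map f).hom.hom) u := by
  obtain ⟨g, hg⟩ := exists_left_mate X.F Y Y' f
  rw [antiLeft_apply, antiLeft_apply]
  refine X.coef_eq_of_hom g _ _ (fun z => hg u z) ?_
  rw [LinearEquiv.eq_symm_apply]
  refine LinearMap.ext fun x => ?_
  rw [leftDualEquiv_apply, hg, ev_leftDualEquiv_symm]
  rfl

/-- The bilinear map `(ξ, u) ↦ [u ⊗ ξ]`, for an identification of `F(Z)` with the dual of `F(U)`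
given by an exact pairing of `U` with `Z`. -/
noncomputable def antiRight (U Z : C) [ExactPairing U Z] (hU : X.deg U = a) :
    Module.Dual k (X.F.obj U) →ₗ[k] X.F.obj U →ₗ[k] EndCheck (X.fiber a⁻¹) :=
  (X.coef Z (X.deg_right_of_exactPairing U Z hU)).flip.compl₁₂
    (rightDualEquiv X.F U Z).symm.toLinearMap (ev X.F U Z).flip

theorem antiRight_apply (U Z : C) [ExactPairing U Z] (hU : X.deg U = a)
    (ξ : Module.Dual k (X.F.obj U)) (u : X.F.obj U) : X.antiRight U Z hU ξ u =
      X.coef Z (X.deg_right_of_exactPairing U Z hU) ((ev X.F U Z).flip u)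
        ((rightDualEquiv X.F U Z).symm ξ) := rfl

theorem antiRight_map {Z Z' U V : C} [ExactPairing U Z] [ExactPairing V Z'] (hU : X.deg U = a)
    (hV : X.deg V = a) (f : U ⟶ V) (ξ : Module.Dual k (X.F.obj V)) (u : X.F.obj U) :
    X.antiRight V Z' hV ξ ((X.F.map f).hom.hom u) =
      X.antiRight U Z hU (ξ ∘ₗ (X.F.map f).hom.hom) u := by
  obtain ⟨g, hg⟩ := exists_right_mate X.F Z Z' f
  rw [antiRight_apply, antiRight_apply]
  refine X.coef_eq_of_hom g _ _ (fun z => hg u z) ?_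
  rw [LinearEquiv.eq_symm_apply]
  refine LinearMap.ext fun x => ?_
  rw [rightDualEquiv_apply, hg, ev_rightDualEquiv_symm]
  rfl

section antipode

variable {X} (A : X.toCrossedCat.Autonomous)

/-- The antipode of the coends. -/
noncomputable def antipodeLin (a : G) : EndCheck (X.fiber a) →ₗ[k] EndCheck (X.fiber a⁻¹) :=
  X.liftCoef (fun U hU => letI := A.rightPairing U; X.antiLeft (A.rightDual U) U hU)
    (fun U V hU hV f ξ u => letI := A.rightPairing U; letI := A.rightPairing V
      X.antiLeft_map hU hV f ξ u)

/-- The antipode is defined with the chosen right dual but may be computed with any exact pairing.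
The inverse and the Hopf axioms rest on this. -/
theorem antipodeLin_coef (Y U : C) [ExactPairing Y U] (hU : X.deg U = a)
    (ξ : Module.Dual k (X.F.obj U)) (u : X.F.obj U) : antipodeLin A a (X.coef U hU ξ u) =
      X.coef Y (X.deg_left_of_exactPairing Y U hU) (ev X.F Y U u)
        ((leftDualEquiv X.F Y U).symm ξ) := by
  let _ := A.rightPairing U
  refine (liftCoef_coef X _ _ U hU ξ u).trans ?_
  have h := X.antiLeft_map (Y := Y) (Y' := A.rightDual U) hU hU (𝟙 U) ξ u
  rw [EndCheck.map_id_apply] at h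
  refine h.trans ?_
  rw [antiLeft_apply]
  congr 2
  exact LinearMap.ext fun x => congrArg ξ (EndCheck.map_id_apply X.F U x)

/-- The inverse of the antipode of the coends. -/
noncomputable def antipodeInvLin (a : G) : EndCheck (X.fiber a) →ₗ[k] EndCheck (X.fiber a⁻¹) :=
  X.liftCoef (fun U hU => letI := A.leftPairing U; X.antiRight U (A.leftDual U) hU)
    (fun U V hU hV f ξ u => letI := A.leftPairing U; letI := A.leftPairing V
      X.antiRight_map hU hV f ξ u)

theorem antipodeInvLin_coef (U Z : C) [ExactPairing U Z] (hU : X.deg U = a)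
    (ξ : Module.Dual k (X.F.obj U)) (u : X.F.obj U) : antipodeInvLin A a (X.coef U hU ξ u) =
      X.coef Z (X.deg_right_of_exactPairing U Z hU) ((ev X.F U Z).flip u)
        ((rightDualEquiv X.F U Z).symm ξ) := by
  let _ := A.leftPairing U
  refine (liftCoef_coef X _ _ U hU ξ u).trans ?_
  have h := X.antiRight_map (Z := Z) (Z' := A.leftDual U) hU hU (𝟙 U) ξ u
  rw [EndCheck.map_id_apply] at h
  refine h.trans ?_
  rw [antiRight_apply]
  congr 2
  exact LinearMap.ext fun x => congrArg ξ (EndCheck.map_id_apply X.F U x)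

/-- The antipode of the coends, as an isomorphism. -/
noncomputable def antipodeEquiv (a : G) : EndCheck (X.fiber a) ≃ₗ[k] EndCheck (X.fiber a⁻¹) :=
  LinearEquiv.ofLinearMap (antipodeLin A a) ((X.castE (inv_inv a)).toLinearMap ∘ₗ antipodeInvLin A a⁻¹)
    (coef_ext fun U hU ξ u => by
      -- The single pairing of `U` with its left dual computes both maps: it exhibits `U` as a right
      -- dual of `A.leftDual U`, so transposing twice gives back the coefficient.
      let _ := A.leftPairing U
      rw [LinearMap.comp_apply, LinearMap.comp_apply, antipodeInvLin_coef A U (A.leftDual U),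
        LinearEquiv.coe_coe, coef_cast, antipodeLin_coef A U (A.leftDual U),
        ev_rightDualEquiv_symm]
      exact congrArg (X.coef U hU ξ) ((leftDualEquiv X.F U (A.leftDual U)).symm_apply_apply u))
    (coef_ext fun U hU ξ u => by
      let _ := A.rightPairing U
      rw [LinearMap.comp_apply, LinearMap.comp_apply, antipodeLin_coef A (A.rightDual U) U,
        antipodeInvLin_coef A (A.rightDual U) U, LinearEquiv.coe_coe, coef_cast]
      have h1 : (ev X.F (A.rightDual U) U).flip ((leftDualEquiv X.F (A.rightDual U) U).symm ξ) = ξ :=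
        (leftDualEquiv X.F (A.rightDual U) U).apply_symm_apply ξ
      rw [h1]
      exact congrArg (X.coef U hU ξ) ((rightDualEquiv X.F (A.rightDual U) U).symm_apply_apply u))

theorem antipodeEquiv_coef (Y U : C) [ExactPairing Y U] (hU : X.deg U = a)
    (ξ : Module.Dual k (X.F.obj U)) (u : X.F.obj U) : antipodeEquiv A a (X.coef U hU ξ u) =
      X.coef Y (X.deg_left_of_exactPairing Y U hU) (ev X.F Y U u)
        ((leftDualEquiv X.F Y U).symm ξ) :=
  antipodeLin_coef A Y U hU ξ u

end antipode

/-- The unit of the coends. -/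
noncomputable def oneE : EndCheck (X.fiber 1) :=
  X.coef (𝟙_ C) X.deg_unit (unitFun X.F) (unitVec X.F)

theorem coef_unit (h : X.deg (𝟙_ C) = 1) (ζ : Module.Dual k (X.F.obj (𝟙_ C))) :
    X.coef (𝟙_ C) h ζ (unitVec X.F) = ζ (unitVec X.F) • X.oneE := by
  have hζ : ζ = ζ (unitVec X.F) • unitFun X.F := LinearMap.ext fun z => by
    conv_lhs => rw [← unitFun_smul_unitVec X.F z, map_smul]
    exact mul_comm _ _
  conv_lhs => rw [hζ, map_smul, LinearMap.smul_apply]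
  rfl

/-- The coefficient moves along `f` to the unit object, where F(𝟙) is a line and all coefficients
are multiples of 1. -/
theorem coef_map_unitVec {W : C} (hW : X.deg W = 1) (f : 𝟙_ C ⟶ W)
    (ζ : Module.Dual k (X.F.obj W)) : X.coef W hW ζ ((X.F.map f).hom.hom (unitVec X.F)) =
      ζ ((X.F.map f).hom.hom (unitVec X.F)) • X.oneE := by
  rw [X.coef_map f X.deg_unit hW, coef_unit]
  rfl

variable {X}

/-- The convolution sum is a coefficient of Y ⊗ U whose vector is the coevaluation tensor. It
therefore comes from the unit object, and the scalar is ξ(u) by a zigzag identity. -/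
theorem IsTannakian.antipode_mul (hX : X.IsTannakian) (A : X.toCrossedCat.Autonomous) (a : G)
    (x : EndCheck (X.fiber a)) :
    X.castE (inv_mul_cancel a) (hX.mulHom a⁻¹ a
      ((antipodeEquiv A a).toLinearMap.rTensor (EndCheck (X.fiber a)) (comul (R := k) x))) =
      counit (R := k) x • X.oneE := by
  obtain ⟨U, hU, ξ, u, rfl⟩ := hX.exists_coef x
  let _ := A.rightPairing U
  let Y := A.rightDual U
  have hY := X.deg_left_of_exactPairing Y U hU
  let e := Module.finBasis k (X.F.obj U)
  have h1 : hX.mulHom a⁻¹ a ((antipodeEquiv A a).toLinearMap.rTensor (EndCheck (X.fiber a))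
      (comul (R := k) (X.coef U hU ξ u))) = X.coef (Y ⊗ U) (X.deg_tensor_eq hY hU)
        (tensorFun X.F (ev X.F Y U u) ξ) (mu X.F Y U (coev X.F Y U)) := by
    refine (congrArg (fun t => hX.mulHom a⁻¹ a ((antipodeEquiv A a).toLinearMap.rTensor _ t))
      (X.comul_coef hU e ξ u)).trans ?_
    refine (congrArg (hX.mulHom a⁻¹ a) (map_sum _ _ _)).trans ((map_sum _ _ _).trans ?_)
    conv_rhs => rw [← sum_slice e (coev X.F Y U), map_sum, map_sum]
    refine Finset.sum_congr rfl fun i _ => ?_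
    rw [LinearMap.rTensor_tmul, LinearEquiv.coe_coe, antipodeEquiv_coef A Y U, mulHom_coef]
    rfl
  rw [h1, coef_cast, ← map_coevaluation, coef_map_unitVec, map_coevaluation, tensorFun_mu,
    ← apply_lid_rTensor, lid_rTensor_coev, counit_coef]

/-- Here it is the functional that assembles: the sum is a coefficient of U ⊗ Y against the
evaluation, and moving the vector along the evaluation reaches the unit object. -/
theorem IsTannakian.mul_antipode (hX : X.IsTannakian) (A : X.toCrossedCat.Autonomous) (a : G)
    (x : EndCheck (X.fiber a)) :
    X.castE (mul_inv_cancel a) (hX.mulHom a a⁻¹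
      ((antipodeEquiv A a).toLinearMap.lTensor (EndCheck (X.fiber a)) (comul (R := k) x))) =
      counit (R := k) x • X.oneE := by
  obtain ⟨U, hU, ξ, u, rfl⟩ := hX.exists_coef x
  let _ := A.rightPairing U
  let Y := A.rightDual U
  have hY := X.deg_left_of_exactPairing Y U hU
  let e := Module.finBasis k (X.F.obj U)
  have h1 : hX.mulHom a a⁻¹ ((antipodeEquiv A a).toLinearMap.lTensor (EndCheck (X.fiber a))
      (comul (R := k) (X.coef U hU ξ u))) = X.coef (U ⊗ Y) (X.deg_tensor_eq hU hY)
        (unitFun X.F ∘ₗ (X.F.map (ε_ Y U)).hom.hom)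
        (mu X.F U Y (u ⊗ₜ (leftDualEquiv X.F Y U).symm ξ)) := by
    refine (congrArg (fun t => hX.mulHom a a⁻¹ ((antipodeEquiv A a).toLinearMap.lTensor _ t))
      (X.comul_coef hU e ξ u)).trans ?_
    refine (congrArg (hX.mulHom a a⁻¹) (map_sum _ _ _)).trans ((map_sum _ _ _).trans ?_)
    have h2 : unitFun X.F ∘ₗ (X.F.map (ε_ Y U)).hom.hom =
        ∑ i, tensorFun X.F (e.coord i) (ev X.F Y U (e i)) := by
      refine hom_ext_mu X.F fun x y => ?_
      rw [LinearMap.comp_apply, unitFun_map_evaluation, LinearMap.sum_apply]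
      conv_lhs => rw [← e.sum_repr x, map_sum, LinearMap.sum_apply]
      refine Finset.sum_congr rfl fun i _ => ?_
      rw [tensorFun_mu_tmul, map_smul]
      rfl
    rw [h2, map_sum, LinearMap.sum_apply]
    refine Finset.sum_congr rfl fun i _ => ?_
    rw [LinearMap.lTensor_tmul, LinearEquiv.coe_coe, antipodeEquiv_coef A Y U, mulHom_coef]
  rw [h1, coef_cast, ← X.coef_map (ε_ Y U) _ X.deg_unit, map_evaluation, map_smul, counit_coef,
    ev_leftDualEquiv_symm]
  rfl

theorem IsTannakian.mul_assoc (hX : X.IsTannakian) (a b c : G) (x : EndCheck (X.fiber a))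
    (y : EndCheck (X.fiber b)) (z : EndCheck (X.fiber c)) :
    X.castE (_root_.mul_assoc a b c) (hX.mulHom (a * b) c (hX.mulHom a b (x ⊗ₜ y) ⊗ₜ z)) =
      hX.mulHom a (b * c) (x ⊗ₜ hX.mulHom b c (y ⊗ₜ z)) := by
  obtain ⟨U, hU, ξ, u, rfl⟩ := hX.exists_coef x
  obtain ⟨V, hV, η, v, rfl⟩ := hX.exists_coef y
  obtain ⟨W, hW, ζ, w, rfl⟩ := hX.exists_coef z
  rw [mulHom_coef, mulHom_coef, mulHom_coef, mulHom_coef, coef_cast]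
  refine X.coef_eq_of_hom (α_ U V W).hom _ _ (fun z => ?_) (map_associator X.F U V W u v w)
  refine LinearMap.congr_fun (f := tensorFun X.F ξ (tensorFun X.F η ζ) ∘ₗ
    (X.F.map (α_ U V W).hom).hom.hom) (hom_ext_mu X.F fun x z => ?_) z
  obtain ⟨t, rfl⟩ := (mu X.F U V).surjective x
  induction t with
  | zero => simp
  | add s t hs ht => simp only [map_add, TensorProduct.add_tmul, hs, ht]
  | tmul x y =>
    rw [LinearMap.comp_apply, map_associator, tensorFun_mu_tmul, tensorFun_mu_tmul,
      tensorFun_mu_tmul, tensorFun_mu_tmul, _root_.mul_assoc]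

theorem IsTannakian.one_mul (hX : X.IsTannakian) (a : G) (x : EndCheck (X.fiber a)) :
    X.castE (_root_.one_mul a) (hX.mulHom 1 a (X.oneE ⊗ₜ x)) = x := by
  obtain ⟨U, hU, ξ, u, rfl⟩ := hX.exists_coef x
  rw [oneE, mulHom_coef, coef_cast]
  refine X.coef_eq_of_hom (λ_ U).hom _ _ (fun z => ?_) (map_leftUnitor X.F U u)
  refine LinearMap.congr_fun (f := ξ ∘ₗ (X.F.map (λ_ U).hom).hom.hom)
    (hom_ext_mu X.F fun x z => ?_) z
  rw [← unitFun_smul_unitVec X.F x, ← TensorProduct.smul_tmul', map_smul, map_smul, map_smul,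
    LinearMap.comp_apply, map_leftUnitor, tensorFun_mu_tmul, unitFun_unitVec, _root_.one_mul]

theorem IsTannakian.mul_one (hX : X.IsTannakian) (a : G) (x : EndCheck (X.fiber a)) :
    X.castE (_root_.mul_one a) (hX.mulHom a 1 (x ⊗ₜ X.oneE)) = x := by
  obtain ⟨U, hU, ξ, u, rfl⟩ := hX.exists_coef x
  rw [oneE, mulHom_coef, coef_cast]
  refine X.coef_eq_of_hom (ρ_ U).hom _ _ (fun z => ?_) (map_rightUnitor X.F U u)
  refine LinearMap.congr_fun (f := ξ ∘ₗ (X.F.map (ρ_ U).hom).hom.hom)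
    (hom_ext_mu X.F fun x z => ?_) z
  rw [← unitFun_smul_unitVec X.F z, TensorProduct.tmul_smul, map_smul, map_smul, map_smul,
    LinearMap.comp_apply, map_rightUnitor, tensorFun_mu_tmul, unitFun_unitVec, _root_.mul_one]

theorem IsTannakian.conj_mul (hX : X.IsTannakian) (c a b : G) (x : EndCheck (X.fiber a))
    (y : EndCheck (X.fiber b)) :
    X.castE (show c * (a * b) * c⁻¹ = (c * a * c⁻¹) * (c * b * c⁻¹) by group)
      (hX.conjEquiv c (a * b) (hX.mulHom a b (x ⊗ₜ y))) =
      hX.mulHom _ _ (hX.conjEquiv c a x ⊗ₜ hX.conjEquiv c b y) := by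
  obtain ⟨U, hU, ξ, u, rfl⟩ := hX.exists_coef x
  obtain ⟨V, hV, η, v, rfl⟩ := hX.exists_coef y
  rw [mulHom_coef, conjEquiv_coef, conjEquiv_coef, conjEquiv_coef, mulHom_coef, coef_cast]
  have h : ∀ x y, X.phiE c (U ⊗ V) (mu X.F U V (x ⊗ₜ y)) =
      (X.F.map (eqToHom (X.conj_tensor c U V).symm)).hom.hom
        (mu X.F _ _ (X.phiE c U x ⊗ₜ X.phiE c V y)) := fun x y => X.phiE_tensor c U V (x ⊗ₜ y)
  refine (X.coef_eq_of_hom (eqToHom (X.conj_tensor c U V).symm) _ _ (fun z => ?_) (h u v).symm).symm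
  refine LinearMap.congr_fun (f := (tensorFun X.F ξ η ∘ₗ (X.phiE c (U ⊗ V)).symm.toLinearMap) ∘ₗ
    (X.F.map (eqToHom (X.conj_tensor c U V).symm)).hom.hom) (hom_ext_mu X.F fun x y => ?_) z
  obtain ⟨x, rfl⟩ := (X.phiE c U).surjective x
  obtain ⟨y, rfl⟩ := (X.phiE c V).surjective y
  rw [LinearMap.comp_apply, ← h, tensorFun_mu_tmul, LinearMap.comp_apply, LinearMap.comp_apply,
    LinearMap.comp_apply, LinearEquiv.coe_coe, LinearEquiv.coe_coe, LinearEquiv.coe_coe,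
    LinearEquiv.symm_apply_apply, LinearEquiv.symm_apply_apply, LinearEquiv.symm_apply_apply,
    tensorFun_mu_tmul]

theorem IsTannakian.conj_one (hX : X.IsTannakian) (c : G) :
    X.castE (show c * 1 * c⁻¹ = 1 by group) (hX.conjEquiv c 1 X.oneE) = X.oneE := by
  rw [oneE, conjEquiv_coef, coef_cast, phiE_unit, coef_map_unitVec, ← phiE_unit]
  simp [oneE]

/-- The crossed Hopf algebra of a Tannakian crossed category. -/
noncomputable def IsTannakian.hopf (hX : X.IsTannakian) :
    CrossedHopfAlgebra.{uG, w, max u w} G k where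
  comp a := EndCheck (X.fiber a)
  mul := hX.mulHom
  mul_assoc := hX.mul_assoc
  one := X.oneE
  counit_one := by rw [oneE, counit_coef, unitFun_unitVec]
  comul_one := by
    -- F(𝟙) has a basis with one element, the image of 1, so the comultiplication of 1 has one term.
    let e : Module.Basis Unit k (X.F.obj (𝟙_ C)) :=
      (Module.Basis.singleton Unit k).map (unitEquiv X.F)
    refine (X.comul_coef X.deg_unit e _ _).trans ?_
    rw [Fintype.sum_unique]
    have h1 : e default = unitVec X.F := by simp [e, unitVec]
    have h2 : e.coord default = unitFun X.F := LinearMap.ext fun z => by simp [e, unitFun]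
    rw [h1, h2]
    rfl
  one_mul := hX.one_mul
  mul_one := hX.mul_one
  conj := hX.conjEquiv
  conj_mul := hX.conj_mul
  conj_one := hX.conj_one
  conj_conj := X.conjLin_conjLin
  -- Any choice of duals gives the same map, by `antipodeLin_coef`.
  antipode := antipodeEquiv hX.autonomous.some
  antipode_mul := hX.antipode_mul _
  mul_antipode := hX.mul_antipode _

end CrossedCatOverVect

/-! ### Matrix coefficients of comodules -/

namespace CrossedHopfAlgebra

open Coaction

variable {G : Type uG} [Group G] {k : Type w} [Field k]

namespace Comod

variable {H : CrossedHopfAlgebra.{uG, w, t} G k}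

/-- The matrix coefficients of a comodule. -/
noncomputable def coeff (M : Comod H) : Module.Dual k M.V →ₗ[k] M.V →ₗ[k] H.comp M.deg :=
  (sliceₗ (H.comp M.deg)).compl₂ M.coact

theorem coeff_apply (M : Comod H) (ζ : Module.Dual k M.V) (m : M.V) :
    M.coeff ζ m = slice (H.comp M.deg) ζ (M.coact m) := rfl

theorem coeff_hom {M N : Comod H} (f : M ⟶ N) (ζ : Module.Dual k N.V) (m : M.V) :
    N.coeff ζ (f.f.hom.hom m) = H.cast f.deg_eq (M.coeff (ζ ∘ₗ f.f.hom.hom) m) := by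
  rw [coeff_apply, f.comm, slice_map]
  rfl

/-- A linear map compatible with the matrix coefficients is an arrow of comodules. -/
def homOfCoeff {M N : Comod H} (h : M.deg = N.deg) (f : M.V ⟶ N.V)
    (hf : ∀ ζ m, N.coeff ζ (f.hom.hom m) = H.cast h (M.coeff (ζ ∘ₗ f.hom.hom) m)) : M ⟶ N :=
  Hom.mk h f fun m => slice_ext fun ζ => by
    rw [slice_map]
    exact hf ζ m

/-- A linear isomorphism compatible with the matrix coefficients is an isomorphism of comodules. -/
def isoOfCoeff {M N : Comod H} (h : M.deg = N.deg) (e : M.V ≅ N.V)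
    (hf : ∀ ζ m, N.coeff ζ (e.hom.hom.hom m) = H.cast h (M.coeff (ζ ∘ₗ e.hom.hom.hom) m)) :
    M ≅ N :=
  isoMk h e fun m => slice_ext fun ζ => by
    rw [slice_map]
    exact hf ζ m

theorem comul_coeff (M : Comod H) {ι : Type*} [Fintype ι] (e : Module.Basis ι k M.V)
    (ζ : Module.Dual k M.V) (m : M.V) :
    comul (R := k) (M.coeff ζ m) = ∑ i, M.coeff (e.coord i) m ⊗ₜ[k] M.coeff ζ (e i) :=
  comul_slice_basis M.coassoc e ζ m

theorem counit_coeff (M : Comod H) (ζ : Module.Dual k M.V) (m : M.V) :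
    counit (R := k) (M.coeff ζ m) = ζ m :=
  counit_slice M.counit_coact ζ m

theorem coeff_tensor (M N : Comod H) (ζ : Module.Dual k M.V) (η : Module.Dual k N.V) (m : M.V)
    (n : N.V) : (M ⊗ N).coeff (TensorProduct.dualDistrib k M.V N.V (ζ ⊗ₜ η)) (m ⊗ₜ[k] n) =
      H.mul M.deg N.deg (M.coeff ζ m ⊗ₜ N.coeff η n) :=
  slice_tensor (H.mul M.deg N.deg).toLinearMap M.coact N.coact ζ η m n

theorem coeff_unit (ζ : Module.Dual k k) (r : k) :
    (𝟙_ (Comod H)).coeff ζ r = ζ r • H.one :=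
  slice_tmul ζ H.one r

theorem coeff_conj (b : G) (M : Comod H) (ζ : Module.Dual k M.V) (m : M.V) :
    ((conj H b).obj M).coeff ζ m = H.conj b M.deg (M.coeff ζ m) :=
  slice_rTensor (H.conj b M.deg).toCoalgHom.toLinearMap ζ (M.coact m)

theorem slice_ext_equiv_tensor {A V W Z : Type*} [AddCommGroup A] [Module k A] [AddCommGroup V]
    [Module k V] [AddCommGroup W] [Module k W] [AddCommGroup Z] [Module k Z] (e : V ⊗[k] W ≃ₗ[k] Z)
    {s t : A ⊗[k] Z}
    (h : ∀ ξ η, slice A (TensorProduct.dualDistrib k V W (ξ ⊗ₜ η) ∘ₗ e.symm.toLinearMap) s =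
      slice A (TensorProduct.dualDistrib k V W (ξ ⊗ₜ η) ∘ₗ e.symm.toLinearMap) t) : s = t :=
  (e.symm.lTensor A).injective (slice_ext_tensor fun ξ η =>
    (slice_lTensor e.symm.toLinearMap _ s).trans
      ((h ξ η).trans (slice_lTensor e.symm.toLinearMap _ t).symm))

/-- Product functionals separate the coactions, so compatibility needs checking only on coefficients
against ξ ⊗ η at pure tensors, where multiplication in `H` appears. -/
theorem comm_of_coeff_tensor {M N P : Comod H} (h : M.deg * N.deg = P.deg)
    (e : M.V ⊗[k] N.V ≃ₗ[k] P.V)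
    (he : ∀ ξ η x y,
      P.coeff (TensorProduct.dualDistrib k M.V N.V (ξ ⊗ₜ η) ∘ₗ e.symm.toLinearMap) (e (x ⊗ₜ y)) =
        H.cast h (H.mul M.deg N.deg (M.coeff ξ x ⊗ₜ N.coeff η y))) (m : M.V ⊗[k] N.V) :
    P.coact (e m) =
      TensorProduct.map (H.cast h).toLinearMap e.toLinearMap (tensorCoact M N m) := by
  refine LinearMap.congr_fun (f := P.coact ∘ₗ e.toLinearMap)
    (g := TensorProduct.map (H.cast h).toLinearMap e.toLinearMap ∘ₗ tensorCoact M N)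
    (TensorProduct.ext' fun x y => slice_ext_equiv_tensor e fun ξ η => ?_) m
  refine (he ξ η x y).trans ?_
  rw [LinearMap.comp_apply, slice_map, ← coeff_tensor, LinearMap.comp_assoc]
  have h' : e.symm.toLinearMap ∘ₗ e.toLinearMap = LinearMap.id :=
    LinearMap.ext fun z => e.symm_apply_apply z
  rw [h', LinearMap.comp_id]
  rfl

/-- The comodule with given matrix coefficients. -/
noncomputable def mkOfCoeff (d : G) (V : FGModuleCat.{w} k)
    (c : Module.Dual k V →ₗ[k] V →ₗ[k] H.comp d)
    (hc : ∀ ζ v, comul (R := k) (c ζ v) = ∑ i, c ((Module.finBasis k V).coord i) v ⊗ₜ[k]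
      c ζ (Module.finBasis k V i))
    (hc' : ∀ ζ v, counit (R := k) (c ζ v) = ζ v) : Comod H where
  deg := d
  V := V
  coact := ofCoeff (Module.finBasis k V) c
  coassoc := isCoassoc_ofCoeff _ c hc
  counit_coact := isCounital_ofCoeff _ c hc'

@[simp] theorem coeff_mkOfCoeff (d : G) (V : FGModuleCat.{w} k)
    (c : Module.Dual k V →ₗ[k] V →ₗ[k] H.comp d)
    (hc : ∀ ζ v, comul (R := k) (c ζ v) = ∑ i, c ((Module.finBasis k V).coord i) v ⊗ₜ[k]
      c ζ (Module.finBasis k V i))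
    (hc' : ∀ ζ v, counit (R := k) (c ζ v) = ζ v) (ζ : Module.Dual k V) (v : V) :
    (mkOfCoeff d V c hc hc').coeff ζ v = c ζ v :=
  slice_ofCoeff _ c ζ v

end Comod

end CrossedHopfAlgebra

/-! ### The equivalence with the category of comodules -/

namespace CrossedCatOverVect

open FiberFunctor Coaction EndCheck CrossedHopfAlgebra

variable {G : Type uG} [Group G] {k : Type w} [Field k]
  {C : Type u} [Category.{v} C] [MonoidalCategory C]
  (X : CrossedCatOverVect G k C)

theorem coef_unitEquiv (h : X.deg (𝟙_ C) = 1) (ζ : Module.Dual k (X.F.obj (𝟙_ C))) (r : k) :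
    X.coef (𝟙_ C) h ζ (unitEquiv X.F r) = ζ (unitEquiv X.F r) • X.oneE := by
  have h' : unitEquiv X.F r = r • unitVec X.F := by
    rw [unitVec, ← map_smul, smul_eq_mul, _root_.mul_one]
  rw [h', map_smul, map_smul, coef_unit, smul_assoc]

variable {X} (hX : X.IsTannakian)

namespace IsTannakian

/-- The comodule `F(U)`. -/
noncomputable def comod (U : C) : Comod hX.hopf :=
  Comod.mkOfCoeff (H := hX.hopf) (X.deg U) (X.F.obj U) (X.coef U rfl)
    (fun ξ v => X.comul_coef rfl _ ξ v) (fun ξ v => X.counit_coef rfl ξ v)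

theorem coeff_comod (U : C) (ξ : Module.Dual k (X.F.obj U)) (v : X.F.obj U) :
    (hX.comod U).coeff ξ v = X.coef U rfl ξ v :=
  Comod.coeff_mkOfCoeff (H := hX.hopf) (X.deg U) (X.F.obj U) (X.coef U rfl) _ _ ξ v

theorem cast_coef {a b : G} {U : C} (hU : X.deg U = a) (h : a = b) (ξ : Module.Dual k (X.F.obj U))
    (v : X.F.obj U) : hX.hopf.cast h (X.coef U hU ξ v) = X.coef U (hU.trans h) ξ v :=
  X.coef_cast hU h ξ v

/-- The functor `U ↦ F(U)` to the category of comodules. -/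
noncomputable def toCom : C ⥤ Comod hX.hopf where
  obj U := hX.comod U
  map {U V} f := Comod.homOfCoeff (M := hX.comod U) (N := hX.comod V) (X.deg_eq_of_hom f)
    (X.F.map f) fun ζ m => by
      have h : X.coef V rfl ζ ((X.F.map f).hom.hom m) = _ :=
        X.coef_map f (X.deg_eq_of_hom f) rfl ζ m
      exact (coeff_comod hX V _ _).trans (h.trans ((cast_coef hX rfl _ _ _).symm.trans
        (congrArg _ (coeff_comod hX U _ _).symm)))
  map_id U := Comod.hom_ext (X.F.map_id U)
  map_comp f g := Comod.hom_ext (X.F.map_comp f g)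

/-- The isomorphism `F(U) ⊗ F(V) ≅ F(U ⊗ V)` of comodules. -/
noncomputable def toComTensor (U V : C) :
    hX.toCom.obj U ⊗ hX.toCom.obj V ≅ hX.toCom.obj (U ⊗ V) :=
  Comod.isoMk (X.deg_tensor U V).symm (Functor.Monoidal.μIso X.F U V)
    (Comod.comm_of_coeff_tensor (M := hX.comod U) (N := hX.comod V) (P := hX.comod (U ⊗ V))
      (X.deg_tensor U V).symm (mu X.F U V) fun ξ η x y => by
        refine (coeff_comod hX (U ⊗ V) _ _).trans ?_
        refine (cast_coef hX (X.deg_tensor U V) (X.deg_tensor U V).symm _ _).symm.trans ?_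
        refine congrArg _ ((hX.mulHom_coef rfl rfl ξ x η y).symm.trans ?_)
        exact (congrArg₂ (fun s t => hX.hopf.mul _ _ (s ⊗ₜ[k] t)) (coeff_comod hX U ξ x)
          (coeff_comod hX V η y)).symm)

/-- The isomorphism `k ≅ F(𝟙)` of comodules. -/
noncomputable def toComUnit : 𝟙_ (Comod hX.hopf) ≅ hX.toCom.obj (𝟙_ C) :=
  Comod.isoOfCoeff X.deg_unit.symm (Functor.Monoidal.εIso X.F) fun ζ r => by
    refine (coeff_comod hX (𝟙_ C) _ _).trans ?_
    refine (cast_coef hX X.deg_unit X.deg_unit.symm _ _).symm.trans (congrArg _ ?_)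
    refine Eq.trans ?_ (Comod.coeff_unit (H := hX.hopf) _ r).symm
    exact X.coef_unitEquiv X.deg_unit ζ r

noncomputable instance : hX.toCom.Monoidal :=
  Functor.CoreMonoidal.toMonoidal
    { εIso := hX.toComUnit
      μIso := hX.toComTensor
      μIso_hom_natural_left := fun f U => Comod.hom_ext (by
        refine Eq.trans ?_ (Functor.LaxMonoidal.μ_natural_left X.F f U)
        exact congrArg (· ≫ _) (MonoidalCategory.tensorHom_id _ _))
      μIso_hom_natural_right := fun U f => Comod.hom_ext (by
        refine Eq.trans ?_ (Functor.LaxMonoidal.μ_natural_right X.F U f)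
        exact congrArg (· ≫ _) (MonoidalCategory.id_tensorHom _ _))
      associativity := fun U V W => Comod.hom_ext (by
        refine Eq.trans ?_ ((Functor.LaxMonoidal.associativity X.F U V W).trans ?_)
        · exact congrArg (· ≫ _) (MonoidalCategory.tensorHom_id _ _)
        · exact congrArg (fun z => _ ≫ z ≫ _) (MonoidalCategory.id_tensorHom _ _).symm)
      left_unitality := fun U => Comod.hom_ext (by
        refine (Functor.LaxMonoidal.left_unitality X.F U).trans ?_
        exact congrArg (· ≫ _) (MonoidalCategory.tensorHom_id _ _).symm)
      right_unitality := fun U => Comod.hom_ext (by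
        refine (Functor.LaxMonoidal.right_unitality X.F U).trans ?_
        exact congrArg (· ≫ _) (MonoidalCategory.id_tensorHom _ _).symm) }

instance : hX.toCom.Faithful where
  map_injective h := hX.faithful.map_injective (congrArg Comod.Hom.f h)

instance : hX.toCom.Full where
  map_surjective {U V} f := by
    obtain ⟨A, hA⟩ := hX.abelian_exact
    let _ := A.abelian (X.deg V)
    let _ := A.linear (X.deg V)
    obtain ⟨_, _, _, _⟩ := hA (X.deg V)
    have : X.F.Faithful := hX.faithful
    let U' : X.toCrossedCat.Component (X.deg V) := ⟨U, f.deg_eq⟩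
    let V' : X.toCrossedCat.Component (X.deg V) := ⟨V, rfl⟩
    -- A comodule map forces its source and target to have equal degree, so the reconstruction
    -- theorem for one component applies.
    obtain ⟨g, hg⟩ := exists_hom_of_forall_rk (X.fiber (X.deg V)) (A := U') (B := V')
      f.f.hom.hom fun ζ x => by
        refine (coeff_comod hX V ζ _).symm.trans ((Comod.coeff_hom f ζ x).trans ?_)
        refine (congrArg _ (coeff_comod hX U _ _)).trans ?_
        exact cast_coef hX rfl f.deg_eq _ _
    exact ⟨g.hom, Comod.hom_ext (FGModuleCat.hom_ext hg)⟩

instance : hX.toCom.EssSurj where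
  mem_essImage M := by
    obtain ⟨A, hA⟩ := hX.abelian_exact
    let _ := A.abelian M.deg
    let _ := A.linear M.deg
    obtain ⟨_, _, _, _⟩ := hA M.deg
    have : X.F.Faithful := hX.faithful
    -- A comodule over `hX.hopf` of degree α is by definition a comodule over the coend of F_α.
    obtain ⟨Q, e, he⟩ := exists_obj_equiv (X.fiber M.deg) (V := M.V) (r := M.coact) M.coassoc
      M.counit_coact
    refine ⟨Q.obj, ⟨Comod.isoOfCoeff (M := hX.comod Q.obj) (N := M) Q.property
      (e.toFGModuleCatIso) fun ζ m => ?_⟩⟩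
    refine (he ζ m).trans ((cast_coef hX rfl Q.property _ _).symm.trans (congrArg _ ?_))
    exact (coeff_comod hX Q.obj _ _).symm

instance : hX.toCom.IsEquivalence where

/-- The isomorphism between `F(Φ_β(U))` and `F(U)`, with the conjugate coaction. -/
noncomputable def toComConj (b : G) (U : C) :
    hX.toCom.obj ((X.conj b).obj U) ≅ (Comod.conj hX.hopf b).obj (hX.toCom.obj U) :=
  Comod.isoOfCoeff (M := hX.comod ((X.conj b).obj U))
    (N := (Comod.conj hX.hopf b).obj (hX.comod U)) (X.deg_conj b U) ((X.phi b).app U).symm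
    fun ζ m => by
      obtain ⟨x, rfl⟩ := (X.phiE b U).surjective m
      have h : ((X.phi b).app U).symm.hom.hom.hom (X.phiE b U x) = x :=
        (X.phiE b U).symm_apply_apply x
      refine (congrArg _ h).trans ?_
      refine (Comod.coeff_conj b (hX.comod U) ζ x).trans ?_
      refine (congrArg _ (coeff_comod hX U ζ x)).trans ?_
      refine (hX.conjEquiv_coef b rfl ζ x).trans ?_
      refine (cast_coef hX rfl (X.deg_conj b U) _ _).symm.trans (congrArg _ ?_)
      exact (coeff_comod hX _ _ _).symm

/-- A Tannakian crossed category is equivalent to the category of comodules. -/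
noncomputable def equivalence : X.Equivalence hX.hopf.com where
  E := hX.toCom
  deg_obj _ := rfl
  -- The comodule Φ_β(F(U)) has underlying space F(U), so κ_β is the inverse of φ̇_β. Its coherences
  -- are those of φ̇_β, inverted.
  kappa b := NatIso.ofComponents (fun U => hX.toComConj b U)
    (fun {U V} f => Comod.hom_ext ((X.phi b).inv.naturality f))
  kappa_mul a b U := Comod.hom_ext (by
    rw [Comod.comp_f, Comod.comp_f, Comod.comp_f, Comod.eqToHom_f, Comod.eqToHom_f]
    have e : X.F.obj ((X.conj (a * b)).obj U) = X.F.obj ((X.conj a).obj ((X.conj b).obj U)) := by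
      rw [X.conj_mul]; rfl
    change (X.phi (a * b)).inv.app U = eqToHom e ≫ (X.phi a).inv.app ((X.conj b).obj U) ≫
      (X.phi b).inv.app U ≫ 𝟙 (X.F.obj U)
    rw [← cancel_epi ((X.phi (a * b)).hom.app U), Iso.hom_inv_id_app, X.phi_mul]
    simp)
  kappa_unit b := Comod.hom_ext (by
    rw [Comod.comp_f, Comod.comp_f, Comod.comp_f, Comod.eqToHom_f]
    change Functor.LaxMonoidal.ε X.F ≫ X.F.map (eqToHom (X.conj_unit b).symm) ≫
      (X.phi b).inv.app (𝟙_ C) = 𝟙 _ ≫ Functor.LaxMonoidal.ε X.F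
    rw [← Category.assoc, ← X.phi_unit, Category.assoc, Iso.hom_inv_id_app, Category.id_comp,
      Category.comp_id])
  kappa_tensor b U V := Comod.hom_ext (by
    rw [Comod.comp_f, Comod.comp_f, Comod.comp_f, Comod.comp_f, Comod.eqToHom_f]
    change Functor.LaxMonoidal.μ X.F _ _ ≫ X.F.map (eqToHom (X.conj_tensor b U V).symm) ≫
      (X.phi b).inv.app (U ⊗ V) = ((X.phi b).inv.app U ⊗ₘ (X.phi b).inv.app V) ≫ 𝟙 _ ≫
        Functor.LaxMonoidal.μ X.F U V
    rw [← cancel_epi ((X.phi b).hom.app U ⊗ₘ (X.phi b).hom.app V), ← Category.assoc,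
      ← Category.assoc, Category.assoc _ (Functor.LaxMonoidal.μ X.F _ _), ← X.phi_tensor,
      Category.assoc, Iso.hom_inv_id_app, Category.id_comp,
      MonoidalCategory.tensorHom_comp_tensorHom_assoc, Iso.hom_inv_id_app, Iso.hom_inv_id_app,
      MonoidalCategory.id_tensorHom_id, Category.id_comp, Category.comp_id])
  fiber_eq := rfl
  fiber_unit := by
    change Functor.LaxMonoidal.ε X.F ≫ 𝟙 _ = 𝟙 _ ≫ Functor.LaxMonoidal.ε X.F
    rw [Category.comp_id, Category.id_comp]
  fiber_tensor U V := by
    change Functor.LaxMonoidal.μ X.F U V ≫ 𝟙 _ = (𝟙 _ ⊗ₘ 𝟙 _) ≫ 𝟙 _ ≫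
      Functor.LaxMonoidal.μ X.F U V
    rw [MonoidalCategory.id_tensorHom_id, Category.comp_id, Category.id_comp, Category.id_comp]
  fiber_phi b U := by
    change (X.phi b).hom.app U ≫ 𝟙 _ ≫ (X.phi b).inv.app U = 𝟙 _ ≫ 𝟙 _
    rw [Category.id_comp, Category.id_comp, Iso.hom_inv_id_app]

end IsTannakian

end CrossedCatOverVect

/-! ### Convolution inverses and the antipode -/

namespace CrossedHopfAlgebra

variable {G : Type uG} [Group G] {k : Type w} [Field k]

section convolution

variable (H : CrossedHopfAlgebra.{uG, w, t} G k) {A : Type*} [AddCommGroup A] [Module k A]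
  [Coalgebra k A] {c d : G}

theorem mul_assoc_cast {a b c d : G} (hab : a * b = 1) (hbc : b * c = 1) (hd : 1 * c = d)
    (hd' : a * 1 = d) (x : H.comp a) (y : H.comp b) (z : H.comp c) :
    H.cast hd (H.mul 1 c (H.cast hab (H.mul a b (x ⊗ₜ y)) ⊗ₜ z)) =
      H.cast hd' (H.mul a 1 (x ⊗ₜ H.cast hbc (H.mul b c (y ⊗ₜ z)))) := by
  have h1 := H.mul_cast hab (rfl : c = c) (H.mul a b (x ⊗ₜ y)) z
  have h2 := H.mul_cast (rfl : a = a) hbc x (H.mul b c (y ⊗ₜ z))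
  rw [cast_rfl] at h1 h2
  rw [h1, h2, cast_cast, cast_cast, ← H.mul_assoc, cast_cast]

/-- A left inverse and a right inverse for the convolution product agree. -/
theorem eq_of_convolution (hcd : c * d = 1) (hdc : d * c = 1) (L R : A →ₗ[k] H.comp c)
    (T : A →ₗ[k] H.comp d)
    (hL : ∀ x, H.cast hcd (H.mul c d (TensorProduct.map L T (comul (R := k) x))) =
      counit (R := k) x • H.one)
    (hR : ∀ x, H.cast hdc (H.mul d c (TensorProduct.map T R (comul (R := k) x))) =
      counit (R := k) x • H.one) : L = R := by
  let μL : A ⊗[k] A →ₗ[k] H.comp 1 :=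
    (H.cast hcd).toLinearMap ∘ₗ (H.mul c d).toLinearMap ∘ₗ TensorProduct.map L T
  let μR : A ⊗[k] A →ₗ[k] H.comp 1 :=
    (H.cast hdc).toLinearMap ∘ₗ (H.mul d c).toLinearMap ∘ₗ TensorProduct.map T R
  let Φ : A ⊗[k] (A ⊗[k] A) →ₗ[k] H.comp c :=
    (H.cast (_root_.mul_one c)).toLinearMap ∘ₗ (H.mul c 1).toLinearMap ∘ₗ TensorProduct.map L μR
  let Ψ : (A ⊗[k] A) ⊗[k] A →ₗ[k] H.comp c :=
    (H.cast (_root_.one_mul c)).toLinearMap ∘ₗ (H.mul 1 c).toLinearMap ∘ₗ TensorProduct.map μL R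
  -- Writing ∗ for convolution, the argument is L = L ∗ (T ∗ R) = (L ∗ T) ∗ R = R. This step is the
  -- middle equality, `h1` and `h2` are the outer ones, and coassociativity joins them.
  have hΦΨ : ∀ s, Φ (TensorProduct.assoc k A A A s) = Ψ s := by
    refine fun s => LinearMap.congr_fun
      (f := Φ ∘ₗ (TensorProduct.assoc k A A A).toLinearMap) (g := Ψ)
      (TensorProduct.ext_threefold fun x y z => ?_) s
    exact (H.mul_assoc_cast hcd hdc (_root_.one_mul c) (_root_.mul_one c) (L x) (T y) (R z)).symm
  have h1 : ∀ s, Φ ((comul (R := k) (A := A)).lTensor A s) =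
      L (TensorProduct.rid k A ((counit (R := k) (A := A)).lTensor A s)) := by
    intro s
    induction s with
    | zero => simp
    | add x y hx hy => simp only [map_add, hx, hy]
    | tmul x y =>
      have h : μR (comul (R := k) y) = counit (R := k) y • H.one := hR y
      simp only [Φ, LinearMap.comp_apply, LinearMap.lTensor_tmul, TensorProduct.map_tmul, h,
        LinearEquiv.coe_coe, TensorProduct.rid_tmul, map_smul, TensorProduct.tmul_smul]
      exact congrArg _ (H.mul_one c (L x))
  have h2 : ∀ s, Ψ ((comul (R := k) (A := A)).rTensor A s) =
      R (TensorProduct.lid k A ((counit (R := k) (A := A)).rTensor A s)) := by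
    intro s
    induction s with
    | zero => simp
    | add x y hx hy => simp only [map_add, hx, hy]
    | tmul x y =>
      have h : μL (comul (R := k) x) = counit (R := k) x • H.one := hL x
      simp only [Ψ, LinearMap.comp_apply, LinearMap.rTensor_tmul, TensorProduct.map_tmul, h,
        LinearEquiv.coe_coe, TensorProduct.lid_tmul, map_smul, ← TensorProduct.smul_tmul']
      exact congrArg _ (H.one_mul c (R y))
  refine LinearMap.ext fun x => ?_
  have h3 := h1 (comul (R := k) x)
  have h4 := h2 (comul (R := k) x)
  rw [Coalgebra.lTensor_counit_comul, TensorProduct.rid_tmul, one_smul] at h3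
  rw [Coalgebra.rTensor_counit_comul, TensorProduct.lid_tmul, one_smul] at h4
  rw [← h3, ← h4, ← hΦΨ, Coalgebra.coassoc_apply]

end convolution

section

variable (H : CrossedHopfAlgebra.{uG, w, t} G k) {a b : G}

theorem lTensor_comul_map {A B B' : Type*} [AddCommGroup A] [Module k A] [Coalgebra k A]
    [AddCommGroup B] [Module k B] [Coalgebra k B] (e : A →ₗc[k] B) [AddCommGroup B']
    [Module k B'] (f : B →ₗ[k] B') (x : A) :
    TensorProduct.map e.toLinearMap (f ∘ₗ e.toLinearMap) (comul (R := k) x) =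
      f.lTensor B (comul (R := k) (e x)) := by
  rw [← CoalgHomClass.map_comp_comul_apply]
  exact (LinearMap.congr_fun (LinearMap.lTensor_comp_map _ f e.toLinearMap e.toLinearMap) _).symm

theorem mul_cast_map {A B : Type*} [AddCommGroup A] [Module k A] [AddCommGroup B] [Module k B]
    {a a' b b' c : G} (h : a = a') (h' : b = b') (hc : a' * b' = c) (f : A →ₗ[k] H.comp a)
    (g : B →ₗ[k] H.comp b) (t : A ⊗[k] B) :
    H.cast hc (H.mul a' b' (TensorProduct.map ((H.cast h).toLinearMap ∘ₗ f)
      ((H.cast h').toLinearMap ∘ₗ g) t)) =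
      H.cast (by rw [h, h', hc]) (H.mul a b (TensorProduct.map f g t)) := by
  subst h; subst h'; rfl

theorem conj_mul_map {A B : Type*} [AddCommGroup A] [Module k A] [AddCommGroup B] [Module k B]
    (c : G) (f : A →ₗ[k] H.comp a) (g : B →ₗ[k] H.comp b) (s : A ⊗[k] B) :
    H.mul _ _ (TensorProduct.map ((H.conj c a).toCoalgHom.toLinearMap ∘ₗ f)
      ((H.conj c b).toCoalgHom.toLinearMap ∘ₗ g) s) =
      H.cast (by group) (H.conj c (a * b) (H.mul a b (TensorProduct.map f g s))) := by
  induction s with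
  | zero => simp only [map_zero]
  | add x y hx hy => simp only [map_add, hx, hy]
  | tmul x y => exact (H.conj_mul c a b (f x) (g y)).symm

/-- Both composites are convolution inverses of φ_b, one on the left by multiplicativity of φ_b and
the other on the right because φ_b is a morphism of coalgebras. -/
theorem conj_antipode (b a : G) (x : H.comp a) :
    H.conj b a⁻¹ (H.antipode a x) =
      H.cast (by group) (H.antipode (b * a * b⁻¹) (H.conj b a x)) := by
  have e : (b * a * b⁻¹)⁻¹ = b * a⁻¹ * b⁻¹ := by group
  refine LinearMap.congr_fun
    (f := (H.conj b a⁻¹).toCoalgHom.toLinearMap ∘ₗ (H.antipode a).toLinearMap)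
    (g := (H.cast e).toLinearMap ∘ₗ (H.antipode (b * a * b⁻¹)).toLinearMap ∘ₗ
      (H.conj b a).toCoalgHom.toLinearMap)
    (H.eq_of_convolution (d := b * a * b⁻¹) (by group) (by group) _ _
      (H.conj b a).toCoalgHom.toLinearMap (fun x => ?_) fun x => ?_) x
  · have h := H.conj_mul_map b (H.antipode a).toLinearMap LinearMap.id (comul (R := k) x)
    rw [LinearMap.comp_id] at h
    rw [h, cast_cast]
    have h1 := H.antipode_mul a x
    have h2 : H.mul a⁻¹ a (TensorProduct.map (H.antipode a).toLinearMap LinearMap.id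
      (comul (R := k) x)) = H.cast (inv_mul_cancel a).symm (counit (R := k) x • H.one) := by
      rw [← h1, cast_cast]; rfl
    rw [h2, H.conj_cast rfl, cast_cast, map_smul, map_smul]
    exact congrArg _ (H.conj_one b)
  · have h := H.mul_cast_map (rfl : b * a * b⁻¹ = b * a * b⁻¹) e (c := 1) (by group)
      (H.conj b a).toCoalgHom.toLinearMap ((H.antipode (b * a * b⁻¹)).toLinearMap ∘ₗ
      (H.conj b a).toCoalgHom.toLinearMap) (comul (R := k) x)
    refine h.trans ?_
    have h1 := H.mul_antipode _ (H.conj b a x)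
    rw [CoalgHomClass.counit_comp_apply] at h1
    rw [← h1]
    exact congrArg (fun t => H.cast _ (H.mul _ _ t)) (lTensor_comul_map (H.conj b a).toCoalgHom
      (H.antipode (b * a * b⁻¹)).toLinearMap x)

end

end CrossedHopfAlgebra

/-! ### Dual comodules -/

namespace CrossedHopfAlgebra

open Coaction

variable {G : Type uG} [Group G] {k : Type w} [Field k]

/-- Linear maps between coalgebras which preserve the counit and reverse the comultiplication. -/
structure IsAntiCoalgHom {A B : Type*} [AddCommGroup A] [Module k A] [Coalgebra k A]
    [AddCommGroup B] [Module k B] [Coalgebra k B] (s : A →ₗ[k] B) : Prop where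
  counit_apply : ∀ x, counit (R := k) (s x) = counit (R := k) x
  comul_apply : ∀ x, comul (R := k) (s x) =
    TensorProduct.comm k B B (TensorProduct.map s s (comul (R := k) x))

theorem IsAntiCoalgHom.symm {A B : Type*} [AddCommGroup A] [Module k A] [Coalgebra k A]
    [AddCommGroup B] [Module k B] [Coalgebra k B] {e : A ≃ₗ[k] B}
    (he : IsAntiCoalgHom e.toLinearMap) : IsAntiCoalgHom e.symm.toLinearMap where
  counit_apply x := by
    obtain ⟨x, rfl⟩ := e.surjective x
    exact (congrArg _ (e.symm_apply_apply x)).trans (he.counit_apply x).symm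
  comul_apply x := by
    obtain ⟨x, rfl⟩ := e.surjective x
    have h := he.comul_apply x
    rw [LinearEquiv.coe_coe] at h
    rw [h, LinearEquiv.coe_coe, LinearEquiv.symm_apply_apply]
    generalize comul (R := k) x = t
    induction t with
    | zero => simp only [map_zero]
    | add x y hx hy => simp only [map_add, ← hx, ← hy]
    | tmul x y => simp

theorem IsAntiCoalgHom.comp_cast {H : CrossedHopfAlgebra.{uG, w, t} G k} {A : Type*}
    [AddCommGroup A] [Module k A] [Coalgebra k A] {a b : G} (h : a = b) {s : H.comp b →ₗ[k] A}
    (hs : IsAntiCoalgHom s) : IsAntiCoalgHom (s ∘ₗ (H.cast h).toLinearMap) := by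
  subst h; exact hs

section dualCoeff

open Module

variable {A B V : Type*} [AddCommGroup A] [Module k A] [AddCommGroup B] [Module k B]
  [AddCommGroup V] [Module k V] [Module.Finite k V]

/-- The matrix coefficients of the dual. -/
noncomputable def dualCoeff (c : Dual k V →ₗ[k] V →ₗ[k] A) (s : A →ₗ[k] B) :
    Dual k (Dual k V) →ₗ[k] Dual k V →ₗ[k] B :=
  (c.compr₂ s).flip ∘ₗ (evalEquiv k V).symm.toLinearMap

theorem dualCoeff_apply (c : Dual k V →ₗ[k] V →ₗ[k] A) (s : A →ₗ[k] B) (v : V) (ξ : Dual k V) :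
    dualCoeff c s (evalEquiv k V v) ξ = s (c ξ v) := by
  rw [dualCoeff, LinearMap.comp_apply, LinearEquiv.coe_coe, LinearEquiv.symm_apply_apply]
  rfl

theorem coord_dualBasis {ι : Type*} [Finite ι] [DecidableEq ι] (e : Basis ι k V) (i : ι) :
    e.dualBasis.coord i = evalEquiv k V (e i) := by
  refine e.dualBasis.ext fun j => ?_
  simp [Finsupp.single_apply]

variable [Coalgebra k A] [Coalgebra k B]

/-- Passing to the dual exchanges vectors and functionals, which reverses the order of the two legs;
the antimorphism `s` reverses it again. This is proved in the dual basis and moved to an arbitrary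
one. -/
theorem comul_dualCoeff (c : Dual k V →ₗ[k] V →ₗ[k] A) {s : A →ₗ[k] B} (hs : IsAntiCoalgHom s)
    {ι κ : Type*} [Fintype ι] [Fintype κ] (e : Basis ι k V)
    (hc : ∀ ξ v, comul (R := k) (c ξ v) = ∑ i, c (e.coord i) v ⊗ₜ[k] c ξ (e i))
    (f : Basis κ k (Dual k V)) (ζ : Dual k (Dual k V)) (ξ : Dual k V) :
    comul (R := k) (dualCoeff c s ζ ξ) =
      ∑ i, dualCoeff c s (f.coord i) ξ ⊗ₜ[k] dualCoeff c s ζ (f i) := by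
  classical
  obtain ⟨v, rfl⟩ := (evalEquiv k V).surjective ζ
  refine Eq.trans ?_ (sum_coord_eq e.dualBasis f ((TensorProduct.mk k _ _).compl₁₂
    ((dualCoeff c s).flip ξ) (dualCoeff c s (evalEquiv k V v))))
  rw [dualCoeff_apply, hs.comul_apply, hc, map_sum, map_sum]
  refine Finset.sum_congr rfl fun i _ => ?_
  rw [TensorProduct.map_tmul, TensorProduct.comm_tmul, LinearMap.compl₁₂_apply,
    LinearMap.flip_apply, coord_dualBasis, dualCoeff_apply, dualCoeff_apply]
  congr 3
  exact (congrArg c (congrFun e.coe_dualBasis i)).symm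

theorem counit_dualCoeff (c : Dual k V →ₗ[k] V →ₗ[k] A) {s : A →ₗ[k] B} (hs : IsAntiCoalgHom s)
    (hc : ∀ ξ v, counit (R := k) (c ξ v) = ξ v) (ζ : Dual k (Dual k V)) (ξ : Dual k V) :
    counit (R := k) (dualCoeff c s ζ ξ) = ζ ξ := by
  obtain ⟨v, rfl⟩ := (evalEquiv k V).surjective ζ
  rw [dualCoeff_apply, hs.counit_apply, hc]
  rfl

end dualCoeff

section contraction

open Module

variable {A B Z Z' V W : Type*} [AddCommGroup A] [Module k A] [AddCommGroup B] [Module k B]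
  [AddCommGroup Z] [Module k Z] [AddCommGroup Z'] [Module k Z'] [AddCommGroup V] [Module k V]
  [AddCommGroup W] [Module k W]

/-- The tensor product of coactions. -/
noncomputable abbrev tensorCoaction (mu : A ⊗[k] B →ₗ[k] Z) (r : V →ₗ[k] A ⊗[k] V)
    (q : W →ₗ[k] B ⊗[k] W) : V ⊗[k] W →ₗ[k] Z ⊗[k] (V ⊗[k] W) :=
  mu.rTensor (V ⊗[k] W) ∘ₗ (TensorProduct.tensorTensorTensorComm k _ _ _ _).toLinearMap ∘ₗ
    TensorProduct.map r q

theorem slice_tensorCoaction (mu : A ⊗[k] B →ₗ[k] Z) (r : V →ₗ[k] A ⊗[k] V)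
    (q : W →ₗ[k] B ⊗[k] W) {ι : Type*} [Fintype ι] (e : Basis ι k V) (β : V ⊗[k] W →ₗ[k] k)
    (x : V) (y : W) : slice Z β (tensorCoaction mu r q (x ⊗ₜ y)) =
      ∑ i, mu (slice A (e.coord i) (r x) ⊗ₜ slice B (β ∘ₗ TensorProduct.mk k V W (e i)) (q y)) := by
  have h : β = ∑ i, TensorProduct.dualDistrib k V W
      (e.coord i ⊗ₜ (β ∘ₗ TensorProduct.mk k V W (e i))) := by
    refine TensorProduct.ext' fun x y => ?_
    conv_lhs => rw [← e.sum_repr x, TensorProduct.sum_tmul, map_sum]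
    rw [LinearMap.sum_apply]
    refine Finset.sum_congr rfl fun i _ => ?_
    rw [← TensorProduct.smul_tmul', map_smul]
    rfl
  conv_lhs => rw [h, slice_sum]
  exact Finset.sum_congr rfl fun i _ => slice_tensor mu r q _ _ x y

/-- The contraction `v ⊗ ξ ↦ ξ(v)`. -/
noncomputable def contract (V : Type*) [AddCommGroup V] [Module k V] :
    V ⊗[k] Dual k V →ₗ[k] k :=
  contractLeft k V ∘ₗ (TensorProduct.comm k V (Dual k V)).toLinearMap

variable [Coalgebra k A] [Module.Finite k V] {r : V →ₗ[k] A ⊗[k] V} {s : A →ₗ[k] B}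
  {q : Dual k V →ₗ[k] B ⊗[k] Dual k V}

/-- Invariance of the contraction: expanding in a basis turns its coefficient into the product of x'
and s(x''), which `hc` reduces to the counit. With `s` the antipode this is the axiom h'S(h'') =
ε(h)1. -/
theorem slice_contract (hr : IsCoassoc r) (hr' : IsCounital r)
    (hq : ∀ v ξ, slice B (evalEquiv k V v) (q ξ) = s (slice A ξ (r v)))
    (mu : A ⊗[k] B →ₗ[k] Z) (c : Z →ₗ[k] Z') (z : Z')
    (hc : ∀ x, c (mu (s.lTensor A (comul (R := k) x))) = counit (R := k) x • z) (ζ : Dual k k)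
    (t : V ⊗[k] Dual k V) : ζ (contract V t) • z =
      c (slice Z (ζ ∘ₗ contract V) (tensorCoaction mu r q t)) := by
  induction t with
  | zero => simp only [map_zero, zero_smul]
  | add x y hx hy => simp only [map_add, add_smul, hx, hy]
  | tmul x ξ =>
    let e := Module.finBasis k V
    have h0 : ∀ y : k, ζ y = ζ 1 * y := fun y => by
      conv_lhs => rw [← _root_.mul_one y, ← smul_eq_mul, map_smul, smul_eq_mul, mul_comm]
    have h1 : ∀ i, (ζ ∘ₗ contract V) ∘ₗ TensorProduct.mk k V (Dual k V) (e i) =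
        ζ 1 • evalEquiv k V (e i) := fun i => LinearMap.ext fun η => h0 (η (e i))
    have h2 : slice Z (ζ ∘ₗ contract V) (tensorCoaction mu r q (x ⊗ₜ[k] ξ)) =
        ζ 1 • mu (s.lTensor A (comul (R := k) (slice A ξ (r x)))) := by
      rw [slice_tensorCoaction mu r q e, comul_slice_basis hr e, map_sum, map_sum, Finset.smul_sum]
      refine Finset.sum_congr rfl fun i _ => ?_
      rw [h1, slice_smul, hq, LinearMap.lTensor_tmul, TensorProduct.tmul_smul, map_smul]
    rw [h2, map_smul, hc, counit_slice hr', smul_smul]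
    exact congrArg (· • z) (h0 _)

/-- Invariance of the canonical tensor, from the axiom S(h')h'' = ε(h)1 when `s` is the antipode. -/
theorem slice_coev (hr : IsCoassoc r) (hr' : IsCounital r)
    (hq : ∀ v ξ, slice B (evalEquiv k V v) (q ξ) = s (slice A ξ (r v)))
    (mu : B ⊗[k] A →ₗ[k] Z) (c : Z →ₗ[k] Z') (z : Z')
    (hc : ∀ x, c (mu (s.rTensor A (comul (R := k) x))) = counit (R := k) x • z) {ι : Type*}
    [Fintype ι] (e : Basis ι k V) (ζ : Dual k (Dual k V)) (ψ : Dual k V) :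
    c (slice (V := Dual k V ⊗[k] V) Z (TensorProduct.dualDistrib k (Dual k V) V (ζ ⊗ₜ ψ))
      (tensorCoaction mu q r (∑ i, e.coord i ⊗ₜ[k] e i))) = ζ ψ • z := by
  obtain ⟨v, rfl⟩ := (evalEquiv k V).surjective ζ
  have h : slice (V := Dual k V ⊗[k] V) Z (TensorProduct.dualDistrib k (Dual k V) V (evalEquiv k V v ⊗ₜ ψ))
      (tensorCoaction mu q r (∑ i, e.coord i ⊗ₜ[k] e i)) =
      mu (s.rTensor A (comul (R := k) (slice A ψ (r v)))) := by
    rw [comul_slice_basis hr e, map_sum, map_sum, map_sum, map_sum]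
    refine Finset.sum_congr rfl fun i _ => ?_
    rw [slice_tensor, LinearMap.rTensor_tmul, hq]
  rw [h, hc, counit_slice hr']
  rfl

end contraction

namespace Comod

variable {H : CrossedHopfAlgebra.{uG, w, t} G k}

/-- The dual comodule with respect to an antimorphism of coalgebras. -/
noncomputable def dual (M : Comod H) {d : G} (s : H.comp M.deg →ₗ[k] H.comp d)
    (hs : IsAntiCoalgHom s) : Comod H :=
  mkOfCoeff d (FGModuleCat.FGModuleCatDual k M.V) (dualCoeff M.coeff s)
    (comul_dualCoeff M.coeff hs (Module.finBasis k M.V) (M.comul_coeff _)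
      (Module.finBasis k (Module.Dual k M.V)))
    (counit_dualCoeff M.coeff hs M.counit_coeff)

theorem coeff_dual (M : Comod H) {d : G} (s : H.comp M.deg →ₗ[k] H.comp d)
    (hs : IsAntiCoalgHom s) (v : M.V) (ξ : Module.Dual k M.V) :
    (M.dual s hs).coeff (Module.evalEquiv k M.V v) ξ = s (M.coeff ξ v) :=
  (coeff_mkOfCoeff _ _ _ _ _ _ _).trans (dualCoeff_apply M.coeff s v ξ)

variable (M : Comod H) (hs : IsAntiCoalgHom (H.antipode M.deg).toLinearMap)

/-- The evaluation of a comodule at its dual. -/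
noncomputable def evalHom : M ⊗ M.dual _ hs ⟶ 𝟙_ (Comod H) :=
  homOfCoeff (M := M ⊗ M.dual _ hs) (N := 𝟙_ (Comod H)) (mul_inv_cancel M.deg)
    ((β_ M.V (FGModuleCat.FGModuleCatDual k M.V)).hom ≫ FGModuleCat.FGModuleCatEvaluation k M.V)
    fun ζ t => (coeff_unit ζ _).trans (slice_contract M.coassoc M.counit_coact
      (q := (M.dual _ hs).coact) (M.coeff_dual _ hs) (H.mul _ _).toLinearMap
      (H.cast _).toLinearMap H.one (H.mul_antipode M.deg) ζ t)

/-- The map `1 ↦ ∑ e_i^* ⊗ e_i`. -/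
noncomputable def coevSwap (V : Type*) [AddCommGroup V] [Module k V] [Module.Finite k V] :
    k →ₗ[k] Module.Dual k V ⊗[k] V :=
  (TensorProduct.comm k V (Module.Dual k V)).toLinearMap ∘ₗ coevaluation k V

theorem coevSwap_one (V : Type*) [AddCommGroup V] [Module k V] [Module.Finite k V] :
    coevSwap (k := k) V 1 = ∑ i, (Module.Basis.ofVectorSpace k V).coord i ⊗ₜ[k]
      Module.Basis.ofVectorSpace k V i := by
  rw [coevSwap, LinearMap.comp_apply, coevaluation_apply_one, map_sum]
  rfl

theorem dualDistrib_coevSwap_one (V : Type*) [AddCommGroup V] [Module k V] [Module.Finite k V]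
    (ζ : Module.Dual k (Module.Dual k V)) (ψ : Module.Dual k V) :
    TensorProduct.dualDistrib k (Module.Dual k V) V (ζ ⊗ₜ ψ) (coevSwap (k := k) V 1) = ζ ψ := by
  have key : ∀ {ι : Type _} [Fintype ι] (e : Module.Basis ι k V),
      ∑ i, ζ (e.coord i) * ψ (e i) = ζ ψ := fun e => by
    have h : ψ = ∑ i, ψ (e i) • e.coord i := e.ext fun l => by simp
    conv_rhs => rw [h, map_sum]
    exact Finset.sum_congr rfl fun i _ => by rw [map_smul, smul_eq_mul, mul_comm]
  rw [coevSwap_one, map_sum]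
  exact key (Module.Basis.ofVectorSpace k V)

theorem slice_map_coevSwap {A B V : Type*} [AddCommGroup A] [Module k A] [AddCommGroup B]
    [Module k B] [AddCommGroup V] [Module k V] [Module.Finite k V] (f : A →ₗ[k] B)
    (ζ : Module.Dual k (Module.Dual k V)) (ψ : Module.Dual k V) (a : A) :
    slice (V := Module.Dual k V ⊗[k] V) B
      (TensorProduct.dualDistrib k (Module.Dual k V) V (ζ ⊗ₜ ψ))
      (TensorProduct.map f (coevSwap (k := k) V) (a ⊗ₜ 1)) = ζ ψ • f a := by
  rw [TensorProduct.map_tmul, slice_tmul, dualDistrib_coevSwap_one]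

theorem coact_coevSwap (r : k) :
    tensorCoact (M.dual _ hs) M (coevSwap (k := k) M.V r) =
      TensorProduct.map (H.cast (inv_mul_cancel M.deg).symm).toLinearMap (coevSwap (k := k) M.V)
        (H.one ⊗ₜ r) := by
  refine LinearMap.congr_fun (f := tensorCoact (M.dual _ hs) M ∘ₗ coevSwap (k := k) M.V)
    (g := TensorProduct.map (H.cast (inv_mul_cancel M.deg).symm).toLinearMap
      (coevSwap (k := k) M.V) ∘ₗ TensorProduct.mk k _ _ H.one) (LinearMap.ext_ring ?_) r
  refine slice_ext_tensor (V := Module.Dual k M.V) (W := M.V) fun ζ ψ =>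
    (H.cast (inv_mul_cancel M.deg)).injective ?_
  have h := CrossedHopfAlgebra.slice_coev M.coassoc M.counit_coact (q := (M.dual _ hs).coact)
      (M.coeff_dual _ hs) (H.mul _ _).toLinearMap (H.cast (inv_mul_cancel M.deg)).toLinearMap H.one
      (H.antipode_mul M.deg) (Module.Basis.ofVectorSpace k M.V) ζ ψ
  rw [← coevSwap_one] at h
  refine h.trans (Eq.symm ?_)
  refine (congrArg (H.cast _) (slice_map_coevSwap
    (H.cast (inv_mul_cancel M.deg).symm).toLinearMap ζ ψ H.one)).trans ?_
  rw [map_smul]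
  exact congrArg _ (H.cast_cast _ _ _)

/-- The coevaluation of a comodule at its dual. -/
noncomputable def coevalHom : 𝟙_ (Comod H) ⟶ M.dual _ hs ⊗ M :=
  Hom.mk (M := 𝟙_ (Comod H)) (N := M.dual _ hs ⊗ M) (inv_mul_cancel M.deg).symm
    (FGModuleCat.FGModuleCatCoevaluation k M.V ≫
      (β_ (FGModuleCat.FGModuleCatDual k M.V) M.V).inv) (coact_coevSwap M hs)

/-- A comodule and its dual with respect to the antipode form an exact pairing. -/
noncomputable abbrev dualPairing : ExactPairing (M.dual _ hs) M :=
  letI : ExactPairing ((forget H).obj (M.dual _ hs)) ((forget H).obj M) :=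
    BraidedCategory.exactPairing_swap M.V (FGModuleCat.FGModuleCatDual k M.V)
  -- The zigzag identities hold for vector spaces, and the faithful forgetful functor reflects them.
  ExactPairing.ofFaithful (forget H) (evalHom M hs) (coevalHom M hs)
    ((Category.id_comp _).trans (Category.comp_id _)).symm
    ((Category.id_comp _).trans (Category.comp_id _)).symm

end Comod

end CrossedHopfAlgebra

/-! ### Comodules form an autonomous category -/

namespace CrossedHopfAlgebra

open Coaction

variable {G : Type uG} [Group G] {k : Type w} [Field k]
  {H : CrossedHopfAlgebra.{uG, w, t} G k}

/-- Writing `x` as an antipode reduces this to `conj_antipode`; what remains is transport along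
equalities in `G`. -/
theorem conj_antipode_symm (b a : G) (x : H.comp a) :
    H.conj b a⁻¹ ((H.antipode a⁻¹).symm (H.cast (inv_inv a).symm x)) =
      H.cast (by group) ((H.antipode (b * a * b⁻¹)⁻¹).symm
        (H.cast (inv_inv _).symm (H.conj b a x))) := by
  obtain ⟨y, rfl⟩ : ∃ y, x = H.cast (inv_inv a) (H.antipode a⁻¹ y) :=
    ⟨(H.antipode a⁻¹).symm (H.cast (inv_inv a).symm x), by
      rw [LinearEquiv.apply_symm_apply, cast_cast]; rfl⟩
  rw [cast_cast, cast_rfl, LinearEquiv.symm_apply_apply, H.conj_cast rfl, H.conj_antipode,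
    cast_cast, cast_cast]
  have key : ∀ {d e : G} (h : d = e) (h' : d⁻¹ = e⁻¹) (z : H.comp d),
      z = H.cast h.symm ((H.antipode e).symm (H.cast h' (H.antipode d z))) := by
    intro d e h h' z
    subst h
    exact ((H.antipode d).symm_apply_apply z).symm
  exact key (by group) _ _

namespace Comod

variable (hS : ∀ a, IsAntiCoalgHom (H.antipode a).toLinearMap)

/-- The inverse of the antipode. -/
noncomputable def antipodeInv (H : CrossedHopfAlgebra.{uG, w, t} G k) (a : G) :
    H.comp a →ₗ[k] H.comp a⁻¹ :=
  (H.antipode a⁻¹).symm.toLinearMap ∘ₗ (H.cast (inv_inv a).symm).toLinearMap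

theorem isAntiCoalgHom_antipodeInv (hS : ∀ a, IsAntiCoalgHom (H.antipode a).toLinearMap) (a : G) :
    IsAntiCoalgHom (antipodeInv H a) :=
  (hS a⁻¹).symm.comp_cast (H := H) _

/-- The right dual of a comodule. -/
noncomputable def rightDual (M : Comod H) : Comod H := M.dual _ (hS M.deg)

/-- The left dual of a comodule. -/
noncomputable def leftDual (M : Comod H) : Comod H :=
  M.dual _ (isAntiCoalgHom_antipodeInv hS M.deg)

/-- A comodule is isomorphic to the right dual of its left dual. -/
noncomputable def isoRightDualLeftDual (M : Comod H) : M ≅ rightDual hS (leftDual hS M) :=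
  isoOfCoeff (M := M) (N := rightDual hS (leftDual hS M)) (inv_inv M.deg).symm
    (LinearEquiv.toFGModuleCatIso (Module.evalEquiv k M.V)) fun ζ m => by
      obtain ⟨ξ, rfl⟩ := (Module.evalEquiv k (Module.Dual k M.V)).surjective ζ
      refine (coeff_dual (leftDual hS M) _ (hS _) ξ (Module.evalEquiv k M.V m)).trans ?_
      refine (congrArg (H.antipode M.deg⁻¹)
        (coeff_dual M _ (isAntiCoalgHom_antipodeInv hS M.deg) m ξ)).trans ?_
      -- The left dual uses the inverse antipode and the right dual the antipode, so the double dual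
      -- carries the original coefficients.
      exact (H.antipode M.deg⁻¹).apply_symm_apply _

/-- The two comodules have the same underlying space and, by `hc`, the same coefficients, so they
are equal and not merely isomorphic. Strict preservation of duals by the conjugation depends on
this. -/
theorem conj_dual_obj (b : G) (M : Comod H) (s : ∀ a, H.comp a →ₗ[k] H.comp a⁻¹)
    (hs : ∀ a, IsAntiCoalgHom (s a))
    (hc : ∀ a x, H.conj b a⁻¹ (s a x) =
      H.cast (show (b * a * b⁻¹)⁻¹ = b * a⁻¹ * b⁻¹ by group) (s _ (H.conj b a x))) :
    (conj H b).obj (M.dual _ (hs M.deg)) = ((conj H b).obj M).dual _ (hs _) :=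
  obj_ext (show b * M.deg⁻¹ * b⁻¹ = (b * M.deg * b⁻¹)⁻¹ by group) rfl fun ξ => by
    refine slice_ext fun ζ => ?_
    obtain ⟨v, rfl⟩ := (Module.evalEquiv k M.V).surjective ζ
    refine (coeff_dual ((conj H b).obj M) _ (hs _) v ξ).trans (Eq.symm ?_)
    refine (slice_map _ _ _ _).trans ?_
    refine (congrArg (H.cast _) ((coeff_conj b (M.dual _ (hs M.deg)) _ ξ).trans
      (congrArg _ (coeff_dual M _ (hs M.deg) v ξ)))).trans ?_
    refine (congrArg (H.cast _) (hc M.deg (M.coeff ξ v))).trans ((H.cast_cast _ _ _).trans ?_)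
    exact congrArg (s (b * M.deg * b⁻¹)) (coeff_conj b M ξ v).symm

/-- The duals of comodules, compatible with the conjugation. -/
noncomputable def autonomous : H.com.toCrossedCat.Autonomous where
  leftDual := leftDual hS
  leftPairing M :=
    letI : ExactPairing (rightDual hS (leftDual hS M)) (leftDual hS M) :=
      dualPairing (leftDual hS M) (hS _)
    exactPairingCongrLeft (isoRightDualLeftDual hS M)
  conj_leftDual b M := conj_dual_obj b M (antipodeInv H) (isAntiCoalgHom_antipodeInv hS)
    (conj_antipode_symm b)
  conj_left_coev b M := hom_ext (by
    rw [comp_f, comp_f, eqToHom_f, eqToHom_f]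
    exact ((Category.id_comp _).trans (Category.comp_id _)).symm)
  conj_left_ev b M := hom_ext (by
    rw [comp_f, comp_f, eqToHom_f, eqToHom_f]
    exact ((Category.id_comp _).trans (Category.comp_id _)).symm)
  rightDual := rightDual hS
  rightPairing M := dualPairing M (hS _)
  conj_rightDual b M := conj_dual_obj b M (fun a => (H.antipode a).toLinearMap) hS
    (H.conj_antipode b)
  conj_right_coev b M := hom_ext (by
    rw [comp_f, comp_f, eqToHom_f, eqToHom_f]
    exact ((Category.id_comp _).trans (Category.comp_id _)).symm)
  conj_right_ev b M := hom_ext (by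
    rw [comp_f, comp_f, eqToHom_f, eqToHom_f]
    exact ((Category.id_comp _).trans (Category.comp_id _)).symm)

end Comod

end CrossedHopfAlgebra

namespace CrossedCatOverVect

open FiberFunctor CrossedHopfAlgebra

variable {G : Type uG} [Group G] {k : Type w} [Field k]
  {C : Type u} [Category.{v} C] [MonoidalCategory C]
  {X : CrossedCatOverVect G k C} (hX : X.IsTannakian)

/-- The antipode transposes coefficients, and in dual bases of F(U) and F(Y) transposition visibly
reverses Δ. For the comultiplication, `f` is the basis of F(Y) dual to `e` under the pairing. -/
theorem IsTannakian.isAntiCoalgHom_antipode (a : G) :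
    IsAntiCoalgHom (hX.hopf.antipode a).toLinearMap where
  counit_apply x := by
    obtain ⟨U, hU, ξ, u, rfl⟩ := hX.exists_coef x
    let A := hX.autonomous.some
    let _ := A.rightPairing U
    refine (congrArg _ (antipodeEquiv_coef A (A.rightDual U) U hU ξ u)).trans ?_
    refine (X.counit_coef _ _ _).trans ((ev_leftDualEquiv_symm X.F _ _ ξ u).trans ?_)
    exact (X.counit_coef hU ξ u).symm
  comul_apply x := by
    obtain ⟨U, hU, ξ, u, rfl⟩ := hX.exists_coef x
    let A := hX.autonomous.some
    let _ := A.rightPairing U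
    let Y := A.rightDual U
    have hY := X.deg_left_of_exactPairing Y U hU
    let e := Module.finBasis k (X.F.obj U)
    let f := e.dualBasis.map (leftDualEquiv X.F Y U).symm
    have h1 : ∀ i, f.coord i = ev X.F Y U (e i) := fun i => f.ext fun j => by
      rw [f.coord_apply, f.repr_self]
      simp [f, Finsupp.single_apply, eq_comm]
    refine (congrArg _ (antipodeEquiv_coef A Y U hU ξ u)).trans ?_
    refine (X.comul_coef hY f _ _).trans (Eq.symm ?_)
    refine (congrArg (fun t => TensorProduct.comm k _ _ (TensorProduct.map _ _ t))
      (X.comul_coef hU e ξ u)).trans ?_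
    refine (congrArg _ (map_sum _ _ _)).trans ((map_sum _ _ _).trans ?_)
    refine Finset.sum_congr rfl fun i _ => ?_
    rw [h1]
    refine congrArg₂ (fun s t => s ⊗ₜ[k] t) (antipodeEquiv_coef A Y U hU ξ (e i))
      ((antipodeEquiv_coef A Y U hU (e.coord i) u).trans ?_)
    congr 1
    simp [f]

end CrossedCatOverVect

/-! ### The category of comodules is Tannakian -/

section transfer

open Limits

variable {k : Type w} [Field k] {D : Type u} [Category.{v} D] {D' : Type u'} [Category.{v'} D']
  (I : D' ⥤ D) [I.IsEquivalence]

/-- The preadditive structure transported along an equivalence. -/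
@[reducible] noncomputable def preadditiveOfEquivalence [Preadditive D] : Preadditive D' :=
  Preadditive.ofFullyFaithful (Functor.FullyFaithful.ofFullyFaithful I)

theorem additive_of_preadditiveOfEquivalence [Preadditive D] :
    letI := preadditiveOfEquivalence I
    I.Additive :=
  letI := preadditiveOfEquivalence I
  { map_add := fun {_ _} _ _ => (Functor.FullyFaithful.ofFullyFaithful I).map_preimage _ }

/-- The abelian structure transported along an equivalence. -/
@[reducible] noncomputable def abelianOfEquiv [Abelian D] : Abelian D' :=
  letI := preadditiveOfEquivalence I
  haveI : HasFiniteProducts D' := ⟨fun _ => Adjunction.hasLimitsOfShape_of_equivalence I⟩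
  abelianOfEquivalence I

/-- The linear structure transported along an equivalence. -/
@[reducible] noncomputable def linearOfEquiv [Abelian D] [Linear k D] :
    letI := abelianOfEquiv I
    Linear k D' :=
  letI := abelianOfEquiv I
  let hI := Functor.FullyFaithful.ofFullyFaithful I
  { homModule := fun X Y => (hI.homEquiv (X := X) (Y := Y)).module k
    smul_comp := fun X Y Z r f g => I.map_injective (by
      rw [I.map_comp]
      refine (congrArg (· ≫ _) (hI.map_preimage _)).trans ((Linear.smul_comp _ _ _ _ _ _).trans ?_)
      refine Eq.trans ?_ (hI.map_preimage _).symm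
      exact congrArg _ (I.map_comp f g).symm)
    comp_smul := fun X Y Z f r g => I.map_injective (by
      rw [I.map_comp]
      refine (congrArg (_ ≫ ·) (hI.map_preimage _)).trans ((Linear.comp_smul _ _ _ _ _ _).trans ?_)
      refine Eq.trans ?_ (hI.map_preimage _).symm
      exact congrArg _ (I.map_comp f g).symm) }

theorem exact_of_equivalence [Abelian D] [Linear k D] (ω : D ⥤ FGModuleCat.{w} k) [ω.Additive]
    [ω.Linear k] [PreservesFiniteLimits ω] [PreservesFiniteColimits ω]
    (ω' : D' ⥤ FGModuleCat.{w} k) (i : I ⋙ ω ≅ ω') :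
    letI := abelianOfEquiv I
    letI := linearOfEquiv (k := k) I
    ω'.Additive ∧ ω'.Linear k ∧ PreservesFiniteLimits ω' ∧ PreservesFiniteColimits ω' := by
  let _ := abelianOfEquiv I
  let _ := linearOfEquiv (k := k) I
  have : I.Additive := additive_of_preadditiveOfEquivalence I
  have : I.Linear k :=
    { map_smul := fun _ _ => (Functor.FullyFaithful.ofFullyFaithful I).map_preimage _ }
  have : ω'.Additive := Functor.additive_of_iso i
  refine ⟨this, Functor.linear_of_iso k i, ?_, ?_⟩
  · exact preservesFiniteLimits_of_natIso i
  · exact preservesFiniteColimits_of_natIso i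

end transfer

namespace CrossedHopfAlgebra

open Limits

variable {G : Type uG} [Group G] {k : Type w} [Field k]
  (H : CrossedHopfAlgebra.{uG, w, t} G k)

/-- The forgetful functor commutes with tensoring by a comodule on the left. -/
noncomputable def tensorLeftCompFiber (M : Comod H) (c : G) :
    H.com.tensorLeftComp M c ⋙ H.com.fiber (H.com.deg M * c) ≅
      H.com.fiber c ⋙ tensorLeft M.V :=
  NatIso.ofComponents (fun _ => Iso.refl _) (fun {N P} f => by
    refine (Category.comp_id _).trans (Eq.trans ?_ (Category.id_comp _).symm)
    exact MonoidalCategory.id_tensorHom M.V (Comod.Hom.f f.hom))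

/-- The forgetful functor commutes with tensoring by a comodule on the right. -/
noncomputable def tensorRightCompFiber (M : Comod H) (c : G) :
    H.com.tensorRightComp M c ⋙ H.com.fiber (c * H.com.deg M) ≅
      H.com.fiber c ⋙ tensorRight M.V :=
  NatIso.ofComponents (fun _ => Iso.refl _) (fun {N P} f => by
    refine (Category.comp_id _).trans (Eq.trans ?_ (Category.id_comp _).symm)
    exact MonoidalCategory.tensorHom_id (Comod.Hom.f f.hom) M.V)

/-- The forgetful functor commutes with the conjugation. -/
noncomputable def conjCompFiber (b c : G) :
    H.com.conjComp b c ⋙ H.com.fiber (b * c * b⁻¹) ≅ H.com.fiber c :=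
  NatIso.ofComponents (fun _ => Iso.refl _) (fun _ =>
    (Category.comp_id _).trans (Category.id_comp _).symm)

instance (c : G) : (H.com.fiber c).Faithful :=
  inferInstanceAs (H.com.toCrossedCat.incl c ⋙ Comod.forget H).Faithful

instance (V : FGModuleCat.{w} k) : PreservesFiniteLimits (tensorLeft V) := by
  let _ : ExactPairing (FGModuleCat.FGModuleCatDual k V) V := BraidedCategory.exactPairing_swap _ _
  have := (tensorLeftAdjunction V (FGModuleCat.FGModuleCatDual k V)).rightAdjoint_preservesLimits
  infer_instance

instance (V : FGModuleCat.{w} k) : PreservesFiniteColimits (tensorLeft V) := by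
  let _ : ExactPairing (FGModuleCat.FGModuleCatDual k V) V := BraidedCategory.exactPairing_swap _ _
  have := (tensorLeftAdjunction (FGModuleCat.FGModuleCatDual k V) V).leftAdjoint_preservesColimits
  infer_instance

instance (V : FGModuleCat.{w} k) : PreservesFiniteLimits (tensorRight V) := by
  let _ : ExactPairing (FGModuleCat.FGModuleCatDual k V) V := BraidedCategory.exactPairing_swap _ _
  have := (tensorRightAdjunction (FGModuleCat.FGModuleCatDual k V) V).rightAdjoint_preservesLimits
  infer_instance

instance (V : FGModuleCat.{w} k) : PreservesFiniteColimits (tensorRight V) := by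
  have := (tensorRightAdjunction V (FGModuleCat.FGModuleCatDual k V)).leftAdjoint_preservesColimits
  infer_instance

variable [∀ a, Abelian (H.com.toCrossedCat.Component a)]

/-- A faithful exact functor between abelian categories reflects additivity and exactness, so a
functor of comodule categories inherits them from the functor it induces on vector spaces. -/
theorem exact_of_fiber {c d : G} [(H.com.fiber c).Additive] [PreservesFiniteLimits (H.com.fiber c)]
    [PreservesFiniteColimits (H.com.fiber c)] [(H.com.fiber d).Additive]
    [PreservesFiniteLimits (H.com.fiber d)] [PreservesFiniteColimits (H.com.fiber d)]
    (T : H.com.toCrossedCat.Component c ⥤ H.com.toCrossedCat.Component d)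
    (L : FGModuleCat.{w} k ⥤ FGModuleCat.{w} k) [L.Additive] [PreservesFiniteLimits L]
    [PreservesFiniteColimits L] (i : T ⋙ H.com.fiber d ≅ H.com.fiber c ⋙ L) :
    T.Additive ∧ PreservesFiniteLimits T ∧ PreservesFiniteColimits T := by
  have : (T ⋙ H.com.fiber d).Additive := Functor.additive_of_iso i.symm
  have : PreservesFiniteLimits (T ⋙ H.com.fiber d) := preservesFiniteLimits_of_natIso i.symm
  have : PreservesFiniteColimits (T ⋙ H.com.fiber d) := preservesFiniteColimits_of_natIso i.symm
  exact ⟨Functor.additive_of_comp_faithful T (H.com.fiber d),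
    preservesFiniteLimits_of_reflects_of_preserves T (H.com.fiber d),
    preservesFiniteColimits_of_reflects_of_preserves T (H.com.fiber d)⟩

variable [∀ a, Linear k (H.com.toCrossedCat.Component a)]

/-- Comodules form an abelian linear crossed category if the forgetful functors are exact. -/
theorem abelianLinear (h : ∀ a, (H.com.fiber a).Additive ∧ (H.com.fiber a).Linear k ∧
      PreservesFiniteLimits (H.com.fiber a) ∧ PreservesFiniteColimits (H.com.fiber a)) :
    ∃ A : H.com.toCrossedCat.AbelianLinear k, ∀ a,
      letI := A.abelian a
      letI := A.linear a
      (H.com.fiber a).Additive ∧ (H.com.fiber a).Linear k ∧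
        PreservesFiniteLimits (H.com.fiber a) ∧ PreservesFiniteColimits (H.com.fiber a) := by
  have (a : G) : (H.com.fiber a).Additive := (h a).1
  have (a : G) : PreservesFiniteLimits (H.com.fiber a) := (h a).2.2.1
  have (a : G) : PreservesFiniteColimits (H.com.fiber a) := (h a).2.2.2
  have hl (M : Comod H) (c : G) := H.exact_of_fiber _ _ (H.tensorLeftCompFiber M c)
  have hr (M : Comod H) (c : G) := H.exact_of_fiber _ _ (H.tensorRightCompFiber M c)
  have hc (b c : G) := H.exact_of_fiber _ _ (H.conjCompFiber b c ≪≫ (Functor.rightUnitor _).symm)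
  exact ⟨{
    tensorLeft_additive := fun M c => (hl M c).1
    tensorLeft_left_exact := fun M c => (hl M c).2.1
    tensorLeft_right_exact := fun M c => (hl M c).2.2
    tensorRight_additive := fun M c => (hr M c).1
    tensorRight_left_exact := fun M c => (hr M c).2.1
    tensorRight_right_exact := fun M c => (hr M c).2.2
    conj_additive := fun b c => (hc b c).1
    conj_left_exact := fun b c => (hc b c).2.1
    conj_right_exact := fun b c => (hc b c).2.2 }, h⟩

end CrossedHopfAlgebra

namespace CrossedCatOverVect

open CrossedHopfAlgebra

variable {G : Type uG} [Group G] {k : Type w} [Field k]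
  {C : Type u} [Category.{v} C] [MonoidalCategory C]
  {X : CrossedCatOverVect G k C} (hX : X.IsTannakian)

namespace IsTannakian

/-- The equivalence between the `α`-th components. -/
noncomputable def toComComp (a : G) :
    X.toCrossedCat.Component a ⥤ hX.hopf.com.toCrossedCat.Component a :=
  ObjectProperty.lift _ (X.toCrossedCat.incl a ⋙ hX.toCom) (fun U => U.property)

instance (a : G) : (hX.toComComp a).Faithful where
  map_injective h := ObjectProperty.hom_ext _ (hX.toCom.map_injective (congrArg (·.hom) h))

instance (a : G) : (hX.toComComp a).Full where
  map_surjective f := ⟨ObjectProperty.homMk (hX.toCom.preimage f.hom),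
    ObjectProperty.hom_ext _ (hX.toCom.map_preimage f.hom)⟩

instance (a : G) : (hX.toComComp a).EssSurj where
  mem_essImage M := by
    obtain ⟨U, ⟨e⟩⟩ := Functor.EssSurj.mem_essImage (F := hX.toCom) M.obj
    have hU : X.deg U = a := (hX.hopf.com.deg_eq_of_hom e.hom).trans M.property
    exact ⟨⟨U, hU⟩, ⟨ObjectProperty.isoMk _ e⟩⟩

instance (a : G) : (hX.toComComp a).IsEquivalence where

theorem isTannakian_com : hX.hopf.com.IsTannakian where
  autonomous := ⟨Comod.autonomous hX.isAntiCoalgHom_antipode⟩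
  faithful := inferInstanceAs (Comod.forget hX.hopf).Faithful
  abelian_exact := by
    obtain ⟨A, hA⟩ := hX.abelian_exact
    let _ (a : G) := A.abelian a
    let _ (a : G) := A.linear a
    -- The abelian and linear structures are pulled back along the inverse equivalence. The
    -- forgetful functor is then isomorphic to `I a` followed by the given fiber functor, hence
    -- exact.
    let I (a : G) := (hX.toComComp a).inv
    let _ (a : G) := abelianOfEquiv (I a)
    let _ (a : G) := linearOfEquiv (k := k) (I a)
    refine hX.hopf.abelianLinear fun a => ?_
    obtain ⟨_, _, _, _⟩ := hA a
    exact exact_of_equivalence (I a) (X.fiber a) (hX.hopf.com.fiber a)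
      (Functor.isoWhiskerRight (hX.toComComp a).asEquivalence.counitIso (hX.hopf.com.fiber a))

end IsTannakian

end CrossedCatOverVect

/-! ### Uniqueness -/

namespace CrossedHopfAlgebra

open Coaction

variable {G : Type uG} [Group G] {k : Type w} [Field k]

section coalgebra

variable {A V : Type*} [AddCommGroup A] [Module k A] [Coalgebra k A] [AddCommGroup V] [Module k V]

theorem slice_eq_slice_comul {r : V →ₗ[k] A ⊗[k] V} (hr : IsCoassoc r) (ξ : Module.Dual k V)
    (φ : Module.Dual k A) (v : V) :
    slice A (φ ∘ₗ slice A ξ ∘ₗ r) (r v) = slice A φ (comul (R := k) (slice A ξ (r v))) := by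
  rw [comul_slice hr, slice_lTensor]

/-- The vectors `v` with vanishing matrix coefficient `c(ξ, v)` form a subcomodule. -/
theorem slice_eq_zero_of_ker {r : V →ₗ[k] A ⊗[k] V} (hr : IsCoassoc r) (ξ ζ : Module.Dual k V)
    (hζ : ∀ v, slice A ξ (r v) = 0 → ζ v = 0) (v : V) (hv : slice A ξ (r v) = 0) :
    slice A ζ (r v) = 0 := by
  -- A functional vanishing on the kernel of v ↦ c(ξ, v) factors through that map. Its coefficient
  -- at `v` is therefore obtained by contracting Δ c(ξ, v), which is zero.
  obtain ⟨φ, hφ⟩ : ∃ φ : Module.Dual k A, φ ∘ₗ slice A ξ ∘ₗ r = ζ := by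
    have h : ζ ∈ LinearMap.range (slice A ξ ∘ₗ r).dualMap := by
      rw [LinearMap.range_dualMap_eq_dualAnnihilator_ker]
      exact (Submodule.mem_dualAnnihilator ζ).2 hζ
    exact h
  rw [← hφ, slice_eq_slice_comul hr, hv, map_zero, map_zero]

/-- Every element of a coalgebra is a matrix coefficient of a finite-dimensional comodule. -/
theorem exists_coaction (y : A) : ∃ (n : ℕ) (q : (Fin n → k) →ₗ[k] A ⊗[k] (Fin n → k))
    (ζ : Module.Dual k (Fin n → k)) (x : Fin n → k), IsCoassoc q ∧ IsCounital q ∧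
      slice A ζ (q x) = y := by
  let c (φ : Module.Dual k A) (t : A ⊗[k] A) : A := TensorProduct.lid k A (φ.rTensor A t)
  let L : Module.Dual k A →ₗ[k] A :=
    { toFun φ := c φ (comul (R := k) y)
      map_add' φ ψ := by simp [c, LinearMap.rTensor_add]
      map_smul' r φ := by simp [c, LinearMap.rTensor_smul] }
  have hc (φ : Module.Dual k A) (g : A →ₗ[k] A) (t : A ⊗[k] A) : c φ (g.lTensor A t) = g (c φ t) := by
    induction t with
    | zero => simp [c]
    | add s t hs ht => simp only [c, map_add] at hs ht ⊢; rw [hs, ht]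
    | tmul a b => simp [c]
  have hc' (φ ζ : Module.Dual k A) (t : A ⊗[k] A) : φ (slice A ζ t) = ζ (c φ t) := by
    induction t with
    | zero => simp [c]
    | add s t hs ht => simp only [c, map_add] at hs ht ⊢; rw [hs, ht]
    | tmul a b => simp [c, mul_comm]
  have hco : IsCoassoc (comul (R := k) (A := A)) := fun z => Coalgebra.coassoc_apply z
  have hcu : IsCounital (comul (R := k) (A := A)) := fun z => by
    rw [Coalgebra.rTensor_counit_comul, TensorProduct.lid_tmul, one_smul]
  -- `N` is the set of all (φ ⊗ id)Δy. It is finite-dimensional because Δy is a finite sum, and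
  -- contains `y` as the value at φ = ε. Coassociativity makes it a left subcomodule of `A`, and `y`
  -- is its coefficient of the vector `y` against the counit.
  let N : Submodule k A := LinearMap.range L
  have hN : Module.Finite k N := by
    obtain ⟨S, hS⟩ := TensorProduct.exists_finset (comul (R := k) y)
    have := FiniteDimensional.span_of_finite k (S.finite_toSet.image Prod.snd)
    refine Submodule.finiteDimensional_of_le (S₂ := Submodule.span k (Prod.snd '' (S : Set (A × A)))) ?_
    rintro _ ⟨φ, rfl⟩
    change TensorProduct.lid k A (φ.rTensor A (comul (R := k) y)) ∈ _
    rw [hS, map_sum, map_sum]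
    refine Submodule.sum_mem _ fun p hp => ?_
    rw [LinearMap.rTensor_tmul, TensorProduct.lid_tmul]
    exact Submodule.smul_mem _ _ (Submodule.subset_span ⟨p, hp, rfl⟩)
  -- Coordinates replace `N` by k^n, which lies in the universe of `k`, where comodules live; `A`
  -- may lie in another.
  let e := (Module.finBasis k N).equivFun
  let j : (Fin (Module.finrank k N) → k) →ₗ[k] A := N.subtype ∘ₗ e.symm.toLinearMap
  obtain ⟨q, hq, hq', h⟩ := exists_restrict hco hcu j
    (N.injective_subtype.comp e.symm.injective) fun ζ w hζ => by
      have hζ' (φ) : ζ (L φ) = 0 := by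
        have h := LinearMap.congr_fun hζ (e ⟨L φ, φ, rfl⟩)
        simpa [j] using h
      have h0 : slice A ζ (comul (R := k) y) = 0 :=
        (Module.forall_dual_apply_eq_zero_iff k _).1 fun φ => (hc' φ ζ _).trans (hζ' φ)
      obtain ⟨φ, hφ⟩ := (e.symm w).2
      have h1 := hc φ (slice A ζ ∘ₗ comul) (comul (R := k) y)
      rw [← comul_slice hco, h0] at h1
      change _ = slice A ζ (comul (R := k) (L φ)) at h1
      rw [hφ] at h1
      exact h1.symm.trans (by simp [c])
  obtain ⟨x, hx⟩ : ∃ x, j x = y := ⟨e ⟨y, counit, hcu y⟩, by simp [j]⟩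
  refine ⟨_, q, counit ∘ₗ j, x, hq, hq', ?_⟩
  rw [← h, hx, slice, LinearMap.comp_apply, Coalgebra.lTensor_counit_comul]
  simp

end coalgebra

end CrossedHopfAlgebra

/-! ### The comparison map from the coend to K -/

namespace CrossedCatOverVect

open FiberFunctor Coaction EndCheck CrossedHopfAlgebra

variable {G : Type uG} [Group G] {k : Type w} [Field k]
  {C : Type u} [Category.{v} C] [MonoidalCategory C]
  {X : CrossedCatOverVect G k C} {K : CrossedHopfAlgebra.{uG, w, t} G k}

namespace Equivalence

variable (Q : X.Equivalence K.com)

/-- The comodule attached to an object. -/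
abbrev toComod (U : C) : Comod K := Q.E.obj U

/-- The underlying space of the comodule is `F(U)`. -/
def fib (U : C) : X.F.obj U ≃ₗ[k] (Q.toComod U).V :=
  FGModuleCat.isoToLinearEquiv ((eqToIso Q.fiber_eq).app U)

theorem fib_map {U V : C} (f : U ⟶ V) (u : X.F.obj U) :
    Q.fib V ((X.F.map f).hom.hom u) = (Comod.Hom.f (Q.E.map f)).hom.hom (Q.fib U u) :=
  congrArg (fun h => h.hom.hom u) ((eqToIso Q.fiber_eq).hom.naturality f)

theorem fib_unit : letI := Q.monoidalE
    Q.fib (𝟙_ C) (unitVec X.F) =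
      (Comod.Hom.f (Functor.LaxMonoidal.ε Q.E)).hom.hom (1 : k) := by
  let _ := Q.monoidalE
  refine (congrArg (fun h => h.hom.hom (1 : k)) Q.fiber_unit).trans ?_
  rfl

theorem fib_tensor (U V : C) (u : X.F.obj U) (v : X.F.obj V) : letI := Q.monoidalE
    Q.fib (U ⊗ V) (mu X.F U V (u ⊗ₜ v)) =
      (Comod.Hom.f (Functor.LaxMonoidal.μ Q.E U V)).hom.hom (Q.fib U u ⊗ₜ[k] Q.fib V v) := by
  let _ := Q.monoidalE
  refine (congrArg (fun h => h.hom.hom (u ⊗ₜ[k] v)) (Q.fiber_tensor U V)).trans ?_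
  rfl

theorem fib_phi (b : G) (U : C) (u : X.F.obj U) :
    (Comod.Hom.f ((Q.kappa b).hom.app U)).hom.hom (Q.fib _ (X.phiE b U u)) = Q.fib U u :=
  congrArg (fun h => h.hom.hom u) (Q.fiber_phi b U)

variable {a b : G}

theorem deg_toComod {U : C} (hU : X.deg U = a) : (Q.toComod U).deg = a :=
  (Q.deg_obj U).trans hU

/-- The comparison map from the coend to `K`. -/
noncomputable def comparison (a : G) : EndCheck (X.fiber a) →ₗ[k] K.comp a :=
  X.liftCoef (fun U hU => ((Q.toComod U).coeff.compr₂ (K.cast (Q.deg_toComod hU)).toLinearMap).compl₁₂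
      (Q.fib U).symm.toLinearMap.dualMap (Q.fib U).toLinearMap)
    (fun U V hU hV f ξ u => by
      have h := Comod.coeff_hom (Q.E.map f) (ξ ∘ₗ (Q.fib V).symm.toLinearMap) (Q.fib U u)
      rw [← fib_map] at h
      refine (congrArg (K.cast (Q.deg_toComod hV)) h).trans ((K.cast_cast _ _ _).trans ?_)
      refine congrArg (fun z => K.cast (Q.deg_toComod hU) ((Q.toComod U).coeff z (Q.fib U u))) ?_
      refine LinearMap.ext fun z => ?_
      obtain ⟨z, rfl⟩ := (Q.fib U).surjective z
      refine (congrArg (fun z => ξ ((Q.fib V).symm z)) (Q.fib_map f z).symm).trans ?_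
      simp)

theorem comparison_coef {U : C} (hU : X.deg U = a) (ξ : Module.Dual k (X.F.obj U))
    (u : X.F.obj U) : Q.comparison a (X.coef U hU ξ u) =
      K.cast (Q.deg_toComod hU)
        ((Q.toComod U).coeff (ξ ∘ₗ (Q.fib U).symm.toLinearMap) (Q.fib U u)) :=
  X.liftCoef_coef _ _ U hU ξ u

end Equivalence

end CrossedCatOverVect

namespace CrossedHopfAlgebra

variable {G : Type uG} [Group G] {k : Type w} [Field k] (K : CrossedHopfAlgebra.{uG, w, t} G k)
  {a b : G}

theorem counit_cast (h : a = b) (x : K.comp a) :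
    counit (R := k) (K.cast h x) = counit (R := k) x := by
  subst h; rfl

theorem comul_cast (h : a = b) (x : K.comp a) : comul (R := k) (K.cast h x) =
    TensorProduct.map (K.cast h).toLinearMap (K.cast h).toLinearMap (comul (R := k) x) := by
  subst h
  exact (LinearMap.congr_fun TensorProduct.map_id _).symm

end CrossedHopfAlgebra

namespace CrossedCatOverVect

open FiberFunctor Coaction EndCheck CrossedHopfAlgebra

variable {G : Type uG} [Group G] {k : Type w} [Field k]
  {C : Type u} [Category.{v} C] [MonoidalCategory C]
  {X : CrossedCatOverVect G k C} {K : CrossedHopfAlgebra.{uG, w, t} G k}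

namespace Equivalence

variable (Q : X.Equivalence K.com) {a b : G}

/-- The comparison map is a morphism of coalgebras. -/
noncomputable def comparisonHom (a : G) : EndCheck (X.fiber a) →ₗc[k] K.comp a :=
  { Q.comparison a with
    counit_comp := coef_ext fun U hU ξ u => by
      refine (congrArg (counit (R := k)) (Q.comparison_coef hU ξ u)).trans ?_
      rw [counit_cast, Comod.counit_coeff, LinearMap.comp_apply, LinearEquiv.coe_coe,
        LinearEquiv.symm_apply_apply, counit_coef]
    map_comp_comul := coef_ext fun U hU ξ u => by
      let e := Module.finBasis k (X.F.obj U)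
      refine Eq.trans ?_ (congrArg (comul (R := k)) (Q.comparison_coef hU ξ u)).symm
      rw [comul_cast, Comod.comul_coeff _ (e.map (Q.fib U)), LinearMap.comp_apply,
        X.comul_coef hU e, map_sum, map_sum]
      refine Finset.sum_congr rfl fun i _ => ?_
      rw [TensorProduct.map_tmul, TensorProduct.map_tmul]
      refine congrArg₂ (· ⊗ₜ[k] ·) (Q.comparison_coef hU _ _) ?_
      refine (Q.comparison_coef hU _ _).trans ?_
      rw [Module.Basis.map_apply]
      rfl }

/-- If c(ξ, u) = 0 in K, the vectors with this property form a subcomodule containing u on which ξ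
vanishes, by the counit. It comes from an object with an arrow f to U, so u lies in the range of
F(f) while ξ ∘ F(f) = 0, and [ξ ⊗ u] = 0. -/
theorem comparison_injective (hX : X.IsTannakian) (a : G) :
    Function.Injective (Q.comparison a) := by
  have := Q.isEquivalence
  refine (injective_iff_map_eq_zero _).2 fun x hx => ?_
  obtain ⟨U, hU, ξ, u, rfl⟩ := hX.exists_coef x
  let M := Q.toComod U
  let ξ' : Module.Dual k M.V := ξ ∘ₗ (Q.fib U).symm.toLinearMap
  let W := LinearMap.ker (M.coeff ξ')
  have hu : Q.fib U u ∈ W := by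
    refine (K.cast (Q.deg_toComod hU)).injective ?_
    rw [map_zero]
    exact (Q.comparison_coef hU ξ u).symm.trans hx
  have hW : ∀ v : M.V, v ∈ W → ξ' v = 0 := fun v hv => by
    rw [← M.counit_coeff, show M.coeff ξ' v = 0 from hv, map_zero]
  obtain ⟨q, hq, hq', h⟩ := exists_restrict (r := M.coact) M.coassoc M.counit_coact W.subtype
    W.injective_subtype fun ζ w hζ => slice_eq_zero_of_ker (r := M.coact) M.coassoc ξ' ζ
      (fun v hv => LinearMap.congr_fun hζ ⟨v, hv⟩) w w.2
  let N : Comod K := ⟨M.deg, FGModuleCat.of k W, q, hq, hq'⟩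
  let i : N ⟶ M := Comod.homOfCoeff rfl (FGModuleCat.ofHom W.subtype) fun ζ m => h ζ m
  -- Essential surjectivity realizes the subcomodule by an object and fullness realizes its
  -- inclusion by `f`.
  let e := Q.E.objObjPreimageIso N
  let f := Q.E.preimage (e.hom ≫ i)
  have hf (z) : Q.fib U ((X.F.map f).hom.hom z) =
      W.subtype ((Comod.Hom.f e.hom).hom.hom (Q.fib _ z)) := by
    rw [Q.fib_map f z, Q.E.map_preimage]
    rfl
  let w : N.V := (⟨_, hu⟩ : W)
  have hfu : (X.F.map f).hom.hom ((Q.fib _).symm ((Comod.Hom.f e.inv).hom.hom w)) = u := by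
    refine (Q.fib U).injective ((hf _).trans ?_)
    rw [LinearEquiv.apply_symm_apply]
    exact congrArg (fun g => W.subtype ((Comod.Hom.f g).hom.hom w)) e.inv_hom_id
  rw [← hfu, X.coef_map f ((X.deg_eq_of_hom f).trans hU) hU]
  have h0 : ξ ∘ₗ (X.F.map f).hom.hom = 0 := LinearMap.ext fun z => by
    have := hW _ ((hf z).symm ▸ Subtype.property _ : Q.fib U ((X.F.map f).hom.hom z) ∈ W)
    simpa [ξ'] using this
  rw [h0, map_zero, LinearMap.zero_apply]

/-- The element `y` is a coefficient of a finite-dimensional comodule, and that comodule is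
isomorphic to the image of an object. -/
theorem comparison_surjective (a : G) : Function.Surjective (Q.comparison a) := fun y => by
  have := Q.isEquivalence
  obtain ⟨n, q, ζ, x, hq, hq', rfl⟩ := exists_coaction (k := k) y
  let M : Comod K := ⟨a, FGModuleCat.of k (Fin n → k), q, hq, hq'⟩
  let e := Q.E.objObjPreimageIso M
  have hU : X.deg (Q.E.objPreimage M) = a := (Q.deg_obj _).symm.trans e.hom.deg_eq
  refine ⟨X.coef _ hU (ζ ∘ₗ (Comod.Hom.f e.hom).hom.hom ∘ₗ (Q.fib _).toLinearMap)
    ((Q.fib _).symm ((Comod.Hom.f e.inv).hom.hom x)), (Q.comparison_coef hU _ _).trans ?_⟩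
  rw [LinearEquiv.apply_symm_apply]
  have h := Comod.coeff_hom e.hom ζ ((Comod.Hom.f e.inv).hom.hom x)
  have hx : (Comod.Hom.f e.hom).hom.hom ((Comod.Hom.f e.inv).hom.hom x) = x :=
    congrArg (fun g => (Comod.Hom.f g).hom.hom x) e.inv_hom_id
  refine Eq.trans (congrArg (fun z => K.cast _ (Comod.coeff _ z _)) ?_) (h.symm.trans
    (congrArg (M.coeff ζ) hx))
  exact LinearMap.ext fun z => congrArg (fun z => ζ ((Comod.Hom.f e.hom).hom.hom z))
    ((Q.fib _).apply_symm_apply z)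

/-- The comparison map as an isomorphism of coalgebras. -/
noncomputable def comparisonEquiv (hX : X.IsTannakian) (a : G) :
    EndCheck (X.fiber a) ≃ₗc[k] K.comp a :=
  { LinearEquiv.ofBijective (Q.comparison a)
      ⟨Q.comparison_injective hX a, Q.comparison_surjective a⟩, Q.comparisonHom a with }

end Equivalence

end CrossedCatOverVect

namespace CrossedHopfAlgebra

variable {G : Type uG} [Group G] {k : Type w} [Field k] (H : CrossedHopfAlgebra.{uG, w, t} G k)
  {K : CrossedHopfAlgebra.{uG, w, t'} G k}

/-- A multiplicative family of morphisms of coalgebras commutes with the antipodes. -/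
theorem map_antipode_of_map_mul (T : ∀ a, H.comp a →ₗc[k] K.comp a)
    (hmul : ∀ a b (x : H.comp a) (y : H.comp b),
      T (a * b) (H.mul a b (x ⊗ₜ y)) = K.mul a b (T a x ⊗ₜ T b y))
    (hone : T 1 H.one = K.one) (a : G) (x : H.comp a) :
    T a⁻¹ (H.antipode a x) = K.antipode a (T a x) := by
  have hcast {a b : G} (h : a = b) (x : H.comp a) : T b (H.cast h x) = K.cast h (T a x) := by
    subst h; rfl
  -- T ∘ S and S ∘ T are a left and a right convolution inverse of `T a`.
  refine LinearMap.congr_fun (f := (T a⁻¹).toLinearMap ∘ₗ (H.antipode a).toLinearMap)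
    (g := (K.antipode a).toLinearMap ∘ₗ (T a).toLinearMap)
    (K.eq_of_convolution (inv_mul_cancel a) (mul_inv_cancel a) _ _ (T a).toLinearMap
      (fun x => ?_) fun x => ?_) x
  · have hm (t : H.comp a ⊗[k] H.comp a) :
        K.mul a⁻¹ a (TensorProduct.map ((T a⁻¹).toLinearMap ∘ₗ (H.antipode a).toLinearMap)
          (T a).toLinearMap t) =
          T (a⁻¹ * a) (H.mul a⁻¹ a ((H.antipode a).toLinearMap.rTensor _ t)) := by
      induction t with
      | zero => simp only [map_zero]
      | add s t hs ht => simp only [map_add, hs, ht]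
      | tmul s t => exact (hmul _ _ _ _).symm
    rw [hm, ← hcast, H.antipode_mul, map_smul, hone]
  · rw [lTensor_comul_map, K.mul_antipode, CoalgHomClass.counit_comp_apply]

end CrossedHopfAlgebra

/-! ### The comparison map respects the crossed Hopf structure -/

namespace CrossedCatOverVect

open FiberFunctor Coaction EndCheck CrossedHopfAlgebra

variable {G : Type uG} [Group G] {k : Type w} [Field k]
  {C : Type u} [Category.{v} C] [MonoidalCategory C]
  {X : CrossedCatOverVect G k C} {K : CrossedHopfAlgebra.{uG, w, t} G k}

namespace Equivalence

variable (Q : X.Equivalence K.com) {a b : G}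

/-- The image of a coefficient may be computed on any comodule `M` mapping to E(U). The structure
maps μ, ε and κ⁻¹ of the equivalence serve as `f` for products, unit and conjugation. -/
theorem comparison_coef_of_hom {U : C} (hU : X.deg U = a) {M : Comod K} (f : M ⟶ Q.toComod U)
    {m : M.V} {u : X.F.obj U} (hm : (Comod.Hom.f f).hom.hom m = Q.fib U u)
    {ξ : Module.Dual k (X.F.obj U)} {ζ : Module.Dual k M.V}
    (hζ : ∀ x z, (Comod.Hom.f f).hom.hom x = Q.fib U z → ζ x = ξ z) :
    Q.comparison a (X.coef U hU ξ u) =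
      K.cast (f.deg_eq.trans (Q.deg_toComod hU)) (M.coeff ζ m) := by
  rw [comparison_coef, ← hm, Comod.coeff_hom, CrossedHopfAlgebra.cast_cast]
  refine congrArg (fun z => K.cast _ (M.coeff z m)) (LinearMap.ext fun x => ?_)
  exact (hζ x _ ((Q.fib U).apply_symm_apply _).symm).symm

variable (hX : X.IsTannakian)

theorem comparison_mul (x : EndCheck (X.fiber a)) (y : EndCheck (X.fiber b)) :
    Q.comparison (a * b) (hX.mulHom a b (x ⊗ₜ y)) =
      K.mul a b (Q.comparison a x ⊗ₜ Q.comparison b y) := by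
  obtain ⟨U, rfl, ξ, u, rfl⟩ := hX.exists_coef x
  obtain ⟨V, rfl, η, v, rfl⟩ := hX.exists_coef y
  let _ := Q.monoidalE
  have hx := Q.comparison_coef rfl ξ u
  have hy := Q.comparison_coef rfl η v
  rw [hX.mulHom_coef, hx, hy, K.mul_cast, ← Comod.coeff_tensor]
  refine Q.comparison_coef_of_hom _ (Functor.LaxMonoidal.μ Q.E U V) (Q.fib_tensor U V u v).symm ?_
  intro x z h
  have key : TensorProduct.dualDistrib k _ _ ((ξ ∘ₗ (Q.fib U).symm.toLinearMap) ⊗ₜ[k]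
      (η ∘ₗ (Q.fib V).symm.toLinearMap)) = tensorFun X.F ξ η ∘ₗ (Q.fib (U ⊗ V)).symm.toLinearMap ∘ₗ
        (Comod.Hom.f (Functor.LaxMonoidal.μ Q.E U V)).hom.hom := by
    refine TensorProduct.ext' fun x y => ?_
    obtain ⟨x, rfl⟩ := (Q.fib U).surjective x
    obtain ⟨y, rfl⟩ := (Q.fib V).surjective y
    refine Eq.trans ?_ (congrArg (fun z => tensorFun X.F ξ η ((Q.fib (U ⊗ V)).symm z))
      (Q.fib_tensor U V x y))
    simp
  refine (LinearMap.congr_fun key x).trans ?_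
  refine (congrArg (fun z => tensorFun X.F ξ η ((Q.fib (U ⊗ V)).symm z)) h).trans ?_
  rw [LinearEquiv.symm_apply_apply]

theorem comparison_one : Q.comparison 1 X.oneE = K.one := by
  let _ := Q.monoidalE
  refine (Q.comparison_coef_of_hom X.deg_unit (Functor.LaxMonoidal.ε Q.E) (m := (1 : k))
    Q.fib_unit.symm (ζ := LinearMap.id) ?_).trans ?_
  · intro (x : k) z h
    have hg {V : Type w} [AddCommGroup V] [Module k V] (g : k →ₗ[k] V) (c : k) : g c = c • g 1 := by
      rw [← map_smul, smul_eq_mul, _root_.mul_one]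
    have hz : z = (x : k) • unitVec X.F := (Q.fib (𝟙_ C)).injective (h.symm.trans (by
      rw [map_smul, fib_unit]
      exact hg (Comod.Hom.f (Functor.LaxMonoidal.ε Q.E)).hom.hom x))
    rw [hz, map_smul, unitFun_unitVec]
    exact (_root_.mul_one x).symm
  · refine (congrArg _ (Comod.coeff_unit (H := K) LinearMap.id 1)).trans ?_
    exact one_smul k K.one

theorem comparison_conj (b : G) (x : EndCheck (X.fiber a)) :
    Q.comparison _ (hX.conjEquiv b a x) = K.conj b a (Q.comparison a x) := by
  obtain ⟨U, rfl, ξ, u, rfl⟩ := hX.exists_coef x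
  have hx := Q.comparison_coef rfl ξ u
  have e (z) : (Comod.Hom.f ((Q.kappa b).inv.app U)).hom.hom (Q.fib U z) =
      Q.fib _ (X.phiE b U z) := by
    rw [← Q.fib_phi b U z]
    exact congrArg (fun g => (Comod.Hom.f g).hom.hom (Q.fib _ (X.phiE b U z)))
      ((Q.kappa b).hom_inv_id_app U)
  rw [hX.conjEquiv_coef, hx, K.conj_cast rfl, ← Comod.coeff_conj]
  refine Q.comparison_coef_of_hom _ ((Q.kappa b).inv.app U) (e u) ?_
  intro x z h
  obtain ⟨x, rfl⟩ := (Q.fib U).surjective x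
  rw [e, (Q.fib _).injective.eq_iff] at h
  rw [← h]
  exact (congrArg ξ ((Q.fib U).symm_apply_apply x)).trans
    (congrArg ξ ((X.phiE b U).symm_apply_apply x)).symm

/-- The isomorphism between the coend and a crossed Hopf algebra whose category of comodules is
equivalent to the given crossed category. -/
noncomputable def hopfIso : hX.hopf.Iso K where
  equiv := Q.comparisonEquiv hX
  map_mul _ _ := Q.comparison_mul hX
  map_one := Q.comparison_one
  map_conj b _ := Q.comparison_conj hX b
  -- Duals need not be compared: the antipode is determined by the product, unit and coalgebra
  -- structure.
  map_antipode _ := hX.hopf.map_antipode_of_map_mul Q.comparisonHom (fun _ _ => Q.comparison_mul hX)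
    Q.comparison_one _

end Equivalence

end CrossedCatOverVect

theorem mainTheorem1 {G : Type uG} [Group G] {k : Type w} [Field k]
    {C : Type u} [Category.{v} C] [MonoidalCategory C]
    (X : CrossedCatOverVect G k C) (hX : X.IsTannakian) :
    ∃ H : CrossedHopfAlgebra.{uG, w, max u w} G k,
      (∀ a : G, Nonempty (H.comp a ≃ₗc[k] EndCheck (X.fiber a))) ∧
      H.com.IsTannakian ∧
      Nonempty (X.Equivalence H.com) ∧
      ∀ K : CrossedHopfAlgebra.{uG, w, t} G k,
        Nonempty (X.Equivalence K.com) → Nonempty (H.Iso K) :=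
  ⟨hX.hopf, fun _ => ⟨CoalgEquiv.refl k _⟩, hX.isTannakian_com, ⟨hX.equivalence⟩,
    fun _ ⟨Q⟩ => ⟨Q.hopfIso hX⟩⟩
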